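/- Let $(\Sigma,r)$ be a finite ranked alphabet; $\Sigma_0$ is the set of symbols of rank $0$ (constants) and $\Sigma_>$ the set of symbols of positive rank. Regular tree expressions over $\Sigma$ are built from $0$ and the constants by $f(E_1,\dots,E_m)$ with $r(f)=m$, $E_1+E_2$, $E_1\cdot_c E_2$ and $E_1^{*_c}$ with $c\in\Sigma_0$. The tree language $[\![E]\!]$ is defined as usual: $[\![0]\!]=\emptyset$, $+$ is union, in $[\![E_1\cdot_c E_2]\!]$ every leaf $c$ of a tree of $[\![E_1]\!]$ is replaced, independently of the others, by a tree of $[\![E_2]\!]$, and $L^{*_c}=\bigcup_n L^{n_c}$ with $L^{0_c}=\{c\}$ and $L^{(n+1)_c}=L^{n_c}\cup L\cdot_c L^{n_c}$. Let $|E|$ be the number of nodes of the syntax tree of $E$, $\|E\|$ the number of occurrences of symbols of $\Sigma_>$ in $E$, and $R$ the maximal rank of the symbols of $\Sigma$ that appear in $E$. The linearized expression $\overline E$ arises from $E$ by marking the occurrences of symbols of $\Sigma_>$ from left to right with $1,2,\dots,\|E\|$; the marked symbols $f_j$ of $\overline E$ are the (non-constant) positions of $E$, with $r(f_j)=r(f)$.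 For a position $f_j$ and $1\le k\le r(f_j)$ let $$\mathrm{Follow}(E,f_j,k)=\{\,g \mid \exists\, t\in[\![\overline E]\!],\ \exists \text{ a subtree } s \text{ of } t \text{ with root } f_j \text{ whose } k\text{-th child has root } g\,\}.$$ Theorem. There are a program of a random access machine (unit cost; arithmetic restricted to addition and truncated subtraction) and a function $C:\mathbb N\to\mathbb N$ such that, for every finite ranked alphabet $(\Sigma,r)$ and every regular tree expression $E$ over $\Sigma$, the program, given $|\Sigma|$, $|E|$, the table of ranks, and $E$ in prefix notation (with the symbols of $\Sigma$ numbered arbitrarily), halts after at most $C(|\Sigma|)\cdot\max(1,R\cdot\|E\|)\cdot|E|$ steps and outputs the lists, without repetitions, of the elements of all the sets $\mathrm{Follow}(E,f_j,k)$, for all non-constant positions $f_j$ of $E$ and all $1\le k\le r(f_j)$. In particular, when the size of the alphabet is considered as constant, all these sets are computed in $O(R\cdot\|E\|\cdot|E|)$ time for expressions with at least one non-constant symbol. -/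

import Mathlib

/-! ### Trees over a ranked alphabet `(σ, r)` -/

/-- Trees over the ranked alphabet `(σ, r)`: a symbol `f` together with `r f` subtrees. -/
inductive RTree {σ : Type*} (r : σ → ℕ) : Type _
  | node (f : σ) (ts : Fin (r f) → RTree r) : RTree r

namespace RTree

/-- The root symbol of a tree. -/
def root {σ : Type*} {r : σ → ℕ} : RTree r → σ
  | node f _ => f

/-- `Subtree s t` means that `s` is a subtree of `t`, written `s ≼ t`. -/
inductive Subtree {σ : Type*} {r : σ → ℕ} : RTree r → RTree r → Prop
  | refl (t : RTree r) : Subtree t t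
  | child {s : RTree r} {f : σ} {ts : Fin (r f) → RTree r} (i : Fin (r f))
      (h : Subtree s (ts i)) : Subtree s (node f ts)

open Classical in
/-- The tree substitution `t{c ← L}` for a constant `c`: every occurrence of `c` in `t` is
replaced, independently of the others, by a tree of `L`. -/
noncomputable def subst {σ : Type*} {r : σ → ℕ} (c : σ) (L : Set (RTree r)) :
    RTree r → Set (RTree r)
  | node f ts =>
      if f = c then L
      else {u | ∃ us : Fin (r f) → RTree r, (∀ i, us i ∈ subst c L (ts i)) ∧ u = node f us}

/-- The `c`-product of two tree languages. -/
def cProd {σ : Type*} {r : σ → ℕ} (c : σ) (L₁ L₂ : Set (RTree r)) : Set (RTree r) :=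
  ⋃ t ∈ L₁, subst c L₂ t

/-- The language `{c}` of the one-node tree `c`, for a constant `c`. -/
def leafLang {σ : Type*} {r : σ → ℕ} (c : σ) : Set (RTree r) :=
  {t | ∃ ts : Fin (r c) → RTree r, t = node c ts}

/-- The iterated `c`-product: `{c}` at stage `0`, and `Lₙ ∪ L ·_c Lₙ` at stage `n + 1`. -/
def cIter {σ : Type*} {r : σ → ℕ} (c : σ) (L : Set (RTree r)) : ℕ → Set (RTree r)
  | 0 => leafLang c
  | n + 1 => cIter c L n ∪ cProd c L (cIter c L n)

/-- The `c`-closure of a tree language. -/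
def cClosure {σ : Type*} {r : σ → ℕ} (c : σ) (L : Set (RTree r)) : Set (RTree r) :=
  ⋃ n, cIter c L n

end RTree

/-! ### Regular tree expressions -/

/-- Regular tree expressions over `(σ, r)`. A constant `a` is `sym a` with no arguments. -/
inductive RegExp {σ : Type*} (r : σ → ℕ) : Type _
  | zero : RegExp r
  | sym (f : σ) (args : Fin (r f) → RegExp r) : RegExp r
  | plus (E₁ E₂ : RegExp r) : RegExp r
  | dot (c : σ) (hc : r c = 0) (E₁ E₂ : RegExp r) : RegExp r
  | star (c : σ) (hc : r c = 0) (E₁ : RegExp r) : RegExp r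

/-- The marked alphabet over `(σ, r)`: `(f, j)` with `1 ≤ j` is the symbol `f_j`, and `(c, 0)` is
the unmarked symbol `c`. Marking does not change the rank. -/
abbrev markedRank {σ : Type*} (r : σ → ℕ) : σ × ℕ → ℕ := fun p => r p.1

namespace RegExp

/-- The tree language denoted by an expression. -/
def lang {σ : Type*} {r : σ → ℕ} : RegExp r → Set (RTree r)
  | zero => ∅
  | sym f args => {t | ∃ ts : Fin (r f) → RTree r, (∀ i, ts i ∈ lang (args i)) ∧ t = .node f ts}
  | plus E₁ E₂ => lang E₁ ∪ lang E₂
  | dot c _ E₁ E₂ => RTree.cProd c (lang E₁) (lang E₂)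
  | star c _ E₁ => RTree.cClosure c (lang E₁)

/-- The size `|E|`: the number of nodes of the syntax tree. -/
def size {σ : Type*} {r : σ → ℕ} : RegExp r → ℕ
  | zero => 1
  | sym _ args => 1 + ∑ i, size (args i)
  | plus E₁ E₂ => 1 + size E₁ + size E₂
  | dot _ _ E₁ E₂ => 1 + size E₁ + size E₂
  | star _ _ E₁ => 1 + size E₁

/-- The alphabetic width `‖E‖`: the number of occurrences of symbols of positive rank. -/
def width {σ : Type*} {r : σ → ℕ} : RegExp r → ℕ
  | zero => 0
  | sym f args => (if r f = 0 then 0 else 1) + ∑ i, width (args i)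
  | plus E₁ E₂ => width E₁ + width E₂
  | dot _ _ E₁ E₂ => width E₁ + width E₂
  | star _ _ E₁ => width E₁

/-- The maximal rank `R` of the symbols that appear in `E`. -/
def maxRank {σ : Type*} {r : σ → ℕ} : RegExp r → ℕ
  | zero => 0
  | sym f args => max (r f) (Finset.univ.sup fun i => maxRank (args i))
  | plus E₁ E₂ => max (maxRank E₁) (maxRank E₂)
  | dot _ _ E₁ E₂ => max (maxRank E₁) (maxRank E₂)
  | star _ _ E₁ => maxRank E₁

/-- The occurrences of symbols of positive rank in `E`, from left to right. -/
def occurrences {σ : Type*} {r : σ → ℕ} : RegExp r → List σ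
  | zero => []
  | sym f args =>
      (if r f = 0 then [] else [f]) ++ (List.ofFn fun i => occurrences (args i)).flatten
  | plus E₁ E₂ => occurrences E₁ ++ occurrences E₂
  | dot _ _ E₁ E₂ => occurrences E₁ ++ occurrences E₂
  | star _ _ E₁ => occurrences E₁

/-- Mark the occurrences of symbols of positive rank from left to right by `j, j + 1, j + 2, …`;
constants stay unmarked. -/
def markFrom {σ : Type*} {r : σ → ℕ} : RegExp r → ℕ → RegExp (markedRank r)
  | zero, _ => zero
  | sym f args, j =>
      sym (f, if r f = 0 then 0 else j)
        (fun i : Fin (r f) => markFrom (args i) (j + 1 + ∑ l ∈ Finset.Iio i, (args l).width))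
  | plus E₁ E₂, j => plus (markFrom E₁ j) (markFrom E₂ (j + E₁.width))
  | dot c hc E₁ E₂, j => dot (c, 0) hc (markFrom E₁ j) (markFrom E₂ (j + E₁.width))
  | star c hc E₁, j => star (c, 0) hc (markFrom E₁ j)

/-- The linearized expression of `E`, with marks `1, 2, …, ‖E‖`. -/
def linearize {σ : Type*} {r : σ → ℕ} (E : RegExp r) : RegExp (markedRank r) :=
  E.markFrom 1

/-- The set `Follow(E, f, k)`: all roots of the child number `k` of a subtree with root `f`
of a tree denoted by `E`. Children are numbered from `0` here, so that `k : Fin (r f)` stands for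
the child number `k + 1` in the numbering that starts with `1`. -/
def follow {σ : Type*} {r : σ → ℕ} (E : RegExp r) (f : σ) (k : Fin (r f)) : Set σ :=
  {g | ∃ t ∈ E.lang, ∃ ts : Fin (r f) → RTree r,
    RTree.Subtree (.node f ts) t ∧ (ts k).root = g}

/-- The expression in prefix (Polish) notation, one token for each node of the syntax tree. A token
is a pair of numbers: the kind of the node (`0` for `0`, `1` for `+`, `2` for a product `·_c`,
`3` for a closure `*_c`, `4` for a symbol of the alphabet), and the number of its symbol of the
alphabet, if any. -/
def tokens {σ : Type*} {r : σ → ℕ} (num : σ → ℕ) : RegExp r → List (ℕ × ℕ)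
  | zero => [(0, 0)]
  | sym f args => (4, num f) :: (List.ofFn fun i => tokens num (args i)).flatten
  | plus E₁ E₂ => (1, 0) :: (tokens num E₁ ++ tokens num E₂)
  | dot c _ E₁ E₂ => (2, num c) :: (tokens num E₁ ++ tokens num E₂)
  | star c _ E₁ => (3, num c) :: tokens num E₁

end RegExp

/-! ### Random access machines with unit cost

Programs are written with structured control flow. The machine has registers and arrays of natural
numbers, named by natural numbers (a program mentions finitely many of them), and a write-only
output. Arithmetic is restricted to addition and subtraction. -/

/-- Programs of the machine. -/
inductive Prog : Type
  /-- do nothing -/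
  | skip : Prog
  /-- register `x` receives the number `v` -/
  | assign (x v : ℕ) : Prog
  /-- register `x` receives the sum of the registers `y` and `z` -/
  | add (x y z : ℕ) : Prog
  /-- register `x` receives the difference of the registers `y` and `z`, or `0` if it is
  negative -/
  | sub (x y z : ℕ) : Prog
  /-- register `x` receives the entry of array `a` whose index is in register `i` -/
  | load (x a i : ℕ) : Prog
  /-- the entry of array `a` whose index is in register `i` receives register `y` -/
  | store (a i y : ℕ) : Prog
  /-- append register `x` to the output -/
  | put (x : ℕ) : Prog
  /-- sequential composition -/
  | seq (p q : Prog) : Prog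
  /-- run `p` if register `x` is nonzero, and `q` otherwise -/
  | branch (x : ℕ) (p q : Prog) : Prog
  /-- run `p` as long as register `x` is nonzero -/
  | loop (x : ℕ) (p : Prog) : Prog

/-- Configurations of the machine: the registers, the arrays, and the output so far. -/
structure Machine where
  reg : ℕ → ℕ
  arr : ℕ → ℕ → ℕ
  out : List ℕ

namespace Machine

/-- Overwrite register `x` by `v`. -/
def setReg (m : Machine) (x v : ℕ) : Machine :=
  { m with reg := Function.update m.reg x v }

/-- Overwrite the entry of array `a` at index `i` by `v`. -/
def setArr (m : Machine) (a i v : ℕ) : Machine :=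
  { m with arr := Function.update m.arr a (Function.update (m.arr a) i v) }

end Machine

/-- `Runs p m t m'`: the program `p`, started in `m`, halts in `m'` after exactly `t` steps.
Every elementary instruction and every test of a register takes one step. -/
inductive Runs : Prog → Machine → ℕ → Machine → Prop
  | skip (m : Machine) : Runs .skip m 1 m
  | assign (m : Machine) (x v : ℕ) : Runs (.assign x v) m 1 (m.setReg x v)
  | add (m : Machine) (x y z : ℕ) :
      Runs (.add x y z) m 1 (m.setReg x (m.reg y + m.reg z))
  | sub (m : Machine) (x y z : ℕ) :
      Runs (.sub x y z) m 1 (m.setReg x (m.reg y - m.reg z))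
  | load (m : Machine) (x a i : ℕ) :
      Runs (.load x a i) m 1 (m.setReg x (m.arr a (m.reg i)))
  | store (m : Machine) (a i y : ℕ) :
      Runs (.store a i y) m 1 (m.setArr a (m.reg i) (m.reg y))
  | put (m : Machine) (x : ℕ) :
      Runs (.put x) m 1 { m with out := m.out ++ [m.reg x] }
  | seq {p q : Prog} {m m' m'' : Machine} {t t' : ℕ}
      (h : Runs p m t m') (h' : Runs q m' t' m'') : Runs (.seq p q) m (t + t') m''
  | branch_true {x : ℕ} {p q : Prog} {m m' : Machine} {t : ℕ}
      (hx : m.reg x ≠ 0) (h : Runs p m t m') : Runs (.branch x p q) m (t + 1) m'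
  | branch_false {x : ℕ} {p q : Prog} {m m' : Machine} {t : ℕ}
      (hx : m.reg x = 0) (h : Runs q m t m') : Runs (.branch x p q) m (t + 1) m'
  | loop_true {x : ℕ} {p : Prog} {m m' m'' : Machine} {t t' : ℕ}
      (hx : m.reg x ≠ 0) (h : Runs p m t m') (h' : Runs (.loop x p) m' t' m'') :
      Runs (.loop x p) m (t + t' + 1) m''
  | loop_false {x : ℕ} {p : Prog} {m : Machine} (hx : m.reg x = 0) :
      Runs (.loop x p) m 1 m

/-! ### Input and output -/

/-- The initial configuration for an expression `E` over an alphabet whose `n` symbols are numbered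
`0, …, n - 1`. Register `0` holds `n`, register `1` holds `|E|`, array `0` is the table of the
ranks, and the arrays `1` and `2` hold the two components of the tokens of `E` in prefix notation.
Everything else is `0`, and the output is empty. -/
def inputMachine {σ : Type*} {r : σ → ℕ} {n : ℕ} (num : σ ≃ Fin n) (E : RegExp r) : Machine where
  reg x := if x = 0 then n else if x = 1 then E.size else 0
  arr a i :=
    if a = 0 then (if h : i < n then r (num.symm ⟨i, h⟩) else 0)
    else if a = 1 then ((E.tokens fun s => (num s : ℕ)).getD i (0, 0)).1
    else if a = 2 then ((E.tokens fun s => (num s : ℕ)).getD i (0, 0)).2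
    else 0
  out := []

/-- The code of a marked symbol in the output: the constant number `i` is written `i + 1`, and the
position `f_j` is written `n + j`. -/
def outCode {σ : Type*} {n : ℕ} (num : σ ≃ Fin n) (g : σ × ℕ) : ℕ :=
  if g.2 = 0 then (num g.1 : ℕ) + 1 else n + g.2

/-- `IsFollowTable num E out`: the word `out` consists of one block for each position `f_j` of `E`
(in the order `j = 1, 2, …, ‖E‖`) and each child index `k` of it (in increasing order); the block
lists the elements of `Follow(E, f_j, k)`, each of them once and in any order, and ends
with `0`. -/
def IsFollowTable {σ : Type*} {r : σ → ℕ} {n : ℕ} (num : σ ≃ Fin n) (E : RegExp r)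
    (out : List ℕ) : Prop :=
  ∃ block : (p : σ × ℕ) → Fin (markedRank r p) → List (σ × ℕ),
    (∀ p ∈ E.linearize.occurrences, ∀ k : Fin (markedRank r p),
      (block p k).Nodup ∧ ∀ g, g ∈ block p k ↔ g ∈ E.linearize.follow p k) ∧
    out = E.linearize.occurrences.flatMap fun p =>
      (List.finRange (markedRank r p)).flatMap fun k => (block p k).map (outCode num) ++ [0]

/-! For one target, that is, a position `p` and a child number `k`, the set Follow is found by two
passes over the syntax tree. The work at a node is bounded in terms of the alphabet size `n` alone,
apart from a bounded amount for each child, and this is charged to the child. There are at most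
R·‖E‖ targets, which gives the time bound; the maximum with 1 pays for computing marks and arities
when there is no target.

The obstacle to a compositional computation is emptiness: a tree of E₁ with a leaf c contributes
nothing to E₁ ·_c E₂ if no tree can be put at that leaf. Languages are therefore studied under a
leaf constraint. `Poss p k L S g y` asks for a tree of `L` with all leaves in `S` that has root `g`
(y = 0), has `g` as child number `k` of `p` (y = 1), contains `g` (y = 2), or satisfies no further
condition (y = 3). In a product, the left factor is read under the constraint in which `d` is
allowed exactly if the right factor has a tree with leaves in `S`. An edge from `p` to `g` then lies
in the left tree, at the junction, or in a substituted tree (`poss_cProd_one`). For a closure the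
stages collapse, and `poss_cClosure` describes all four properties by `L` alone under the constraint
`starSet`.

The bottom-up pass tabulates these truth values for all `S` and all constants `g`; there are only
finitely many tables for given `n` (`represents_tree`). Marked symbols are not tabulated, since
there are too many of them. Instead a top-down pass gives every subexpression a context: the leaf
constraint, whether its trees occur inside trees of E, and whether they occur as child number `k` of
`p`. A position is listed if its own node receives the last flag and its subexpression has a tree
under the constraint; `posLab_mem_treeListOf` is the invariant. The constants in Follow are read off
the table of the root.

On the machine, the functions evaluated at the nodes are primitive recursive in codes of tables and
contexts. By `exists_computes` they have programs whose time is bounded in terms of the arguments,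
and by `exists_closed` the arguments stay below a bound depending only on `n`. Marks and child
numbers are unbounded in terms of `n`, but they reach these functions only through comparison bits
computed by explicit instructions. -/

/-! ### Leaf constraints and occurrences in trees -/

namespace RTree

variable {σ : Type*} {r : σ → ℕ}

/-- All symbols of rank `0` in the tree belong to `S`. -/
def Good (S : Set σ) : RTree r → Prop
  | node f ts => (r f = 0 → f ∈ S) ∧ ∀ i, Good S (ts i)

/-- The symbol `g` occurs in the tree. -/
def Occurs (g : σ) : RTree r → Prop
  | node f ts => f = g ∨ ∃ i, Occurs g (ts i)

/-- Somewhere in the tree, the child number `k` of a node `p` has root `g`. -/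
def Under (p : σ) (k : ℕ) (g : σ) : RTree r → Prop
  | node f ts => (f = p ∧ ∃ i : Fin (r f), (i : ℕ) = k ∧ (ts i).root = g) ∨
      ∃ i, Under p k g (ts i)

/-- The four properties of the tree that the algorithm keeps track of. -/
def Meets (p : σ) (k : ℕ) (g : σ) : ℕ → RTree r → Prop
  | 0, t => t.root = g
  | 1, t => Under p k g t
  | 2, t => Occurs g t
  | _, _ => True

open Classical in
/-- Replace every occurrence of `d` by the tree `v`. -/
noncomputable def replace (d : σ) (v : RTree r) : RTree r → RTree r
  | node f ts => if f = d then v else node f fun i => replace d v (ts i)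

/-- Put `d` into `S` if `b` holds, and remove it otherwise. -/
def upd (S : Set σ) (d : σ) (b : Prop) : Set σ :=
  {x | (x = d ∧ b) ∨ (x ≠ d ∧ x ∈ S)}

theorem Good.mono {S S' : Set σ} (h : S ⊆ S') {t : RTree r} (ht : Good S t) : Good S' t := by
  induction t with
  | node f ts ih => exact ⟨fun h0 => h (ht.1 h0), fun i => ih i (ht.2 i)⟩

theorem Good.of_not_occurs {S S' : Set σ} {d : σ} (h : ∀ x ∈ S, x ≠ d → x ∈ S') {t : RTree r}
    (ht : Good S t) (hd : ¬ Occurs d t) : Good S' t := by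
  induction t with
  | node f ts ih =>
    simp only [Occurs, not_or, not_exists] at hd
    exact ⟨fun h0 => h _ (ht.1 h0) hd.1, fun i => ih i (ht.2 i) (hd.2 i)⟩

theorem Good.mem_of_occurs {S : Set σ} {d : σ} (hd : r d = 0) {t : RTree r} (ht : Good S t)
    (h : Occurs d t) : d ∈ S := by
  induction t with
  | node f ts ih =>
    rcases h with rfl | ⟨i, hi⟩
    · exact ht.1 hd
    · exact ih i (ht.2 i) hi

theorem not_under_of_rank {p : σ} {k : ℕ} {g d : σ} (hd : r d = 0) (ts : Fin (r d) → RTree r) :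
    ¬ Under p k g (node d ts) := by
  rintro (⟨-, i, -⟩ | ⟨i, -⟩) <;> exact absurd i.2 (by omega)

theorem subst_self {d : σ} {L : Set (RTree r)} {t : RTree r} (h : ¬ Occurs d t) :
    t ∈ subst d L t := by
  induction t with
  | node f ts ih =>
    simp only [Occurs, not_or, not_exists] at h
    simp only [subst, if_neg h.1]
    exact ⟨ts, fun i => ih i (h.2 i), rfl⟩

/-- Substitution is independent at the different occurrences of `d`, but for existence statements
the same tree may be used at all of them. -/
theorem replace_mem_subst {d : σ} {L : Set (RTree r)} {v : RTree r} (hv : v ∈ L) (t : RTree r) :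
    replace d v t ∈ subst d L t := by
  induction t with
  | node f ts ih =>
    by_cases h : f = d
    · simpa only [subst, replace, if_pos h] using hv
    · simp only [subst, replace, if_neg h]
      exact ⟨_, ih, rfl⟩

theorem Good.replace {S : Set σ} {d : σ} {b : Prop} {v t : RTree r} (hv : Good S v)
    (ht : Good (upd S d b) t) : Good S (replace d v t) := by
  induction t with
  | node f ts ih =>
    by_cases h : f = d
    · simpa only [RTree.replace, if_pos h] using hv
    · simp only [RTree.replace, if_neg h]
      refine ⟨fun h0 => ?_, fun i => ih i (ht.2 i)⟩
      rcases ht.1 h0 with h' | h'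
      · exact absurd h'.1 h
      · exact h'.2

theorem root_replace_of_ne {d : σ} {v t : RTree r} (h : t.root ≠ d) :
    (replace d v t).root = t.root := by
  cases t with
  | node f ts => simp only [replace, if_neg (show f ≠ d from h)]; rfl

theorem root_replace_of_eq {d : σ} {v t : RTree r} (h : t.root = d) : replace d v t = v := by
  cases t with
  | node f ts => simp only [replace, if_pos (show f = d from h)]

theorem occurs_replace_of_ne {d g : σ} (hd : r d = 0) {v t : RTree r} (hg : g ≠ d)
    (h : Occurs g t) : Occurs g (replace d v t) := by
  induction t with
  | node f ts ih =>
    by_cases hf : f = d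
    · subst hf
      rcases h with h | ⟨i, -⟩
      · exact absurd h.symm hg
      · exact absurd i.2 (by omega)
    · simp only [replace, if_neg hf]
      exact h.imp id fun ⟨i, hi⟩ => ⟨i, ih i hi⟩

theorem occurs_replace {d g : σ} {v t : RTree r} (h : Occurs d t)
    (hv : Occurs g v) : Occurs g (replace d v t) := by
  induction t with
  | node f ts ih =>
    by_cases hf : f = d
    · simpa only [replace, if_pos hf] using hv
    · simp only [replace, if_neg hf]
      obtain ⟨i, hi⟩ := h.resolve_left hf
      exact Or.inr ⟨i, ih i hi⟩

theorem under_replace_of_ne {p : σ} {k : ℕ} {d g : σ} (hd : r d = 0) {v t : RTree r} (hg : g ≠ d)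
    (h : Under p k g t) : Under p k g (replace d v t) := by
  induction t with
  | node f ts ih =>
    by_cases hf : f = d
    · subst hf
      exact absurd h (not_under_of_rank hd ts)
    · simp only [replace, if_neg hf]
      refine h.imp (fun ⟨h1, i, h2, h3⟩ => ⟨h1, i, h2, ?_⟩) fun ⟨i, hi⟩ => ⟨i, ih i hi⟩
      rw [root_replace_of_ne (h3 ▸ hg), h3]

theorem under_replace_of_under_root {p : σ} {k : ℕ} {d g : σ} (hd : r d = 0) {v t : RTree r}
    (h : Under p k d t) (hv : v.root = g) : Under p k g (replace d v t) := by
  induction t with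
  | node f ts ih =>
    by_cases hf : f = d
    · subst hf
      exact absurd h (not_under_of_rank hd ts)
    · simp only [replace, if_neg hf]
      refine h.imp (fun ⟨h1, i, h2, h3⟩ => ⟨h1, i, h2, ?_⟩) fun ⟨i, hi⟩ => ⟨i, ih i hi⟩
      change (replace d v (ts i)).root = g
      rw [root_replace_of_eq h3, hv]

theorem under_replace_of_occurs {p : σ} {k : ℕ} {d g : σ} {v t : RTree r}
    (h : Occurs d t) (hv : Under p k g v) : Under p k g (replace d v t) := by
  induction t with
  | node f ts ih =>
    by_cases hf : f = d
    · simpa only [replace, if_pos hf] using hv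
    · simp only [replace, if_neg hf]
      obtain ⟨i, hi⟩ := h.resolve_left hf
      exact Or.inr ⟨i, ih i hi⟩

/-! ### Decomposition of the trees obtained by substitution -/

variable {d : σ} {L : Set (RTree r)} {S : Set σ} {p : σ} {k : ℕ} {g : σ}

/-- Each occurrence of `d` in `t` leaves a tree of `L` inside `u`, which inherits the constraint
`S`. So `d` can occur in `t` only if `L` has such a tree, and this is what `upd` records. -/
theorem good_of_subst (hd : r d = 0) (t : RTree r) : ∀ u ∈ subst d L t, Good S u →
    Good (upd S d (∃ v ∈ L, Good S v)) t := by
  induction t with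
  | node f ts ih =>
    intro u hu hg
    by_cases hf : f = d
    · subst hf
      simp only [subst, if_true] at hu
      refine ⟨fun _ => Or.inl ⟨rfl, u, hu, hg⟩, fun i => absurd i.2 (by omega)⟩
    · simp only [subst, if_neg hf] at hu
      obtain ⟨us, hus, rfl⟩ := hu
      exact ⟨fun h0 => Or.inr ⟨hf, hg.1 h0⟩, fun i => ih i _ (hus i) (hg.2 i)⟩

/-- No occurrence of `d` in `t` itself survives the substitution, whence `g ≠ d` in the first
alternative; a root `d` of `u` can only come from `L`. -/
theorem root_of_subst {t u : RTree r} (hu : u ∈ subst d L t) (hg : Good S u) (h : u.root = g) :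
    (g ≠ d ∧ t.root = g) ∨ (t.root = d ∧ ∃ v ∈ L, Good S v ∧ v.root = g) := by
  cases t with
  | node f ts =>
    by_cases hf : f = d
    · simp only [subst, if_pos hf] at hu
      exact Or.inr ⟨hf, u, hu, hg, h⟩
    · simp only [subst, if_neg hf] at hu
      obtain ⟨us, hus, rfl⟩ := hu
      exact Or.inl ⟨fun h' => hf (h' ▸ h), h⟩

theorem occurs_of_subst {t : RTree r} : ∀ u ∈ subst d L t, Good S u → Occurs g u →
    (g ≠ d ∧ Occurs g t) ∨ (Occurs d t ∧ ∃ v ∈ L, Good S v ∧ Occurs g v) := by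
  induction t with
  | node f ts ih =>
    intro u hu hg h
    by_cases hf : f = d
    · simp only [subst, if_pos hf] at hu
      exact Or.inr ⟨Or.inl hf, u, hu, hg, h⟩
    · simp only [subst, if_neg hf] at hu
      obtain ⟨us, hus, rfl⟩ := hu
      rcases h with h | ⟨i, hi⟩
      · exact Or.inl ⟨fun h' => hf (h' ▸ h), Or.inl h⟩
      · exact (ih i _ (hus i) (hg.2 i) hi).imp (fun h => ⟨h.1, Or.inr ⟨i, h.2⟩⟩)
          fun h => ⟨Or.inr ⟨i, h.1⟩, h.2⟩

/-- An edge of `u` lies within the part that stems from `t`, joins a node of `t` to the root of a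
substituted tree, or lies inside a substituted tree. -/
theorem under_of_subst {t : RTree r} : ∀ u ∈ subst d L t, Good S u → Under p k g u →
    (g ≠ d ∧ Under p k g t) ∨ (Under p k d t ∧ ∃ v ∈ L, Good S v ∧ v.root = g) ∨
      (Occurs d t ∧ ∃ v ∈ L, Good S v ∧ Under p k g v) := by
  induction t with
  | node f ts ih =>
    intro u hu hg h
    by_cases hf : f = d
    · simp only [subst, if_pos hf] at hu
      exact Or.inr (Or.inr ⟨Or.inl hf, u, hu, hg, h⟩)
    · simp only [subst, if_neg hf] at hu
      obtain ⟨us, hus, rfl⟩ := hu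
      rcases h with ⟨h1, i, h2, h3⟩ | ⟨i, hi⟩
      · rcases root_of_subst (hus i) (hg.2 i) h3 with h | h
        · exact Or.inl ⟨h.1, Or.inl ⟨h1, i, h2, h.2⟩⟩
        · exact Or.inr (Or.inl ⟨Or.inl ⟨h1, i, h2, h.1⟩, h.2⟩)
      · exact (ih i _ (hus i) (hg.2 i) hi).imp (fun h => ⟨h.1, Or.inr ⟨i, h.2⟩⟩)
          (Or.imp (fun h => ⟨Or.inr ⟨i, h.1⟩, h.2⟩) fun h => ⟨Or.inr ⟨i, h.1⟩, h.2⟩)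

/-! ### Properties of languages -/

/-- Some tree of `L` with leaves in `S` has the property number `y`. -/
def Poss (p : σ) (k : ℕ) (L : Set (RTree r)) (S : Set σ) (g : σ) (y : ℕ) : Prop :=
  ∃ t ∈ L, Good S t ∧ Meets p k g y t

theorem poss_three_iff : Poss p k L S g 3 ↔ ∃ t ∈ L, Good S t := by
  simp [Poss, Meets]

section Product

variable {L₁ L₂ : Set (RTree r)}

/-- The leaf constraint for the left factor of a product. -/
def leftSet (L₂ : Set (RTree r)) (S : Set σ) (d : σ) : Set σ := upd S d (∃ v ∈ L₂, Good S v)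

/-- If `L₂` has a tree with leaves in `S`, put it at every `d`. Otherwise the constraint forbids
`d`, so `t` has no `d` and is itself a result of the substitution. In both cases everything that
concerns symbols other than `d` survives. -/
theorem exists_mem_subst {t : RTree r} (ht : Good (leftSet L₂ S d) t) (hd : r d = 0) :
    ∃ u ∈ subst d L₂ t, Good S u ∧ ∀ g ≠ d, ∀ y, Meets p k g y t → Meets p k g y u := by
  by_cases hL : ∃ v ∈ L₂, Good S v
  · obtain ⟨v, hv, hg⟩ := hL
    refine ⟨_, replace_mem_subst hv t, hg.replace ht, fun g hne y h => ?_⟩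
    match y, h with
    | 0, h =>
      have h : t.root = g := h
      exact (root_replace_of_ne (h ▸ hne)).trans h
    | 1, h => exact under_replace_of_ne hd hne h
    | 2, h => exact occurs_replace_of_ne hd hne h
    | _ + 3, _ => trivial
  · have hocc : ¬ Occurs d t := fun h => by
      rcases ht.mem_of_occurs hd h with h | h
      · exact hL h.2
      · exact h.1 rfl
    refine ⟨t, subst_self hocc, ht.of_not_occurs (fun x hx hne => ?_) hocc, fun g _ y h => h⟩
    exact (hx.resolve_left fun h => hne h.1).2

theorem mem_cProd {u : RTree r} : u ∈ cProd d L₁ L₂ ↔ ∃ t ∈ L₁, u ∈ subst d L₂ t := by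
  simp [cProd]

theorem poss_cProd_of_ne (hd : r d = 0) (hg : g ≠ d) {y : ℕ}
    (h : Poss p k L₁ (leftSet L₂ S d) g y) : Poss p k (cProd d L₁ L₂) S g y := by
  obtain ⟨t, ht, hgood, hm⟩ := h
  obtain ⟨u, hu, hu', h⟩ := exists_mem_subst (p := p) (k := k) hgood hd
  exact ⟨u, mem_cProd.2 ⟨t, ht, hu⟩, hu', h g hg y hm⟩

theorem poss_cProd_three (hd : r d = 0) :
    Poss p k (cProd d L₁ L₂) S g 3 ↔ Poss p k L₁ (leftSet L₂ S d) g 3 := by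
  constructor
  · rintro ⟨u, hu, hg, -⟩
    obtain ⟨t, ht, hu⟩ := mem_cProd.1 hu
    exact ⟨t, ht, good_of_subst hd t u hu hg, trivial⟩
  · rintro ⟨t, ht, hgood, -⟩
    obtain ⟨u, hu, hu', -⟩ := exists_mem_subst (p := p) (k := k) hgood hd
    exact ⟨u, mem_cProd.2 ⟨t, ht, hu⟩, hu', trivial⟩

theorem poss_cProd_zero (hd : r d = 0) :
    Poss p k (cProd d L₁ L₂) S g 0 ↔ (g ≠ d ∧ Poss p k L₁ (leftSet L₂ S d) g 0) ∨
      (Poss p k L₁ (leftSet L₂ S d) d 0 ∧ Poss p k L₂ S g 0) := by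
  constructor
  · rintro ⟨u, hu, hg, h⟩
    obtain ⟨t, ht, hu⟩ := mem_cProd.1 hu
    have ht' := good_of_subst hd t u hu hg
    exact (root_of_subst hu hg h).imp (fun h => ⟨h.1, t, ht, ht', h.2⟩)
      fun h => ⟨⟨t, ht, ht', h.1⟩, h.2⟩
  · rintro (h | ⟨⟨t, ht, ht', h⟩, v, hv, hg, h'⟩)
    · exact poss_cProd_of_ne hd h.1 h.2
    · exact ⟨_, mem_cProd.2 ⟨t, ht, replace_mem_subst hv t⟩, hg.replace ht',
        (congrArg root (root_replace_of_eq h)).trans h'⟩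

/-- The first factor and the second factor can be examined separately because the substituted tree
may be chosen after the left tree, and the same one everywhere. -/
theorem poss_cProd_one (hd : r d = 0) :
    Poss p k (cProd d L₁ L₂) S g 1 ↔ (g ≠ d ∧ Poss p k L₁ (leftSet L₂ S d) g 1) ∨
      (Poss p k L₁ (leftSet L₂ S d) d 1 ∧ Poss p k L₂ S g 0) ∨
      (Poss p k L₁ (leftSet L₂ S d) d 2 ∧ Poss p k L₂ S g 1) := by
  constructor
  · rintro ⟨u, hu, hg, h⟩
    obtain ⟨t, ht, hu⟩ := mem_cProd.1 hu
    have ht' := good_of_subst hd t u hu hg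
    exact (under_of_subst u hu hg h).imp (fun h => ⟨h.1, t, ht, ht', h.2⟩)
      (Or.imp (fun h => ⟨⟨t, ht, ht', h.1⟩, h.2⟩) fun h => ⟨⟨t, ht, ht', h.1⟩, h.2⟩)
  · rintro (h | ⟨⟨t, ht, ht', h⟩, v, hv, hg, h'⟩ | ⟨⟨t, ht, ht', h⟩, v, hv, hg, h'⟩)
    · exact poss_cProd_of_ne hd h.1 h.2
    · exact ⟨_, mem_cProd.2 ⟨t, ht, replace_mem_subst hv t⟩, hg.replace ht',
        under_replace_of_under_root hd h h'⟩
    · exact ⟨_, mem_cProd.2 ⟨t, ht, replace_mem_subst hv t⟩, hg.replace ht',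
        under_replace_of_occurs h h'⟩

theorem poss_cProd_two (hd : r d = 0) :
    Poss p k (cProd d L₁ L₂) S g 2 ↔ (g ≠ d ∧ Poss p k L₁ (leftSet L₂ S d) g 2) ∨
      (Poss p k L₁ (leftSet L₂ S d) d 2 ∧ Poss p k L₂ S g 2) := by
  constructor
  · rintro ⟨u, hu, hg, h⟩
    obtain ⟨t, ht, hu⟩ := mem_cProd.1 hu
    have ht' := good_of_subst hd t u hu hg
    exact (occurs_of_subst u hu hg h).imp (fun h => ⟨h.1, t, ht, ht', h.2⟩)
      fun h => ⟨⟨t, ht, ht', h.1⟩, h.2⟩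
  · rintro (h | ⟨⟨t, ht, ht', h⟩, v, hv, hg, h'⟩)
    · exact poss_cProd_of_ne hd h.1 h.2
    · exact ⟨_, mem_cProd.2 ⟨t, ht, replace_mem_subst hv t⟩, hg.replace ht',
        occurs_replace h h'⟩

end Product

theorem Poss.mono {S' : Set σ} (hS : S ⊆ S') {y : ℕ} (h : Poss p k L S g y) :
    Poss p k L S' g y := by
  obtain ⟨t, ht, hg, h⟩ := h
  exact ⟨t, ht, hg.mono hS, h⟩

theorem upd_mono {b b' : Prop} (h : b → b') : upd S d b ⊆ upd S d b' :=
  fun _ hx => hx.imp (fun h' => ⟨h'.1, h h'.2⟩) id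

/-! ### The closure -/

/-- Some tree of the closure of `L` has its leaves in `S`. -/
def StarNonempty (L : Set (RTree r)) (S : Set σ) (d : σ) : Prop := d ∈ S ∨ ∃ v ∈ L, Good S v

/-- The leaf constraint for the trees of `L` that build a tree of the closure of `L`. -/
def starSet (L : Set (RTree r)) (S : Set σ) (d : σ) : Set σ := upd S d (StarNonempty L S d)

/-- The property number `y < 3` for the closure, in terms of the trees of `L`. -/
def StarPoss (p : σ) (k : ℕ) (L : Set (RTree r)) (S : Set σ) (d g : σ) : ℕ → Prop
  | 0 => (g = d ∧ d ∈ S) ∨ (g ≠ d ∧ Poss p k L (starSet L S d) g 0)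
  | 1 => (g ≠ d ∧ Poss p k L (starSet L S d) g 1) ∨
      (Poss p k L (starSet L S d) d 1 ∧
        ((g = d ∧ d ∈ S) ∨ (g ≠ d ∧ Poss p k L (starSet L S d) g 0)))
  | 2 => (g = d ∧ d ∈ S) ∨ (g ≠ d ∧ Poss p k L (starSet L S d) g 2)
  | _ => StarNonempty L S d

theorem poss_leafLang (hd : r d = 0) (y : ℕ) :
    Poss p k (leafLang d : Set (RTree r)) S g y ↔
      d ∈ S ∧ (y = 0 → g = d) ∧ y ≠ 1 ∧ (y = 2 → g = d) := by
  have hgood : ∀ ts : Fin (r d) → RTree r, Good S (node d ts) ↔ d ∈ S := fun ts =>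
    ⟨fun h => h.1 hd, fun h => ⟨fun _ => h, fun i => absurd i.2 (by omega)⟩⟩
  constructor
  · rintro ⟨-, ⟨ts, rfl⟩, hg, h⟩
    refine ⟨(hgood _).1 hg, ?_⟩
    match y, h with
    | 0, h => exact ⟨fun _ => Eq.symm h, by omega, by omega⟩
    | 1, h => exact absurd h (not_under_of_rank hd ts)
    | 2, h =>
      refine ⟨by omega, by omega, fun _ => ?_⟩
      rcases h with h | ⟨i, -⟩
      · exact h.symm
      · exact absurd i.2 (by omega)
    | _ + 3, _ => exact ⟨by omega, by omega, by omega⟩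
  · rintro ⟨hS, h0, h1, h2⟩
    refine ⟨node d fun i => absurd i.2 (by omega), ⟨_, rfl⟩, (hgood _).2 hS, ?_⟩
    match y with
    | 0 => exact (h0 rfl).symm
    | 1 => exact absurd rfl h1
    | 2 => exact Or.inl (h2 rfl).symm
    | _ + 3 => trivial

theorem poss_union {L' : Set (RTree r)} {y : ℕ} :
    Poss p k (L ∪ L') S g y ↔ Poss p k L S g y ∨ Poss p k L' S g y := by
  simp only [Poss, Set.mem_union, or_and_right, exists_or]

/-- At the first stage that has a tree with leaves in `S`, either this tree is `d` itself, or the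
previous stage offers nothing to substitute; then the tree of `L` used at the top contains no `d`
and already has its leaves in `S`. -/
theorem starNonempty_of_cIter (hd : r d = 0) (n : ℕ) (h : ∃ v ∈ cIter d L n, Good S v) :
    StarNonempty L S d := by
  induction n with
  | zero =>
    have := (poss_leafLang (p := d) (k := 0) (g := d) hd 3).1 (poss_three_iff.2 h)
    exact Or.inl this.1
  | succ n ih =>
    obtain ⟨v, hv | hv, hg⟩ := h
    · exact ih ⟨v, hv, hg⟩
    · obtain ⟨t, ht, hv⟩ := mem_cProd.1 hv
      by_cases hn : ∃ v ∈ cIter d L n, Good S v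
      · exact ih hn
      · refine Or.inr ⟨t, ht, (good_of_subst hd t v hv hg).mono ?_⟩
        exact fun x hx => (hx.resolve_left fun h => hn h.2).2

theorem leftSet_cIter_subset (hd : r d = 0) (n : ℕ) :
    leftSet (cIter d L n) S d ⊆ starSet L S d :=
  upd_mono (starNonempty_of_cIter hd n)

theorem cIter_mono {n n' : ℕ} (h : n ≤ n') : cIter d L n ⊆ cIter d L n' := by
  induction h with
  | refl => exact subset_rfl
  | step _ ih => exact ih.trans Set.subset_union_left

/-- If `d ∈ S`, the tree `d` of stage 0 serves. If not, a tree of `L` with leaves in `S` contains no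
`d`, so it is unchanged by substitution and appears at stage 1. -/
theorem exists_cIter_good (hd : r d = 0) (h : StarNonempty L S d) :
    ∃ v ∈ cIter d L 1, Good S v := by
  by_cases hS : d ∈ S
  · obtain ⟨v, hv, hg, -⟩ := (poss_leafLang (p := d) (k := 0) (g := d) (S := S) hd 3).2
      ⟨hS, by omega, by omega, by omega⟩
    exact ⟨v, Or.inl hv, hg⟩
  · obtain ⟨v, hv, hg⟩ := h.resolve_left hS
    exact ⟨v, Or.inr (mem_cProd.2 ⟨v, hv, subst_self fun h => hS (hg.mem_of_occurs hd h)⟩), hg⟩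

/-- The leaf constraint is stable from stage 1 on; this is why no fixed-point iteration is needed
for closures. -/
theorem leftSet_cIter (hd : r d = 0) {n : ℕ} (hn : 1 ≤ n) :
    leftSet (cIter d L n) S d = starSet L S d := by
  refine (leftSet_cIter_subset hd n).antisymm (upd_mono fun h => ?_)
  obtain ⟨v, hv, hg⟩ := exists_cIter_good hd h
  exact ⟨v, cIter_mono hn hv, hg⟩

/-- In the product `L ·_d Lₙ`, the alternatives in which the property is found inside a substituted
tree of `Lₙ` are absorbed by the induction hypothesis. For edges there remain one layer of `L` and
the junction between two layers. -/
theorem starPoss_of_cIter (hd : r d = 0) (n : ℕ) : ∀ (g : σ) (y : ℕ),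
    Poss p k (cIter d L n) S g y → StarPoss p k L S d g y := by
  induction n with
  | zero =>
    intro g y h
    obtain ⟨hS, h0, h1, h2⟩ := (poss_leafLang hd y).1 h
    match y with
    | 0 => exact Or.inl ⟨h0 rfl, hS⟩
    | 1 => exact absurd rfl h1
    | 2 => exact Or.inl ⟨h2 rfl, hS⟩
    | _ + 3 => exact Or.inl hS
  | succ n ih =>
    intro g y h
    have hsub := leftSet_cIter_subset (L := L) (S := S) hd n
    rcases poss_union.1 h with h | h
    · exact ih g y h
    match y with
    | 0 =>
      rcases (poss_cProd_zero hd).1 h with h | h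
      · exact Or.inr ⟨h.1, h.2.mono hsub⟩
      · exact ih g 0 h.2
    | 1 =>
      rcases (poss_cProd_one hd).1 h with h | h | h
      · exact Or.inl ⟨h.1, h.2.mono hsub⟩
      · exact Or.inr ⟨h.1.mono hsub, ih g 0 h.2⟩
      · exact ih g 1 h.2
    | 2 =>
      rcases (poss_cProd_two hd).1 h with h | h
      · exact Or.inr ⟨h.1, h.2.mono hsub⟩
      · exact ih g 2 h.2
    | _ + 3 =>
      obtain ⟨t, ht, hg, -⟩ := h
      exact starNonempty_of_cIter hd (n + 1) ⟨t, Or.inr ht, hg⟩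

theorem poss_cClosure (hd : r d = 0) (y : ℕ) :
    Poss p k (cClosure d L) S g y ↔ StarPoss p k L S d g y := by
  have hmem : ∀ {g : σ} {y : ℕ}, Poss p k (cClosure d L) S g y ↔
      ∃ n, Poss p k (cIter d L n) S g y := by
    intro g y
    simp only [Poss, cClosure, Set.mem_iUnion]
    exact ⟨fun ⟨t, ⟨n, hn⟩, h⟩ => ⟨n, t, hn, h⟩, fun ⟨n, t, hn, h⟩ => ⟨t, ⟨n, hn⟩, h⟩⟩
  rw [hmem]
  refine ⟨fun ⟨n, h⟩ => starPoss_of_cIter hd n g y h, ?_⟩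
  have hne : ∀ (g : σ) (y : ℕ), g ≠ d → Poss p k L (starSet L S d) g y →
      ∃ n, Poss p k (cIter d L n) S g y := fun g y hg h => by
    -- Stage 2 contains the product with stage 1, the first stage whose constraint is already
    -- `starSet`.
    refine ⟨2, poss_union.2 (Or.inr (poss_cProd_of_ne hd hg ?_))⟩
    rwa [leftSet_cIter hd le_rfl]
  have hzero : StarPoss p k L S d g 0 → ∃ n, Poss p k (cIter d L n) S g 0 := by
    rintro (⟨hg, hS⟩ | h)
    · exact ⟨0, (poss_leafLang hd 0).2 ⟨hS, fun _ => hg, by omega, by omega⟩⟩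
    · exact hne g 0 h.1 h.2
  intro h
  match y, h with
  | 0, h => exact hzero h
  | 1, h =>
    rcases h with h | ⟨h1, h2⟩
    · exact hne g 1 h.1 h.2
    · obtain ⟨n, v, hv, hg⟩ := hzero h2
      -- The right factor is stage `n + 1`: it contains the tree `v` of stage `n`, and it is at
      -- least stage 1, so the constraint on the left is `starSet`.
      refine ⟨n + 2, poss_union.2 (Or.inr ((poss_cProd_one hd).2 (Or.inr (Or.inl ⟨?_, ?_⟩))))⟩
      · rwa [leftSet_cIter hd (by omega)]
      · exact ⟨v, cIter_mono (by omega) hv, hg⟩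
  | 2, h =>
    rcases h with ⟨hg, hS⟩ | h
    · exact ⟨0, (poss_leafLang hd 2).2 ⟨hS, by omega, by omega, fun _ => hg⟩⟩
    · exact hne g 2 h.1 h.2
  | _ + 3, h =>
    obtain ⟨v, hv, hg⟩ := exists_cIter_good hd h
    exact ⟨1, v, hv, hg, trivial⟩

end RTree

/-! ### Expressions -/

namespace RegExp

open RTree

variable {σ : Type*} {r : σ → ℕ} {p : σ} {k : ℕ} {g : σ} {S : Set σ}

/-- The property number `y` for an application of the symbol `f`, in terms of the arguments. -/
def SymPoss (p : σ) (k : ℕ) (f : σ) (Ls : Fin (r f) → Set (RTree r)) (S : Set σ) (g : σ) :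
    ℕ → Prop
  | 0 => f = g
  | 1 => ∃ i, Poss p k (Ls i) S g 1 ∨ ((f = p ∧ (i : ℕ) = k) ∧ Poss p k (Ls i) S g 0)
  | 2 => f = g ∨ ∃ i, Poss p k (Ls i) S g 2
  | _ => True

/-- The arguments are chosen independently, so a property realized in one argument extends to a full
tree as soon as every argument has some tree with leaves in `S`. -/
theorem poss_sym {f : σ} {args : Fin (r f) → RegExp r} (y : ℕ) :
    Poss p k (sym f args).lang S g y ↔ (r f = 0 → f ∈ S) ∧
      (∀ i, ∃ t ∈ (args i).lang, Good S t) ∧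
      SymPoss p k f (fun i => (args i).lang) S g y := by
  constructor
  · rintro ⟨-, ⟨ts, hts, rfl⟩, hg, h⟩
    refine ⟨hg.1, fun i => ⟨ts i, hts i, hg.2 i⟩, ?_⟩
    match y, h with
    | 0, h => exact h
    | 1, h =>
      rcases h with ⟨h1, i, h2, h3⟩ | ⟨i, h⟩
      · exact ⟨i, Or.inr ⟨⟨h1, h2⟩, ts i, hts i, hg.2 i, h3⟩⟩
      · exact ⟨i, Or.inl ⟨ts i, hts i, hg.2 i, h⟩⟩
    | 2, h => exact h.imp id fun ⟨i, h⟩ => ⟨i, ts i, hts i, hg.2 i, h⟩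
    | _ + 3, _ => trivial
  · rintro ⟨h0, hne, h⟩
    -- A prescribed tree at argument `i` is completed by arbitrary admissible trees at the other
    -- arguments.
    have key : ∀ (i : Fin (r f)) (t : RTree r), t ∈ (args i).lang → Good S t →
        ∃ ts : Fin (r f) → RTree r, ts i = t ∧ (node f ts) ∈ (sym f args).lang ∧
          Good S (node f ts) := by
      intro i t ht hg
      choose us hus hus' using hne
      refine ⟨Function.update us i t, by simp, ⟨_, fun j => ?_, rfl⟩, h0, fun j => ?_⟩ <;>
      · rcases eq_or_ne j i with rfl | hj
        · simpa
        · simp [hj, hus, hus']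
    have triv : ∃ ts : Fin (r f) → RTree r, (node f ts) ∈ (sym f args).lang ∧
          Good S (node f ts) := by
      choose us hus hus' using hne
      exact ⟨us, ⟨_, hus, rfl⟩, h0, hus'⟩
    obtain ⟨us, hus, hus'⟩ := triv
    match y, h with
    | 0, h => exact ⟨_, hus, hus', h⟩
    | 1, ⟨i, h⟩ =>
      rcases h with ⟨t, ht, hg, h⟩ | ⟨⟨h1, h2⟩, t, ht, hg, h⟩
      · obtain ⟨ts, rfl, h3, h4⟩ := key i t ht hg
        exact ⟨_, h3, h4, Or.inr ⟨i, h⟩⟩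
      · obtain ⟨ts, rfl, h3, h4⟩ := key i t ht hg
        exact ⟨_, h3, h4, Or.inl ⟨h1, i, h2, h⟩⟩
    | 2, h =>
      rcases h with h | ⟨i, t, ht, hg, h⟩
      · exact ⟨_, hus, hus', Or.inl h⟩
      · obtain ⟨ts, rfl, h3, h4⟩ := key i t ht hg
        exact ⟨_, h3, h4, Or.inr ⟨i, h⟩⟩
    | _ + 3, _ => exact ⟨_, hus, hus', trivial⟩

/-- `Under` compares child numbers as natural numbers, which avoids transporting `Fin (r p)` along
equalities of symbols; this lemma links it to the dependent form used by `follow`. -/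
theorem exists_subtree_iff_under {p : σ} {k : Fin (r p)} {g : σ} (t : RTree r) :
    (∃ ts : Fin (r p) → RTree r, Subtree (.node p ts) t ∧ (ts k).root = g) ↔
      Under p k g t := by
  induction t with
  | node f us ih =>
    constructor
    · rintro ⟨ts, h, hg⟩
      cases h with
      | refl => exact Or.inl ⟨rfl, k, rfl, hg⟩
      | child i h => exact Or.inr ⟨i, (ih i).1 ⟨ts, h, hg⟩⟩
    · rintro (⟨rfl, i, hi, hg⟩ | ⟨i, h⟩)
      · obtain rfl : i = k := Fin.ext hi
        exact ⟨us, .refl _, hg⟩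
      · obtain ⟨ts, h, hg⟩ := (ih i).2 h
        exact ⟨ts, .child i h, hg⟩

theorem mem_follow_iff {E : RegExp r} {k : Fin (r p)} :
    g ∈ E.follow p k ↔ ∃ t ∈ E.lang, Under p k g t := by
  simp only [follow, Set.mem_ofPred_eq, exists_subtree_iff_under]

end RegExp

/-! ### Total correctness of programs -/

/-- The program `p` halts when started in `m`, and its running time and final configuration
satisfy `Q`. -/
def WP (p : Prog) (m : Machine) (Q : ℕ → Machine → Prop) : Prop :=
  ∃ t m', Runs p m t m' ∧ Q t m'

namespace WP

variable {m : Machine} {Q : ℕ → Machine → Prop}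

theorem mono {p : Prog} {Q' : ℕ → Machine → Prop} (h : WP p m Q)
    (hQ : ∀ t m', Q t m' → Q' t m') : WP p m Q' := by
  obtain ⟨t, m', h, h'⟩ := h
  exact ⟨t, m', h, hQ _ _ h'⟩

theorem seq {p q : Prog} (h : WP p m fun t m' => WP q m' fun t' m'' => Q (t + t') m'') :
    WP (.seq p q) m Q := by
  obtain ⟨t, m', h, t', m'', h', hQ⟩ := h
  exact ⟨_, _, h.seq h', hQ⟩

theorem skip (h : Q 1 m) : WP .skip m Q := ⟨_, _, .skip m, h⟩

theorem assign {x v : ℕ} (h : Q 1 (m.setReg x v)) : WP (.assign x v) m Q := ⟨_, _, .assign .., h⟩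

theorem add {x y z : ℕ} (h : Q 1 (m.setReg x (m.reg y + m.reg z))) : WP (.add x y z) m Q :=
  ⟨_, _, .add .., h⟩

theorem sub {x y z : ℕ} (h : Q 1 (m.setReg x (m.reg y - m.reg z))) : WP (.sub x y z) m Q :=
  ⟨_, _, .sub .., h⟩

theorem load {x a i : ℕ} (h : Q 1 (m.setReg x (m.arr a (m.reg i)))) : WP (.load x a i) m Q :=
  ⟨_, _, .load .., h⟩

theorem store {a i y : ℕ} (h : Q 1 (m.setArr a (m.reg i) (m.reg y))) : WP (.store a i y) m Q :=
  ⟨_, _, .store .., h⟩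

theorem put {x : ℕ} (h : Q 1 { m with out := m.out ++ [m.reg x] }) : WP (.put x) m Q :=
  ⟨_, _, .put .., h⟩

theorem add' {x y z : ℕ} (v : ℕ) (hv : m.reg y + m.reg z = v) (h : Q 1 (m.setReg x v)) :
    WP (.add x y z) m Q := add (hv ▸ h)

theorem sub' {x y z : ℕ} (v : ℕ) (hv : m.reg y - m.reg z = v) (h : Q 1 (m.setReg x v)) :
    WP (.sub x y z) m Q := sub (hv ▸ h)

theorem load' {x a i : ℕ} (v : ℕ) (hv : m.arr a (m.reg i) = v) (h : Q 1 (m.setReg x v)) :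
    WP (.load x a i) m Q := load (hv ▸ h)

theorem store' {a i y : ℕ} (w v : ℕ) (hw : m.reg i = w) (hv : m.reg y = v)
    (h : Q 1 (m.setArr a w v)) : WP (.store a i y) m Q := store (hw ▸ hv ▸ h)

theorem branch {x : ℕ} {p q : Prog} (h : m.reg x ≠ 0 → WP p m fun t m' => Q (t + 1) m')
    (h' : m.reg x = 0 → WP q m fun t m' => Q (t + 1) m') : WP (.branch x p q) m Q := by
  by_cases hx : m.reg x = 0
  · obtain ⟨t, m', h, hQ⟩ := h' hx
    exact ⟨_, _, .branch_false hx h, hQ⟩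
  · obtain ⟨t, m', h, hQ⟩ := h hx
    exact ⟨_, _, .branch_true hx h, hQ⟩

theorem branch_true {x : ℕ} {p q : Prog} (hx : m.reg x ≠ 0)
    (h : WP p m fun t m' => Q (t + 1) m') : WP (.branch x p q) m Q :=
  branch (fun _ => h) fun h' => absurd h' hx

theorem branch_false {x : ℕ} {p q : Prog} (hx : m.reg x = 0)
    (h : WP q m fun t m' => Q (t + 1) m') : WP (.branch x p q) m Q :=
  branch (fun h' => absurd hx h') fun _ => h

end WP

/-- `Iter x p c m t m'`: running `c` rounds of the loop with guard `x` and body `p` leads from `m`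
to `m'` in `t` steps. -/
def Iter (x : ℕ) (p : Prog) : ℕ → Machine → ℕ → Machine → Prop
  | 0, m, t, m' => t = 0 ∧ m' = m
  | c + 1, m, t, m' => ∃ t₁ m₁ t₂, m.reg x ≠ 0 ∧ Runs p m t₁ m₁ ∧ Iter x p c m₁ t₂ m' ∧
      t = t₁ + 1 + t₂

namespace Iter

variable {x : ℕ} {p : Prog}

theorem trans {c c' : ℕ} : ∀ {m m' m'' : Machine} {t t' : ℕ}, Iter x p c m t m' →
    Iter x p c' m' t' m'' → Iter x p (c + c') m (t + t') m'' := by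
  induction c with
  | zero =>
    rintro m m' m'' t t' ⟨rfl, rfl⟩ h
    simpa using h
  | succ c ih =>
    rintro m m' m'' t t' ⟨t₁, m₁, t₂, h0, h1, h2, rfl⟩ h
    rw [Nat.add_right_comm]
    exact ⟨t₁, m₁, t₂ + t', h0, h1, ih h2 h, by omega⟩

theorem one {m m' : Machine} {t : ℕ} (hx : m.reg x ≠ 0) (h : Runs p m t m') :
    Iter x p 1 m (t + 1) m' := ⟨t, m', 0, hx, h, ⟨rfl, rfl⟩, rfl⟩

theorem runs {c : ℕ} : ∀ {m m' : Machine} {t : ℕ}, Iter x p c m t m' → m'.reg x = 0 →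
    Runs (.loop x p) m (t + 1) m' := by
  induction c with
  | zero =>
    rintro m m' t ⟨rfl, rfl⟩ h
    exact .loop_false h
  | succ c ih =>
    rintro m m' t ⟨t₁, m₁, t₂, h0, h1, h2, rfl⟩ h
    have := Runs.loop_true h0 h1 (ih h2 h)
    rwa [show t₁ + 1 + t₂ + 1 = t₁ + (t₂ + 1) + 1 by omega]

end Iter

/-- A counting loop: `I j` holds after `j` of `c` rounds, each of them of at most `T` steps. -/
theorem WP.loop {x c T : ℕ} {p : Prog} {m : Machine} {Q : ℕ → Machine → Prop}
    (I : ℕ → Machine → Prop) (h0 : I 0 m)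
    (hx : ∀ j m, I j m → m.reg x = c - j)
    (hstep : ∀ j m, j < c → I j m → WP p m fun t m' => t ≤ T ∧ I (j + 1) m')
    (hQ : ∀ t m', I c m' → t ≤ c * (T + 1) + 1 → Q t m') : WP (.loop x p) m Q := by
  have key : ∀ j ≤ c, ∃ t m', Iter x p j m t m' ∧ t ≤ j * (T + 1) ∧ I j m' := by
    intro j hj
    induction j with
    | zero => exact ⟨0, m, ⟨rfl, rfl⟩, by simp, h0⟩
    | succ j ih =>
      obtain ⟨t, m', h1, h2, h3⟩ := ih (by omega)
      obtain ⟨t', m'', h4, h5, h6⟩ := hstep j m' hj h3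
      refine ⟨_, m'', h1.trans (Iter.one ?_ h4), ?_, h6⟩
      · rw [hx j m' h3]; omega
      · rw [Nat.succ_mul]; omega
  obtain ⟨t, m', h1, h2, h3⟩ := key c le_rfl
  refine ⟨_, m', h1.runs ?_, hQ _ _ h3 (by omega)⟩
  rw [hx c m' h3]; omega

/-! ### Primitive recursive functions on the machine -/

@[simp] theorem Machine.setReg_reg (m : Machine) (x v y : ℕ) :
    (m.setReg x v).reg y = if y = x then v else m.reg y := by
  simp [Machine.setReg, Function.update_apply]

theorem Machine.setReg_of_ne {m : Machine} {x v y : ℕ} (h : y ≠ x) :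
    (m.setReg x v).reg y = m.reg y := by
  simp [h]

@[simp] theorem Machine.setReg_arr (m : Machine) (x v : ℕ) : (m.setReg x v).arr = m.arr := rfl

@[simp] theorem Machine.setReg_out (m : Machine) (x v : ℕ) : (m.setReg x v).out = m.out := rfl

@[simp] theorem Machine.setArr_reg (m : Machine) (a i v : ℕ) : (m.setArr a i v).reg = m.reg := rfl

@[simp] theorem Machine.setArr_out (m : Machine) (a i v : ℕ) : (m.setArr a i v).out = m.out := rfl

@[simp] theorem Machine.setArr_arr (m : Machine) (a i v a' i' : ℕ) :
    (m.setArr a i v).arr a' i' = if a' = a ∧ i' = i then v else m.arr a' i' := by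
  by_cases h : a' = a
  · subst h; simp [Machine.setArr, Function.update_apply]
  · simp [Machine.setArr, h]

/-- The effect of a program that computes a value into register `out` and uses the registers from
`b` on as working space. -/
structure Returns (out b v : ℕ) (m m' : Machine) : Prop where
  value : m'.reg out = v
  frame : ∀ x < b, x ≠ out → m'.reg x = m.reg x
  arr : m'.arr = m.arr
  output : m'.out = m.out

/-- The program `p` computes `f` from the registers `ins` into the register `out`, in a time that
is bounded in terms of the arguments. -/
def Computes {n : ℕ} (f : (Fin n → ℕ) → ℕ) (ins : Fin n → ℕ) (out b : ℕ) (p : Prog)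
    (τ : ℕ → ℕ) : Prop :=
  ∀ m B, (∀ i, m.reg (ins i) ≤ B) →
    WP p m fun t m' => t ≤ τ B ∧ Returns out b (f fun i => m.reg (ins i)) m m'

/-- Only finitely many argument vectors lie below `B`. The bound `V` is not computed by any program;
it only enters the running time estimates. -/
theorem exists_bound {n : ℕ} (F : (Fin n → ℕ) → ℕ) :
    ∃ V : ℕ → ℕ, ∀ B v, (∀ i, v i ≤ B) → F v ≤ V B := by
  refine ⟨fun B => (Fintype.piFinset fun _ => Finset.range (B + 1)).sup F, fun B v hv => ?_⟩
  exact Finset.le_sup (f := F) (Fintype.mem_piFinset.2 fun i =>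
    Finset.mem_range.2 (Nat.lt_succ_of_le (hv i)))

/-- The results are collected in the registers `b, …, b + k - 1`. Every call takes its working space
from `c ≥ b + k` on, so it destroys neither the inputs nor earlier results. -/
theorem computes_sequence {n k : ℕ} {ins : Fin n → ℕ} {b : ℕ} (hins : ∀ i, ins i < b)
    (g : Fin k → (Fin n → ℕ) → ℕ)
    (hg : ∀ (i : Fin k) (b : ℕ), (∀ i, ins i < b) → ∀ out < b,
      ∃ p τ, Computes (g i) ins out b p τ) (c : ℕ) (hbc : b + k ≤ c) :
    ∃ p, ∃ τ : ℕ → ℕ, ∀ m B, (∀ i, m.reg (ins i) ≤ B) → WP p m fun t m' => t ≤ τ B ∧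
      (∀ i : Fin k, m'.reg (b + i) = g i fun j => m.reg (ins j)) ∧
      (∀ x < b, m'.reg x = m.reg x) ∧ m'.arr = m.arr ∧ m'.out = m.out := by
  induction k with
  | zero => exact ⟨.skip, fun _ => 1, fun m B _ => .skip ⟨le_rfl, fun i => i.elim0,
      fun _ _ => rfl, rfl, rfl⟩⟩
  | succ k ih =>
    obtain ⟨p, τ, h⟩ := ih (fun i => g i.castSucc) (fun i => hg i.castSucc) (by omega)
    obtain ⟨q, τ', h'⟩ := hg (Fin.last k) c (fun i => (hins i).trans_le (by omega)) (b + k)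
      (by omega)
    refine ⟨.seq p q, fun B => τ B + τ' B, fun m B hB => .seq ((h m B hB).mono ?_)⟩
    rintro t m' ⟨ht, h1, h2, h3, h4⟩
    have hin : ∀ i, m'.reg (ins i) = m.reg (ins i) := fun i => h2 _ (hins i)
    refine (h' m' B (by simpa only [hin] using hB)).mono ?_
    rintro t' m'' ⟨ht', hr⟩
    refine ⟨Nat.add_le_add ht ht', fun i => ?_, fun x hx => ?_, hr.arr.trans h3, hr.output.trans h4⟩
    · refine Fin.lastCases ?_ (fun i => ?_) i
      · simpa only [hin, Fin.val_last] using hr.value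
      · rw [Fin.val_castSucc, hr.frame _ (by omega) (by omega), h1]
    · rw [hr.frame _ (by omega) (by omega), h2 x hx]

/-- Induction on the construction of the function. An inner program is called with a larger start of
its working space, above the registers in which the outer program keeps its data. -/
theorem computes_of_primrec' {n : ℕ} {f : List.Vector ℕ n → ℕ} (hf : Nat.Primrec' f) :
    ∀ (ins : Fin n → ℕ) (b : ℕ), (∀ i, ins i < b) → ∀ out < b,
      ∃ p τ, Computes (fun v => f (List.Vector.ofFn v)) ins out b p τ := by
  induction hf with
  | zero =>
    intro ins b hins out hout
    refine ⟨.assign out 0, fun _ => 1, fun m B _ => .assign ⟨le_rfl, ?_, fun x _ h => ?_, rfl,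
      rfl⟩⟩ <;> simp [*]
  | succ =>
    intro ins b hins out hout
    have h0 := hins 0
    refine ⟨.seq (.assign b 1) (.add out (ins 0) b), fun _ => 2, fun m B _ =>
      .seq (.assign (.add ⟨le_rfl, ?_, fun x hx h => ?_, rfl, rfl⟩))⟩
    · simp [h0.ne]
    · simp [h, hx.ne]
  | @get n i =>
    intro ins b hins out hout
    have h0 := hins i
    refine ⟨.seq (.assign b 0) (.add out (ins i) b), fun _ => 2, fun m B _ =>
      .seq (.assign (.add ⟨le_rfl, ?_, fun x hx h => ?_, rfl, rfl⟩))⟩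
    · simp [h0.ne]
    · simp [h, hx.ne]
  | @comp k n f g _ _ ihf ihg =>
    intro ins b hins out hout
    obtain ⟨p, τ, hp⟩ := computes_sequence hins (fun i v => g i (List.Vector.ofFn v))
      (fun i b hb out ho => ihg i ins b hb out ho) (b + n) le_rfl
    obtain ⟨q, τ', hq⟩ := ihf (fun i => b + i) (b + n) (fun i => by omega) out (by omega)
    -- The outer program runs on intermediate values, whose size is no longer bounded by `B`; `V B`
    -- bounds them.
    obtain ⟨V, hV⟩ := exists_bound fun v : Fin k → ℕ =>
      Finset.univ.sup fun i => g i (List.Vector.ofFn v)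
    refine ⟨.seq p q, fun B => τ B + τ' (V B), fun m B hB => .seq ((hp m B hB).mono ?_)⟩
    rintro t m' ⟨ht, h1, h2, h3, h4⟩
    refine (hq m' (V B) fun i => ?_).mono ?_
    · rw [h1]
      exact (Finset.le_sup (f := fun i => g i _) (Finset.mem_univ i)).trans (hV B _ hB)
    · rintro t' m'' ⟨ht', hr⟩
      refine ⟨Nat.add_le_add ht ht', ?_, fun x hx hne => ?_, hr.arr.trans h3, hr.output.trans h4⟩
      · rw [hr.value]
        simp only [h1]
      · rw [hr.frame _ (by omega) hne, h2 x hx]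
  | @prec n f g _ _ ihf ihg =>
    intro ins b hins out hout
    have hins' : ∀ i : Fin n, ins i.succ < b + 5 := fun i => (hins i.succ).trans_le (by omega)
    obtain ⟨p, τ, hp⟩ := ihf (fun i => ins i.succ) (b + 5) hins' (b + 2) (by omega)
    obtain ⟨q, τ', hq⟩ := ihg (Fin.cons (b + 1) (Fin.cons (b + 2) fun i => ins i.succ)) (b + 5)
      (Fin.cases (by simp) (Fin.cases (by simp) hins')) (b + 2) (by omega)
    -- `R v j` is the value of the recursion after `j` rounds; below, `V B` bounds all these values
    -- for `j ≤ v 0`.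
    let R : (Fin (n + 1) → ℕ) → ℕ → ℕ := fun v j => Nat.rec (f (List.Vector.ofFn fun i => v i.succ))
      (fun y IH => g (y ::ᵥ IH ::ᵥ List.Vector.ofFn fun i => v i.succ)) j
    obtain ⟨V, hV⟩ := exists_bound fun v : Fin (n + 1) → ℕ => (Finset.range (v 0 + 1)).sup (R v)
    -- Register `b` counts the remaining rounds, `b + 1` the rounds done, `b + 2` holds the current
    -- value, and `b + 3`, `b + 4` hold the numbers 1 and 0; adding 0 serves to copy a register.
    refine ⟨.seq (.assign (b + 4) 0) <| .seq (.add b (ins 0) (b + 4)) <| .seq (.assign (b + 3) 1) <|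
      .seq (.assign (b + 1) 0) <| .seq p <|
      .seq (.loop b (.seq q (.seq (.add (b + 1) (b + 1) (b + 3)) (.sub b b (b + 3)))))
        (.add out (b + 2) (b + 4)),
      fun B => 1 + (1 + (1 + (1 + (τ B +
        (B * (τ' (max B (V B)) + 2 + 1) + 1 + 1))))), fun m B hB => ?_⟩
    have hv0 : m.reg (ins 0) ≤ B := hB 0
    have hne : ∀ i, ∀ j, ins i ≠ b + j := fun i j => by have := hins i; omega
    have hne' : ∀ i, ins i ≠ b := fun i => (hins i).ne
    set v : Fin (n + 1) → ℕ := fun i => m.reg (ins i) with hv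
    refine .seq (.assign (.seq (.add (.seq (.assign (.seq (.assign (.seq ?_))))))))
    refine (hp _ B fun i => by simpa [hne, hne'] using hB i.succ).mono ?_
    rintro t m₁ ⟨ht, hr⟩
    have hf := hr.frame
    refine .seq (WP.loop (c := v 0) (T := τ' (max B (V B)) + 2) (fun j m' => m'.reg b = v 0 - j ∧
      m'.reg (b + 1) = j ∧ m'.reg (b + 2) = R v j ∧ m'.reg (b + 3) = 1 ∧ m'.reg (b + 4) = 0 ∧
      (∀ x < b, m'.reg x = m.reg x) ∧ m'.arr = m.arr ∧ m'.out = m.out) ?_ ?_ ?_ ?_)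
    · refine ⟨?_, ?_, ?_, ?_, ?_, fun x hx => ?_, hr.arr, hr.output⟩
      · rw [hf _ (by omega) (by omega)]; simp [hne, hv]
      · rw [hf _ (by omega) (by omega)]; simp
      · rw [hr.value]; simp [hne, hne', R, hv]
      · rw [hf _ (by omega) (by omega)]; simp
      · rw [hf _ (by omega) (by omega)]; simp
      · rw [hf _ (by omega) (by omega)]
        simp [hx.ne, (show ∀ j, x ≠ b + j by omega)]
    · exact fun j m' h => h.1
    · rintro j m' hj ⟨h1, h2, h3, h4, h5, h6, h7, h8⟩
      refine .seq ((hq m' (max B (V B)) ?_).mono ?_)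
      · refine Fin.cases ?_ (Fin.cases ?_ fun i => ?_)
        · simp only [Fin.cons_zero, h2]
          exact (hj.le.trans hv0).trans (le_max_left _ _)
        · simp only [Fin.cons_zero, Fin.cons_succ, h3]
          exact ((Finset.le_sup (f := R v) (Finset.mem_range.2 (by omega))).trans
            (hV B v hB)).trans (le_max_right _ _)
        · simp only [Fin.cons_succ, h6 _ (hins _)]
          exact (hB _).trans (le_max_left _ _)
      · rintro t' m₂ ⟨ht', hr'⟩
        have hf' := hr'.frame
        have e0 := hf' b (by omega) (by omega)
        have e1 := hf' (b + 1) (by omega) (by omega)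
        have e3 := hf' (b + 3) (by omega) (by omega)
        have e4 := hf' (b + 4) (by omega) (by omega)
        refine .seq (.add (.sub ⟨by omega, ?_, ?_, ?_, ?_, ?_, fun x hx => ?_, ?_, ?_⟩))
        · simp [e0, e3, h1, h4]; omega
        · simp [e1, e3, h2, h4]
        · simp only [Machine.setReg_reg, show b + 2 ≠ b by omega, show b + 2 ≠ b + 1 by omega,
            if_false, hr'.value]
          change g (m'.reg (b + 1) ::ᵥ m'.reg (b + 2) ::ᵥ
            List.Vector.ofFn fun i => m'.reg (ins i.succ)) = _
          simp only [h2, h3, h6 _ (hins _)]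
          rfl
        · simp [e3, h4]
        · simp [e4, h5]
        · simp only [Machine.setReg_reg, hx.ne, show x ≠ b + 1 by omega, if_false]
          rw [hf' x (by omega) (by omega), h6 x hx]
        · exact hr'.arr.trans h7
        · exact hr'.output.trans h8
    · rintro t' m' ⟨h1, h2, h3, h4, h5, h6, h7, h8⟩ ht'
      refine .add ⟨?_, ?_, fun x hx hx' => ?_, h7, h8⟩
      · have : v 0 * (τ' (max B (V B)) + 2 + 1) ≤ B * (τ' (max B (V B)) + 2 + 1) :=
          Nat.mul_le_mul_right _ hv0
        change 1 + (1 + (1 + (1 + (t + (t' + 1))))) ≤ 1 + (1 + (1 + (1 + (τ B +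
          (B * (τ' (max B (V B)) + 2 + 1) + 1 + 1)))))
        omega
      · simp [h3, h5, R, hv]
      · simp [hx', h6 x hx]

/-- Every primitive recursive function of `n` arguments is computed by a program. -/
theorem exists_computes {n : ℕ} {f : (Fin n → ℕ) → ℕ} (hf : Primrec f) (ins : Fin n → ℕ)
    (b : ℕ) (hins : ∀ i, ins i < b) (out : ℕ) (hout : out < b) :
    ∃ p τ, Computes f ins out b p τ := by
  have h : Primrec fun v : List.Vector ℕ n => f v.get := hf.comp .vector_get'
  obtain ⟨p, τ, hp⟩ := computes_of_primrec' (Nat.Primrec'.of_prim h) ins b hins out hout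
  refine ⟨p, τ, fun m B hB => (hp m B hB).mono ?_⟩
  rintro t m' ⟨ht, hr⟩
  refine ⟨ht, hr.value.trans ?_, hr.frame, hr.arr, hr.output⟩
  have : (List.Vector.ofFn fun i => m.reg (ins i)).get = fun i => m.reg (ins i) :=
    funext fun i => List.Vector.get_ofFn _ i
  simp only [this]

/-! ### Forests of labelled nodes in prefix order -/

/-- The label of a node of a syntax tree: its kind, the number of its symbol, and its mark. -/
structure Lab where
  kind : ℕ
  sym : ℕ
  mark : ℕ

/-- Ordered forests: the first root with its children, and the remaining trees. -/
inductive Forest : Type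
  | nil : Forest
  | cons (l : Lab) (c r : Forest) : Forest

namespace Forest

/-- The number of nodes. -/
def size : Forest → ℕ
  | nil => 0
  | cons _ c r => 1 + c.size + r.size

/-- The number of roots. -/
def len : Forest → ℕ
  | nil => 0
  | cons _ _ r => 1 + r.len

/-- The labels and the numbers of children of all nodes in prefix order. -/
def labels : Forest → List (Lab × ℕ)
  | nil => []
  | cons l c r => (l, c.len) :: (c.labels ++ r.labels)

theorem length_labels (f : Forest) : f.labels.length = f.size := by
  induction f with
  | nil => rfl
  | cons l c r ihc ihr => simp [labels, size, ihc, ihr]; omega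

end Forest

/-- The functions that the two passes over an expression evaluate at the nodes. Their first argument
is the number of symbols of the alphabet. -/
structure Kernel where
  /-- arguments `n`, kind, accumulator, value of the child, flag of the child -/
  step : (Fin 5 → ℕ) → ℕ
  /-- arguments `n`, kind, symbol, accumulator -/
  fin : (Fin 4 → ℕ) → ℕ
  /-- arguments `n`, kind, symbol, context, accumulator, `1` for the first child, flag -/
  down : (Fin 7 → ℕ) → ℕ
  /-- arguments `n`, symbol, context, value -/
  emit : (Fin 4 → ℕ) → ℕ
  /-- arguments `n`, value, number of a constant -/
  const : (Fin 3 → ℕ) → ℕ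
  /-- argument `n` -/
  root : (Fin 1 → ℕ) → ℕ

/-- The flag of the child number `i` of a node with mark `j`, for the target `(q, k)`. -/
def flag (q k j i : ℕ) : ℕ := if j = q ∧ i = k then 1 else 0

theorem flag_le (q k j i : ℕ) : flag q k j i ≤ 1 := by
  unfold flag; split <;> omega

namespace Forest

variable (K : Kernel) (n q k : ℕ)

/-- The accumulator of a node with label `l` after its children from number `i` on. -/
def fold : Forest → Lab → ℕ → ℕ → ℕ
  | nil, _, _, a => a
  | cons l' c r, l, i, a => fold r l (i + 1)
      (K.step ![n, l.kind, a, K.fin ![n, l'.kind, l'.sym, fold c l' 0 0], flag q k l.mark i])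

/-- The value of the tree with root label `l` and children `c`. -/
def value (l : Lab) (c : Forest) : ℕ := K.fin ![n, l.kind, l.sym, fold K n q k c l 0 0]

/-- The context of the child number `i` of a node with label `l`, accumulator `a` and context
`y`. -/
def childCtx (l : Lab) (a y i : ℕ) : ℕ :=
  K.down ![n, l.kind, l.sym, y, a, 1 - i, flag q k l.mark i]

/-- The label of a node with context `y` and value `x`, if it is to be listed. -/
def ownList (l : Lab) (y x : ℕ) : List Lab :=
  if l.mark ≠ 0 ∧ K.emit ![n, l.sym, y, x] ≠ 0 then [l] else []

/-- The labels of the nodes that are to be listed, among the children from number `i` on (and their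
descendants) of a node with label `l`, accumulator `a` and context `y`. -/
def listed : Forest → Lab → ℕ → ℕ → ℕ → List Lab
  | nil, _, _, _, _ => []
  | cons l' c r, l, a, y, i =>
      ownList K n l' (childCtx K n q k l a y i) (value K n q k l' c) ++
      listed c l' (fold K n q k c l' 0 0) (childCtx K n q k l a y i) 0 ++ listed r l a y (i + 1)

/-- The arrays `1`, `2`, `3` and `8` hold the kinds, symbols, marks and arities of the nodes, from
index `o` on. -/
def Laid (A : ℕ → ℕ → ℕ) : Forest → ℕ → Prop
  | nil, _ => True
  | cons l c r, o => (A 1 o = l.kind ∧ A 2 o = l.sym ∧ A 3 o = l.mark ∧ A 8 o = c.len) ∧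
      Laid A c (o + 1) ∧ Laid A r (o + 1 + c.size)

/-- The arrays `4`, `5` and `6` hold the end indices, values and accumulators of the nodes, from
index `o` on. -/
def Done (A : ℕ → ℕ → ℕ) : Forest → ℕ → Prop
  | nil, _ => True
  | cons l c r, o => (A 4 o = o + 1 + c.size ∧ A 5 o = value K n q k l c ∧
      A 6 o = fold K n q k c l 0 0) ∧ Done A c (o + 1) ∧ Done A r (o + 1 + c.size)

/-- The array `7` holds the contexts of the roots, from child number `i` on. -/
def RootCtx (A : ℕ → ℕ → ℕ) (l : Lab) (a y : ℕ) : Forest → ℕ → ℕ → Prop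
  | nil, _, _ => True
  | cons _ c r, o, i => A 7 o = childCtx K n q k l a y i ∧ RootCtx A l a y r (o + 1 + c.size) (i + 1)

/-- Kinds and symbols of all labels are in range. -/
def Valid : Forest → Prop
  | nil => True
  | cons l c r => (l.kind < 5 ∧ l.sym ≤ n) ∧ Valid c ∧ Valid r

variable {K n q k}

theorem Laid.congr {A A' : ℕ → ℕ → ℕ} {f : Forest} : ∀ {o : ℕ}, Laid A f o →
    (∀ a, a = 1 ∨ a = 2 ∨ a = 3 ∨ a = 8 → ∀ i, o ≤ i → i < o + f.size → A' a i = A a i) →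
    Laid A' f o := by
  induction f with
  | nil => exact fun _ _ => trivial
  | cons l c r ihc ihr =>
    intro o h hA
    simp only [size] at hA
    refine ⟨?_, ihc h.2.1 fun a ha i h1 h2 => hA a ha i (by omega) (by omega),
      ihr h.2.2 fun a ha i h1 h2 => hA a ha i (by omega) (by omega)⟩
    rw [hA 1 (by simp) o (by omega) (by omega), hA 2 (by simp) o (by omega) (by omega),
      hA 3 (by simp) o (by omega) (by omega), hA 8 (by simp) o (by omega) (by omega)]
    exact h.1

theorem Done.congr {A A' : ℕ → ℕ → ℕ} {f : Forest} : ∀ {o : ℕ}, Done K n q k A f o →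
    (∀ a, a = 4 ∨ a = 5 ∨ a = 6 → ∀ i, o ≤ i → i < o + f.size → A' a i = A a i) →
    Done K n q k A' f o := by
  induction f with
  | nil => exact fun _ _ => trivial
  | cons l c r ihc ihr =>
    intro o h hA
    simp only [size] at hA
    refine ⟨?_, ihc h.2.1 fun a ha i h1 h2 => hA a ha i (by omega) (by omega),
      ihr h.2.2 fun a ha i h1 h2 => hA a ha i (by omega) (by omega)⟩
    rw [hA 4 (by simp) o (by omega) (by omega), hA 5 (by simp) o (by omega) (by omega),
      hA 6 (by simp) o (by omega) (by omega)]
    exact h.1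

theorem RootCtx.congr {A A' : ℕ → ℕ → ℕ} {l : Lab} {a y : ℕ} {f : Forest} : ∀ {o i : ℕ},
    RootCtx K n q k A l a y f o i → (∀ j, o ≤ j → j < o + f.size → A' 7 j = A 7 j) →
    RootCtx K n q k A' l a y f o i := by
  induction f with
  | nil => exact fun _ _ => trivial
  | cons l c r ihc ihr =>
    intro o i h hA
    simp only [size] at hA
    refine ⟨?_, ihr h.2 fun j h1 h2 => hA j (by omega) (by omega)⟩
    rw [hA o (by omega) (by omega)]
    exact h.1

end Forest

/-- Sets of numbers that contain all the values that occur in the passes for an alphabet with `n`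
symbols, and that are bounded by `B`. -/
structure Kernel.Closed (K : Kernel) (n B : ℕ) (A X Y : Set ℕ) : Prop where
  le_n : n ≤ B
  le_five : 5 ≤ B
  le_A : ∀ a ∈ A, a ≤ B
  le_X : ∀ x ∈ X, x ≤ B
  le_Y : ∀ y ∈ Y, y ≤ B
  zero : 0 ∈ A
  step : ∀ c < 5, ∀ a ∈ A, ∀ x ∈ X, ∀ b ≤ 1, K.step ![n, c, a, x, b] ∈ A
  fin : ∀ c < 5, ∀ s ≤ n, ∀ a ∈ A, K.fin ![n, c, s, a] ∈ X
  down : ∀ c < 5, ∀ s ≤ n, ∀ y ∈ Y, ∀ a ∈ A, ∀ b ≤ 1, ∀ b' ≤ 1,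
    K.down ![n, c, s, y, a, b, b'] ∈ Y
  root : K.root ![n] ∈ Y

namespace Forest

variable {K : Kernel} {n q k B : ℕ} {A X Y : Set ℕ}

theorem fold_mem (hK : K.Closed n B A X Y) {f : Forest} (hf : f.Valid n) : ∀ {l : Lab} {i a : ℕ},
    l.kind < 5 → a ∈ A → fold K n q k f l i a ∈ A := by
  induction f with
  | nil => exact fun _ h => h
  | cons l' c r ihc ihr =>
    intro l i a hl ha
    exact ihr hf.2.2 hl (hK.step _ hl _ ha _
      (hK.fin _ hf.1.1 _ hf.1.2 _ (ihc hf.2.1 hf.1.1 hK.zero)) _ (flag_le ..))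

theorem value_mem (hK : K.Closed n B A X Y) {c : Forest} (hc : c.Valid n) {l : Lab}
    (hl : l.kind < 5) (hs : l.sym ≤ n) : value K n q k l c ∈ X :=
  hK.fin _ hl _ hs _ (fold_mem hK hc hl hK.zero)

theorem childCtx_mem (hK : K.Closed n B A X Y) {l : Lab} (hl : l.kind < 5) (hs : l.sym ≤ n)
    {a y i : ℕ} (ha : a ∈ A) (hy : y ∈ Y) : childCtx K n q k l a y i ∈ Y :=
  hK.down _ hl _ hs _ hy _ ha _ (by omega) _ (flag_le ..)

end Forest

/-! ### Programs for the passes -/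

/-- Programs for the functions of a kernel, in the registers that the passes use. -/
structure Impl (K : Kernel) where
  pStep : Prog
  pFin : Prog
  pDown : Prog
  pEmit : Prog
  pConst : Prog
  pRoot : Prog
  τ : ℕ → ℕ
  step : Computes K.step ![0, 12, 18, 19, 20] 18 30 pStep τ
  fin : Computes K.fin ![0, 12, 13, 18] 19 30 pFin τ
  down : Computes K.down ![0, 12, 13, 22, 18, 23, 20] 19 30 pDown τ
  emit : Computes K.emit ![0, 13, 22, 19] 24 30 pEmit τ
  const : Computes K.const ![0, 19, 10] 24 30 pConst τ
  root : Computes K.root ![0] 22 30 pRoot τ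

/-- Sequential composition of a list of programs. -/
def Prog.block : List Prog → Prog
  | [] => .skip
  | p :: ps => .seq p (block ps)

/-- The flag of the child number `reg 17` of a node with mark `reg 14`, for the target
`(reg 2, reg 3)`. -/
def flagProg : Prog := .block [.sub 20 14 2, .sub 21 2 14, .add 20 20 21, .sub 21 17 3,
  .add 20 20 21, .sub 21 3 17, .add 20 20 21, .sub 20 7 20]

theorem Computes.mono {n : ℕ} {f : (Fin n → ℕ) → ℕ} {ins : Fin n → ℕ} {out b : ℕ} {p : Prog}
    {τ τ' : ℕ → ℕ} (h : Computes f ins out b p τ) (hτ : ∀ B, τ B ≤ τ' B) :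
    Computes f ins out b p τ' :=
  fun m B hB => (h m B hB).mono fun _ _ h => ⟨h.1.trans (hτ B), h.2⟩

/-- The four truncated differences add up to |j − q| + |i − k|, and 1 minus this sum is 1 exactly if
the sum is 0. Marks and child numbers are thus compared in constant time, outside the programs
obtained from primitive recursion. -/
theorem wp_flagProg {m : Machine} (h7 : m.reg 7 = 1) :
    WP flagProg m fun t m' => t = 9 ∧
      m'.reg 20 = flag (m.reg 2) (m.reg 3) (m.reg 14) (m.reg 17) ∧
      (∀ x, x ≠ 20 → x ≠ 21 → m'.reg x = m.reg x) ∧ m'.arr = m.arr ∧ m'.out = m.out := by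
  refine .seq <| .sub <| .seq <| .sub <| .seq <| .add <| .seq <| .sub <| .seq <| .add <| .seq <|
    .sub <| .seq <| .add <| .seq <| .sub <| .skip ⟨rfl, ?_, fun x h h' => ?_, rfl, rfl⟩
  · simp [h7, flag]
    split <;> omega
  · simp [h, h']

namespace Impl

variable {K : Kernel} (I : Impl K)

/-- Registers during a pass: 10 is the index of the current node, 12, 13, 14 are its kind, symbol
and mark, 15 counts its remaining children, 16 is the index of the current child and 17 its number.
Register 18 is the accumulator, 19 holds a value or the result of a call, 20 the flag, 22 the
context. The end index in array `4` leads from one child to its next sibling. -/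
def upStep : Prog := .block [.load 19 5 16, flagProg, I.pStep, .load 16 4 16, .add 17 17 7,
  .sub 15 15 7]

/-- The index runs downwards through the prefix order, so all children of a node are finished before
the node and no stack is needed. -/
def upBody : Prog := .block [.sub 10 10 7, .load 12 1 10, .load 13 2 10, .load 14 3 10,
  .load 15 8 10, .add 16 10 7, .assign 17 0, .assign 18 0, .loop 15 I.upStep, I.pFin,
  .store 4 10 16, .store 6 10 18, .store 5 10 19]

def downStep : Prog := .block [.sub 23 7 17, flagProg, I.pDown, .store 7 16 19, .load 16 4 16,
  .add 17 17 7, .sub 15 15 7]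

def emitProg : Prog := .branch 14 (.seq I.pEmit (.branch 24 (.seq (.add 24 0 14) (.put 24)) .skip))
  .skip

/-- The index runs upwards through the prefix order, so the context of a node has been written by
its parent when the node is reached. -/
def downBody : Prog := .block [.load 12 1 10, .load 13 2 10, .load 14 3 10, .load 15 8 10,
  .load 18 6 10, .load 22 7 10, .load 19 5 10, I.emitProg, .add 16 10 7, .assign 17 0,
  .loop 15 I.downStep, .add 10 10 7, .sub 11 11 7]

def constBody : Prog := .block [I.pConst, .branch 24 (.seq (.add 24 10 7) (.put 24)) .skip,
  .add 10 10 7, .sub 11 11 7]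

/-- Append the list for the target `(reg 2, reg 3)` to the output. -/
def blockProg : Prog := .block [.assign 8 0, .add 10 1 8, .loop 10 I.upBody, I.pRoot,
  .assign 10 0, .store 7 10 22, .add 11 1 8, .loop 11 I.downBody,
  .assign 10 0, .add 11 0 8, .load 19 5 10, .loop 11 I.constBody, .assign 24 0, .put 24]

variable {n B q k : ℕ} {A X Y : Set ℕ}

theorem call {N out : ℕ} {f : (Fin N → ℕ) → ℕ} {ins : Fin N → ℕ} {p : Prog} {τ : ℕ → ℕ}
    (h : Computes f ins out 30 p τ) {m : Machine} {v : Fin N → ℕ}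
    (hv : ∀ i, m.reg (ins i) = v i) (hB : ∀ i, v i ≤ B) :
    WP p m fun t m' => t ≤ τ B ∧ Returns out 30 (f v) m m' := by
  have := h m B fun i => (hv i).trans_le (hB i)
  rwa [show (fun i => m.reg (ins i)) = v from funext hv] at this

theorem wp_step {m : Machine} {c a x b : ℕ} (hK : K.Closed n B A X Y) (h0 : m.reg 0 = n)
    (h12 : m.reg 12 = c) (h18 : m.reg 18 = a) (h19 : m.reg 19 = x) (h20 : m.reg 20 = b)
    (hc : c < 5) (ha : a ∈ A) (hx : x ∈ X) (hb : b ≤ 1) :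
    WP I.pStep m fun t m' => t ≤ I.τ B ∧ Returns 18 30 (K.step ![n, c, a, x, b]) m m' := by
  have h1 := hK.le_n
  have h2 := hK.le_five
  have h3 := hK.le_A a ha
  have h4 := hK.le_X x hx
  exact call I.step (by simp [Fin.forall_fin_succ, *]) (by simp [Fin.forall_fin_succ]; omega)

theorem wp_fin {m : Machine} {c s a : ℕ} (hK : K.Closed n B A X Y) (h0 : m.reg 0 = n)
    (h12 : m.reg 12 = c) (h13 : m.reg 13 = s) (h18 : m.reg 18 = a)
    (hc : c < 5) (hs : s ≤ n) (ha : a ∈ A) :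
    WP I.pFin m fun t m' => t ≤ I.τ B ∧ Returns 19 30 (K.fin ![n, c, s, a]) m m' := by
  have h1 := hK.le_n
  have h2 := hK.le_five
  have h3 := hK.le_A a ha
  exact call I.fin (by simp [Fin.forall_fin_succ, *]) (by simp [Fin.forall_fin_succ]; omega)

theorem wp_down {m : Machine} {c s y a b b' : ℕ} (hK : K.Closed n B A X Y) (h0 : m.reg 0 = n)
    (h12 : m.reg 12 = c) (h13 : m.reg 13 = s) (h22 : m.reg 22 = y) (h18 : m.reg 18 = a)
    (h23 : m.reg 23 = b) (h20 : m.reg 20 = b') (hc : c < 5) (hs : s ≤ n) (hy : y ∈ Y)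
    (ha : a ∈ A) (hb : b ≤ 1) (hb' : b' ≤ 1) :
    WP I.pDown m fun t m' => t ≤ I.τ B ∧
      Returns 19 30 (K.down ![n, c, s, y, a, b, b']) m m' := by
  have h1 := hK.le_n
  have h2 := hK.le_five
  have h3 := hK.le_A a ha
  have h4 := hK.le_Y y hy
  exact call I.down (by simp [Fin.forall_fin_succ, *]) (by simp [Fin.forall_fin_succ]; omega)

theorem wp_emit {m : Machine} {s y x : ℕ} (hK : K.Closed n B A X Y) (h0 : m.reg 0 = n)
    (h13 : m.reg 13 = s) (h22 : m.reg 22 = y) (h19 : m.reg 19 = x) (hs : s ≤ n) (hy : y ∈ Y)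
    (hx : x ∈ X) :
    WP I.pEmit m fun t m' => t ≤ I.τ B ∧ Returns 24 30 (K.emit ![n, s, y, x]) m m' := by
  have h1 := hK.le_n
  have h3 := hK.le_X x hx
  have h4 := hK.le_Y y hy
  exact call I.emit (by simp [Fin.forall_fin_succ, *]) (by simp [Fin.forall_fin_succ]; omega)

theorem wp_const {m : Machine} {x c : ℕ} (hK : K.Closed n B A X Y) (h0 : m.reg 0 = n)
    (h19 : m.reg 19 = x) (h10 : m.reg 10 = c) (hx : x ∈ X) (hc : c ≤ n) :
    WP I.pConst m fun t m' => t ≤ I.τ B ∧ Returns 24 30 (K.const ![n, x, c]) m m' := by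
  have h1 := hK.le_n
  have h3 := hK.le_X x hx
  exact call I.const (by simp [Fin.forall_fin_succ, *]) (by simp [Fin.forall_fin_succ]; omega)

theorem wp_root {m : Machine} (hK : K.Closed n B A X Y) (h0 : m.reg 0 = n) :
    WP I.pRoot m fun t m' => t ≤ I.τ B ∧ Returns 22 30 (K.root ![n]) m m' :=
  call I.root (by simp [h0]) (by simp [hK.le_n])

/-- The registers that do not change during the passes. -/
structure Regs (n q k : ℕ) (m : Machine) : Prop where
  r0 : m.reg 0 = n
  r2 : m.reg 2 = q
  r3 : m.reg 3 = k
  r7 : m.reg 7 = 1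

theorem Regs.congr {m m' : Machine} (h : Regs n q k m) (h' : ∀ x < 8, m'.reg x = m.reg x) :
    Regs n q k m' :=
  ⟨(h' 0 (by omega)).trans h.r0, (h' 2 (by omega)).trans h.r2, (h' 3 (by omega)).trans h.r3,
    (h' 7 (by omega)).trans h.r7⟩

theorem wp_upStep {m : Machine} {c j i a x e d : ℕ} (hK : K.Closed n B A X Y) (hm : Regs n q k m)
    (h12 : m.reg 12 = c) (h14 : m.reg 14 = j) (h15 : m.reg 15 = d + 1) (h17 : m.reg 17 = i)
    (h18 : m.reg 18 = a) (hX : m.arr 5 (m.reg 16) = x) (he : m.arr 4 (m.reg 16) = e)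
    (hc : c < 5) (ha : a ∈ A) (hx : x ∈ X) :
    WP I.upStep m fun t m' => t ≤ I.τ B + 14 ∧ m'.reg 15 = d ∧ m'.reg 16 = e ∧
      m'.reg 17 = i + 1 ∧ m'.reg 18 = K.step ![n, c, a, x, flag q k j i] ∧
      (∀ x < 15, m'.reg x = m.reg x) ∧ m'.arr = m.arr ∧ m'.out = m.out := by
  refine .seq <| .load <| .seq <| (wp_flagProg (by simpa using hm.r7)).mono ?_
  rintro t₁ m₁ ⟨rfl, h20, hf, ha₁, ho₁⟩
  have f1 : ∀ x, x ≠ 19 → x ≠ 20 → x ≠ 21 → m₁.reg x = m.reg x := fun x h h' h'' => by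
    rw [hf x h' h'']; simp [h]
  refine .seq <| (I.wp_step hK ((f1 0 (by omega) (by omega) (by omega)).trans hm.r0)
    ((f1 12 (by omega) (by omega) (by omega)).trans h12)
    ((f1 18 (by omega) (by omega) (by omega)).trans h18)
    (x := x) (b := flag q k j i) ?_ ?_ hc ha hx (flag_le ..)).mono ?_
  · rw [hf 19 (by omega) (by omega)]; simp [hX]
  · rw [h20]; simp [hm.r2, hm.r3, h14, h17]
  rintro t₂ m₂ ⟨ht₂, hr⟩
  have f2 : ∀ x < 30, x ≠ 18 → x ≠ 19 → x ≠ 20 → x ≠ 21 → m₂.reg x = m.reg x :=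
    fun x h h' h1 h2 h3 => by rw [hr.frame x h h', f1 x h1 h2 h3]
  have harr : m₂.arr = m.arr := hr.arr.trans ha₁
  refine .seq <| .load <| .seq <| .add <| .seq <| .sub <| .skip
    ⟨by omega, ?_, ?_, ?_, ?_, fun x hx => ?_, harr, hr.output.trans ho₁⟩
  · simp [f2, h15, hm.r7]
  · simp [f2, harr, he]
  · simp [f2, h17, hm.r7]
  · simp [hr.value]
  · simp [show x ≠ 15 by omega, show x ≠ 16 by omega, show x ≠ 17 by omega]
    exact f2 x (by omega) (by omega) (by omega) (by omega) (by omega)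

open Forest in
-- The rounds correspond to the siblings of a forest. Arities are not bounded in terms of `n`, so
-- this time is kept as a multiple of the number of roots and is charged to the roots later.
theorem wp_upLoop (hK : K.Closed n B A X Y) {l : Lab} (hl : l.kind < 5) {f : Forest}
    (hf : f.Valid n) : ∀ {m : Machine} {i a o : ℕ}, Regs n q k m → m.reg 12 = l.kind →
    m.reg 14 = l.mark → m.reg 15 = f.len → m.reg 16 = o → m.reg 17 = i → m.reg 18 = a → a ∈ A →
    Done K n q k m.arr f o → WP (.loop 15 I.upStep) m fun t m' =>
      t ≤ f.len * (I.τ B + 15) + 1 ∧ m'.reg 16 = o + f.size ∧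
      m'.reg 18 = fold K n q k f l i a ∧
      (∀ x < 15, m'.reg x = m.reg x) ∧ m'.arr = m.arr ∧ m'.out = m.out := by
  induction f with
  | nil =>
    intro m i a o hm h12 h14 h15 h16 h17 h18 ha hd
    exact ⟨_, _, .loop_false h15, by simp, h16, h18, fun _ _ => rfl, rfl, rfl⟩
  | cons l' c r ihc ihr =>
    intro m i a o hm h12 h14 h15 h16 h17 h18 ha hd
    obtain ⟨⟨hd1, hd2, hd3⟩, hd4, hd5⟩ := hd
    rw [← h16] at hd1 hd2
    rw [len, Nat.add_comm] at h15
    obtain ⟨t₁, m₁, hr₁, ht₁, e15, e16, e17, e18, ef, ea, eo⟩ := I.wp_upStep hK hm h12 h14 h15 h17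
      h18 hd2 hd1 hl ha (value_mem hK hf.2.1 hf.1.1 hf.1.2)
    have hA : K.step ![n, l.kind, a, value K n q k l' c, flag q k l.mark i] ∈ A :=
      hK.step _ hl _ ha _ (value_mem hK hf.2.1 hf.1.1 hf.1.2) _ (flag_le ..)
    obtain ⟨t₂, m₂, hr₂, ht₂, g16, g18, gf, ga, go⟩ := ihr hf.2.2
      (hm.congr fun x hx => ef x (by omega))
      ((ef 12 (by omega)).trans h12) ((ef 14 (by omega)).trans h14) e15 e16 e17 e18 hA
      (by rw [ea, h16]; exact hd5)
    refine ⟨_, m₂, .loop_true (by omega) hr₁ hr₂, ?_, ?_, g18, fun x hx => ?_, ga.trans ea,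
      go.trans eo⟩
    · simp only [len, Nat.add_mul]; omega
    · rw [g16, h16]; simp only [size]; omega
    · rw [gf x hx, ef x hx]

open Forest in
/-- One round of the first pass. -/
theorem wp_upBody (hK : K.Closed n B A X Y) {l : Lab} {c r : Forest} {m : Machine} {o : ℕ}
    (hf : (Forest.cons l c r).Valid n) (hm : Regs n q k m) (h10 : m.reg 10 = o + 1)
    (hl : Laid m.arr (.cons l c r) o) (hd : Done K n q k m.arr c (o + 1)) :
    WP I.upBody m fun t m' => t ≤ I.τ B + 20 + c.len * (I.τ B + 15) ∧ m'.reg 10 = o ∧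
      (∀ x < 10, m'.reg x = m.reg x) ∧ m'.out = m.out ∧
      m'.arr 4 o = o + 1 + c.size ∧ m'.arr 5 o = value K n q k l c ∧
      m'.arr 6 o = fold K n q k c l 0 0 ∧
      ∀ a i, (a ≠ 4 ∧ a ≠ 5 ∧ a ≠ 6) ∨ i ≠ o → m'.arr a i = m.arr a i := by
  obtain ⟨⟨hl1, hl2, hl3, hl8⟩, -, -⟩ := hl
  refine .seq <| .sub' o (by simp [h10, hm.r7]) <| .seq <| .load' l.kind (by simpa) <|
    .seq <| .load' l.sym (by simpa) <| .seq <| .load' l.mark (by simpa) <|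
    .seq <| .load' c.len (by simpa) <| .seq <| .add' (o + 1) (by simp [hm.r7]) <|
    .seq <| .assign <| .seq <| .assign <| .seq ?_
  refine (I.wp_upLoop hK hf.1.1 hf.2.1 (i := 0) (a := 0) (o := o + 1) (l := l)
    (by exact hm.congr fun x hx => by simp (disch := omega) only [Machine.setReg_of_ne])
    (by simp) (by simp) (by simp) (by simp) (by simp) (by simp) hK.zero (by exact hd)).mono ?_
  rintro t₁ m₁ ⟨ht₁, h16, h18, ef, ea, eo⟩
  refine .seq <| (I.wp_fin hK (c := l.kind) (s := l.sym) (a := fold K n q k c l 0 0)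
    (by rw [ef 0 (by omega)]; simp [hm.r0]) (by rw [ef 12 (by omega)]; simp)
    (by rw [ef 13 (by omega)]; simp) h18 hf.1.1 hf.1.2
    (fold_mem hK hf.2.1 hf.1.1 hK.zero)).mono ?_
  rintro t₂ m₂ ⟨ht₂, hr⟩
  have e10 : m₂.reg 10 = o := by
    rw [hr.frame 10 (by omega) (by omega), ef 10 (by omega)]; simp
  have e16 : m₂.reg 16 = o + 1 + c.size := by
    rw [hr.frame 16 (by omega) (by omega), h16]
  have e18 : m₂.reg 18 = fold K n q k c l 0 0 := by
    rw [hr.frame 18 (by omega) (by omega), h18]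
  have e19 : m₂.reg 19 = value K n q k l c := hr.value
  have harr : m₂.arr = m.arr := hr.arr.trans ea
  refine .seq <| .store' _ _ e10 e16 <| .seq <| .store' _ _ e10 e18 <| .seq <|
    .store' _ _ e10 e19 <| .skip ⟨by omega, e10, fun x hx => ?_, hr.output.trans eo,
      by simp, by simp, by simp, fun a i h => ?_⟩
  · simp only [Machine.setArr_reg]
    rw [hr.frame x (by omega) (by omega), ef x (by omega)]
    simp (disch := omega) only [Machine.setReg_of_ne]
  · have h5 : ¬ (a = 5 ∧ i = o) := by omega
    have h6 : ¬ (a = 6 ∧ i = o) := by omega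
    have h4 : ¬ (a = 4 ∧ i = o) := by omega
    simp only [Machine.setArr_arr, h4, h5, h6, if_false, harr]

open Forest in
/-- The first pass. -/
theorem iter_up (hK : K.Closed n B A X Y) {f : Forest} (hf : f.Valid n) :
    ∀ {m : Machine} {o : ℕ}, Regs n q k m → m.reg 10 = o + f.size → Laid m.arr f o →
    ∃ t m', Iter 10 I.upBody f.size m t m' ∧ t + f.len * (I.τ B + 15) ≤ f.size * (2 * I.τ B + 36) ∧
      m'.reg 10 = o ∧ Done K n q k m'.arr f o ∧ (∀ x < 10, m'.reg x = m.reg x) ∧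
      m'.out = m.out ∧
      ∀ a i, (a ≠ 4 ∧ a ≠ 5 ∧ a ≠ 6) ∨ i < o ∨ o + f.size ≤ i → m'.arr a i = m.arr a i := by
  induction f with
  | nil =>
    intro m o hm h10 hl
    exact ⟨0, m, ⟨rfl, rfl⟩, by simp [len, size], h10, trivial, fun _ _ => rfl, rfl,
      fun _ _ _ => rfl⟩
  | cons l c r ihc ihr =>
    intro m o hm h10 hl
    simp only [size] at h10
    -- Since the index decreases, the later siblings come first, then the children, and the node
    -- itself last.
    obtain ⟨t₁, m₁, hi₁, ht₁, e10, hd₁, ef₁, eo₁, ea₁⟩ := ihr hf.2.2 (o := o + 1 + c.size) hm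
      (by omega) hl.2.2
    have hm₁ : Regs n q k m₁ := hm.congr fun x hx => ef₁ x (by omega)
    obtain ⟨t₂, m₂, hi₂, ht₂, g10, hd₂, ef₂, eo₂, ea₂⟩ := ihc hf.2.1 (o := o + 1) hm₁ (by omega)
      (hl.2.1.congr fun a ha i h1 h2 => ea₁ a i (by omega))
    have hm₂ : Regs n q k m₂ := hm₁.congr fun x hx => ef₂ x (by omega)
    have ea₁₂ : ∀ a i, (a ≠ 4 ∧ a ≠ 5 ∧ a ≠ 6) → m₂.arr a i = m.arr a i := fun a i h => by
      rw [ea₂ a i (Or.inl h), ea₁ a i (Or.inl h)]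
    obtain ⟨t₃, m₃, hr₃, ht₃, f10, ef₃, eo₃, f4, f5, f6, ea₃⟩ := I.wp_upBody hK hf hm₂ (o := o) g10
      (hl.congr fun a ha i h1 h2 => ea₁₂ a i (by omega)) hd₂
    refine ⟨t₁ + (t₂ + (t₃ + 1)), m₃, ?_, ?_, f10, ⟨⟨f4, f5, f6⟩, hd₂.congr fun a ha i h1 h2 => ea₃ a i (by omega),
      hd₁.congr fun a ha i h1 h2 => ?_⟩, fun x hx => ?_, ?_, fun a i h => ?_⟩
    · rw [show (cons l c r).size = r.size + (c.size + 1) by simp only [size]; omega]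
      exact hi₁.trans (hi₂.trans (Iter.one (by omega) hr₃))
    -- The summand with `f.len` reserves the cost of the child loop that the parent of the roots
    -- will execute. A node pays `I.τ B + 21` for its own round and `I.τ B + 15` for its turn in the
    -- loop of its parent.
    · simp only [size, len, Nat.add_mul, Nat.mul_add] at *
      omega
    · rw [ea₃ a i (by omega), ea₂ a i (by omega)]
    · rw [ef₃ x hx, ef₂ x hx, ef₁ x hx]
    · rw [eo₃, eo₂, eo₁]
    · simp only [size] at h
      rw [ea₃ a i (by omega), ea₂ a i (by omega), ea₁ a i (by omega)]

end Impl

/-! ### The second pass: contexts and listing -/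

namespace Impl

variable {K : Kernel} (I : Impl K) {n B q k : ℕ} {A X Y : Set ℕ}

open Forest

theorem wp_downStep {m : Machine} {l : Lab} {o i a y e d : ℕ} (hK : K.Closed n B A X Y)
    (hm : Regs n q k m) (h12 : m.reg 12 = l.kind) (h13 : m.reg 13 = l.sym)
    (h14 : m.reg 14 = l.mark) (h15 : m.reg 15 = d + 1) (h16 : m.reg 16 = o) (h17 : m.reg 17 = i)
    (h18 : m.reg 18 = a) (h22 : m.reg 22 = y) (he : m.arr 4 o = e)
    (hl : l.kind < 5) (hs : l.sym ≤ n) (ha : a ∈ A) (hy : y ∈ Y) :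
    WP I.downStep m fun t m' => t ≤ I.τ B + 15 ∧ m'.reg 15 = d ∧ m'.reg 16 = e ∧
      m'.reg 17 = i + 1 ∧ m'.reg 18 = a ∧ m'.reg 22 = y ∧ (∀ x < 15, m'.reg x = m.reg x) ∧
      m'.out = m.out ∧ m'.arr 7 o = childCtx K n q k l a y i ∧
      ∀ b j, b ≠ 7 ∨ j ≠ o → m'.arr b j = m.arr b j := by
  refine .seq <| .sub' (1 - i) (by simp [hm.r7, h17]) <| .seq <|
    (wp_flagProg (by simpa using hm.r7)).mono ?_
  rintro t₁ m₁ ⟨rfl, h20, hf, ha₁, ho₁⟩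
  have f1 : ∀ x, x ≠ 23 → x ≠ 20 → x ≠ 21 → m₁.reg x = m.reg x := fun x h h' h'' => by
    rw [hf x h' h'']; simp [h]
  refine .seq <| (I.wp_down hK (c := l.kind) (s := l.sym) (y := y) (a := a) (b := 1 - i)
    (b' := flag q k l.mark i) ((f1 0 (by omega) (by omega) (by omega)).trans hm.r0)
    ((f1 12 (by omega) (by omega) (by omega)).trans h12)
    ((f1 13 (by omega) (by omega) (by omega)).trans h13)
    ((f1 22 (by omega) (by omega) (by omega)).trans h22)
    ((f1 18 (by omega) (by omega) (by omega)).trans h18) ?_ ?_ hl hs hy ha (by omega)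
    (flag_le ..)).mono ?_
  · rw [hf 23 (by omega) (by omega)]; simp
  · rw [h20]; simp [hm.r2, hm.r3, h14, h17]
  rintro t₂ m₂ ⟨ht₂, hr⟩
  have f2 : ∀ x < 30, x ≠ 19 → x ≠ 20 → x ≠ 21 → x ≠ 23 → m₂.reg x = m.reg x :=
    fun x h h1 h2 h3 h4 => by rw [hr.frame x h h1, f1 x h4 h2 h3]
  have harr : m₂.arr = m.arr := hr.arr.trans ha₁
  refine .seq <| .store' o _ (by simp [f2, h16]) hr.value <| .seq <|
    .load' e (by simp [f2, harr, he, h16]) <| .seq <| .add' (i + 1) (by simp [f2, h17, hm.r7]) <|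
    .seq <| .sub' d (by simp [f2, h15, hm.r7]) <| .skip
    ⟨by omega, by simp, by simp, by simp, by simp [f2, h18], by simp [f2, h22], fun x hx => ?_,
      hr.output.trans ho₁, by simp [childCtx], fun b j hb => ?_⟩
  · simp (disch := omega) only [Machine.setReg_of_ne, Machine.setArr_reg]
    exact f2 x (by omega) (by omega) (by omega) (by omega) (by omega)
  · have : ¬ (b = 7 ∧ j = o) := by omega
    simp only [Machine.setReg_arr, Machine.setArr_arr, this, if_false, harr]

/-- The contexts of all children are computed from the same final accumulator and context of the
parent, so `a` and `y` stay fixed, unlike in the first pass. -/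
theorem wp_downLoop (hK : K.Closed n B A X Y) {l : Lab} (hl : l.kind < 5) (hs : l.sym ≤ n)
    {a y : ℕ} (ha : a ∈ A) (hy : y ∈ Y) {f : Forest} :
    ∀ {m : Machine} {i o : ℕ}, Regs n q k m → m.reg 12 = l.kind → m.reg 13 = l.sym →
    m.reg 14 = l.mark → m.reg 15 = f.len → m.reg 16 = o → m.reg 17 = i → m.reg 18 = a →
    m.reg 22 = y → Done K n q k m.arr f o → WP (.loop 15 I.downStep) m fun t m' =>
      t ≤ f.len * (I.τ B + 16) + 1 ∧ (∀ x < 15, m'.reg x = m.reg x) ∧ m'.out = m.out ∧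
      RootCtx K n q k m'.arr l a y f o i ∧
      ∀ b j, b ≠ 7 ∨ j < o ∨ o + f.size ≤ j → m'.arr b j = m.arr b j := by
  induction f with
  | nil =>
    intro m i o hm h12 h13 h14 h15 h16 h17 h18 h22 hd
    exact ⟨_, _, .loop_false h15, by simp, fun _ _ => rfl, rfl, trivial, fun _ _ _ => rfl⟩
  | cons l' c r ihc ihr =>
    intro m i o hm h12 h13 h14 h15 h16 h17 h18 h22 hd
    obtain ⟨⟨hd1, hd2, hd3⟩, hd4, hd5⟩ := hd
    rw [len, Nat.add_comm] at h15
    obtain ⟨t₁, m₁, hr₁, ht₁, e15, e16, e17, e18, e22, ef, eo, ey, ea⟩ := I.wp_downStep hK hm h12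
      h13 h14 h15 h16 h17 h18 h22 hd1 hl hs ha hy
    obtain ⟨t₂, m₂, hr₂, ht₂, gf, go, gc, ga⟩ := ihr
      (hm.congr fun x hx => ef x (by omega)) ((ef 12 (by omega)).trans h12)
      ((ef 13 (by omega)).trans h13) ((ef 14 (by omega)).trans h14) e15 e16 e17 e18 e22
      (hd5.congr fun b hb j h1 h2 => ea b j (by omega))
    refine ⟨t₁ + t₂ + 1, m₂, .loop_true (by omega) hr₁ hr₂, ?_, fun x hx => ?_, go.trans eo,
      ⟨?_, gc⟩, fun b j h => ?_⟩
    · simp only [len, Nat.add_mul]; omega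
    · rw [gf x hx, ef x hx]
    · rw [ga 7 o (by omega), ey]
    · simp only [size] at h
      rw [ga b j (by omega), ea b j (by omega)]

theorem wp_emitProg {m : Machine} {l : Lab} {y x : ℕ} (hK : K.Closed n B A X Y) (h0 : m.reg 0 = n)
    (h13 : m.reg 13 = l.sym) (h14 : m.reg 14 = l.mark) (h22 : m.reg 22 = y) (h19 : m.reg 19 = x)
    (hs : l.sym ≤ n) (hy : y ∈ Y) (hx : x ∈ X) :
    WP I.emitProg m fun t m' => t ≤ I.τ B + 4 ∧ (∀ x < 24, m'.reg x = m.reg x) ∧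
      m'.arr = m.arr ∧ m'.out = m.out ++ (ownList K n l y x).map fun l => n + l.mark := by
  refine .branch (fun hj => .seq ((I.wp_emit hK h0 h13 h22 h19 hs hy hx).mono ?_)) fun hj => ?_
  · rintro t₁ m₁ ⟨ht₁, hr⟩
    have e0 : m₁.reg 0 = n := (hr.frame 0 (by omega) (by omega)).trans h0
    have e14 : m₁.reg 14 = l.mark := (hr.frame 14 (by omega) (by omega)).trans h14
    have ef : ∀ x < 24, m₁.reg x = m.reg x := fun x hx => hr.frame x (by omega) (by omega)
    refine .branch (fun h => .seq (.add' (n + l.mark) (by rw [e0, e14]) (.put ⟨by omega,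
      fun x hx => ?_, hr.arr, ?_⟩))) fun h => .skip ⟨by omega, ef, hr.arr, ?_⟩
    · simp (disch := omega) only [Machine.setReg_of_ne, ef x hx]
    · rw [hr.value] at h
      simp [ownList, h14 ▸ hj, h, hr.output]
    · rw [hr.value] at h
      simp [ownList, h, hr.output]
  · exact .skip ⟨by omega, fun _ _ => rfl, rfl, by simp [ownList, h14 ▸ hj]⟩

/-- One round of the second pass. -/
theorem wp_downBody (hK : K.Closed n B A X Y) {l : Lab} {c r : Forest} {m : Machine} {o y d : ℕ}
    (hf : (Forest.cons l c r).Valid n) (hm : Regs n q k m) (h10 : m.reg 10 = o)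
    (h11 : m.reg 11 = d + 1) (hl : Laid m.arr (.cons l c r) o)
    (hd : Done K n q k m.arr (.cons l c r) o) (hy : m.arr 7 o = y) (hY : y ∈ Y) :
    WP I.downBody m fun t m' => t ≤ I.τ B + 22 + c.len * (I.τ B + 16) ∧ m'.reg 10 = o + 1 ∧
      m'.reg 11 = d ∧ (∀ x < 10, m'.reg x = m.reg x) ∧
      m'.out = m.out ++ (ownList K n l y (value K n q k l c)).map (fun l => n + l.mark) ∧
      RootCtx K n q k m'.arr l (fold K n q k c l 0 0) y c (o + 1) 0 ∧
      ∀ b j, b ≠ 7 ∨ j < o + 1 ∨ o + 1 + c.size ≤ j → m'.arr b j = m.arr b j := by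
  obtain ⟨⟨hl1, hl2, hl3, hl8⟩, -, -⟩ := hl
  obtain ⟨⟨hd4, hd5, hd6⟩, hdc, -⟩ := hd
  refine .seq <| .load' l.kind (by simpa [h10]) <| .seq <| .load' l.sym (by simpa [h10]) <|
    .seq <| .load' l.mark (by simpa [h10]) <| .seq <| .load' c.len (by simpa [h10]) <|
    .seq <| .load' (fold K n q k c l 0 0) (by simpa [h10]) <| .seq <| .load' y (by simpa [h10]) <|
    .seq <| .load' (value K n q k l c) (by simpa [h10]) <| .seq <|
    (I.wp_emitProg hK (l := l) (y := y) (x := value K n q k l c) (by simp [hm.r0]) (by simp)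
      (by simp) (by simp) (by simp) hf.1.2 hY (value_mem hK hf.2.1 hf.1.1 hf.1.2)).mono ?_
  rintro t₁ m₁ ⟨ht₁, hf₁, ha₁, ho₁⟩
  have hb : ∀ x < 12, m₁.reg x = m.reg x := fun x hx => by
    rw [hf₁ x (by omega)]
    simp (disch := omega) only [Machine.setReg_of_ne]
  simp only [Machine.setReg_arr, Machine.setReg_out] at ha₁ ho₁
  refine .seq <| .add' (o + 1) (by rw [hb 10 (by omega), hb 7 (by omega), h10, hm.r7]) <| .seq <|
    .assign <| .seq <| (I.wp_downLoop hK hf.1.1 hf.1.2 (fold_mem hK hf.2.1 hf.1.1 hK.zero) hY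
      (q := q) (k := k) (a := fold K n q k c l 0 0) (f := c) (o := o + 1) (i := 0) ?_ ?_ ?_ ?_ ?_ ?_ ?_ ?_ ?_ ?_).mono ?_
  · exact hm.congr fun x hx => by
      simp (disch := omega) only [Machine.setReg_of_ne]
      exact hb x (by omega)
  · simp [hf₁]
  · simp [hf₁]
  · simp [hf₁]
  · simp [hf₁]
  · simp
  · simp
  · simp [hf₁]
  · simp [hf₁]
  · simp only [Machine.setReg_arr, ha₁]; exact hdc
  · rintro t₂ m₂ ⟨ht₂, gf, go, gc, ga⟩
    have hc : ∀ x < 12, m₂.reg x = m.reg x := fun x hx => by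
      rw [gf x (by omega)]
      simp (disch := omega) only [Machine.setReg_of_ne]
      exact hb x hx
    refine .seq <| .add' (o + 1) (by rw [hc 10 (by omega), hc 7 (by omega), h10, hm.r7]) <|
      .seq <| .sub' d ?_ <| .skip ⟨by omega, by simp, by simp, fun x hx => ?_, go.trans ho₁, gc,
        fun b j h => ?_⟩
    · simp [hc, h11, hm.r7]
    · simp (disch := omega) only [Machine.setReg_of_ne]
      exact hc x (by omega)
    · simp only [Machine.setReg_arr, ga b j h, ha₁]

/-- The second pass. -/
theorem iter_down (hK : K.Closed n B A X Y) {f : Forest} (hf : f.Valid n) :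
    ∀ {m : Machine} {l : Lab} {a y i o d : ℕ}, Regs n q k m → m.reg 10 = o →
    m.reg 11 = f.size + d → l.kind < 5 → l.sym ≤ n → a ∈ A → y ∈ Y → Laid m.arr f o →
    Done K n q k m.arr f o → RootCtx K n q k m.arr l a y f o i →
    ∃ t m', Iter 11 I.downBody f.size m t m' ∧
      t + f.len * (I.τ B + 16) ≤ f.size * (2 * I.τ B + 39) ∧
      m'.reg 10 = o + f.size ∧ m'.reg 11 = d ∧ (∀ x < 10, m'.reg x = m.reg x) ∧
      m'.out = m.out ++ (listed K n q k f l a y i).map (fun l => n + l.mark) ∧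
      ∀ b j, b ≠ 7 ∨ j ≤ o ∨ o + f.size ≤ j → m'.arr b j = m.arr b j := by
  induction f with
  | nil =>
    intro m l a y i o d hm h10 h11 hl hs ha hy hld hd hc
    exact ⟨0, m, ⟨rfl, rfl⟩, by simp [len, size], h10, by simpa [size] using h11, fun _ _ => rfl,
      by simp [listed], fun _ _ _ => rfl⟩
  | cons l' c r ihc ihr =>
    intro m l a y i o d hm h10 h11 hl hs ha hy hld hd hc
    have hy' : childCtx K n q k l a y i ∈ Y := childCtx_mem hK hl hs ha hy
    obtain ⟨t₁, m₁, hr₁, ht₁, e10, e11, ef, eo, ec, ea⟩ := I.wp_downBody hK hf hm h10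
      (d := c.size + (r.size + d)) (by rw [h11]; simp only [size]; omega) hld hd hc.1 hy'
    have hm₁ : Regs n q k m₁ := hm.congr fun x hx => ef x (by omega)
    obtain ⟨t₂, m₂, hi₂, ht₂, g10, g11, gf, go, ga⟩ := ihc hf.2.1 hm₁ e10 e11 hf.1.1 hf.1.2
      (fold_mem hK hf.2.1 hf.1.1 hK.zero) hy'
      (hld.2.1.congr fun b hb j h1 h2 => ea b j (by omega))
      (hd.2.1.congr fun b hb j h1 h2 => ea b j (by omega)) ec
    have hm₂ : Regs n q k m₂ := hm₁.congr fun x hx => gf x (by omega)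
    have h2 : ∀ b j, b ≠ 7 ∨ j < o + 1 ∨ o + 1 + c.size ≤ j → m₂.arr b j = m.arr b j :=
      fun b j h => by rw [ga b j (by omega), ea b j h]
    obtain ⟨t₃, m₃, hi₃, ht₃, f10, f11, ff, fo, fa⟩ := ihr hf.2.2 hm₂ g10 g11 hl hs ha hy
      (hld.2.2.congr fun b hb j h1 h3 => h2 b j (by omega))
      (hd.2.2.congr fun b hb j h1 h3 => h2 b j (by omega))
      (hc.2.congr fun j h1 h3 => h2 7 j (by omega))
    refine ⟨(t₁ + 1) + (t₂ + t₃), m₃, ?_, ?_, ?_, f11, fun x hx => ?_, ?_, fun b j h => ?_⟩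
    · rw [show (cons l' c r).size = 1 + (c.size + r.size) by simp only [size]; omega]
      exact (Iter.one (by rw [h11]; simp only [size]; omega) hr₁).trans (hi₂.trans hi₃)
    -- The same charging as in the first pass: `I.τ B + 23` for the round of the node and `I.τ B +
    -- 16` for its turn in the loop of its parent.
    · simp only [size, len, Nat.add_mul, Nat.mul_add] at *
      omega
    · rw [f10]; simp only [size]; omega
    · rw [ff x hx, gf x hx, ef x hx]
    · rw [fo, go, eo]; simp [listed]
    · simp only [size] at h
      rw [fa b j (by omega), ga b j (by omega), ea b j (by omega)]

end Impl

/-! ### The output and the time for one target -/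

namespace Forest

variable (K : Kernel) (n q k : ℕ)

/-- The labels of the nodes that are to be listed, in the tree with root label `l` and
children `c`. -/
def treeListed (l : Lab) (c : Forest) : List Lab :=
  ownList K n l (K.root ![n]) (value K n q k l c) ++
    listed K n q k c l (fold K n q k c l 0 0) (K.root ![n]) 0

/-- The constants that are to be listed. -/
def constListed (x : ℕ) : List ℕ := (List.range n).filter fun c => K.const ![n, x, c] ≠ 0

/-- The output for one target. -/
def blockOut (l : Lab) (c : Forest) : List ℕ :=
  (treeListed K n q k l c).map (fun l => n + l.mark) ++
    (constListed K n (value K n q k l c)).map (· + 1) ++ [0]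

end Forest

namespace Impl

variable {K : Kernel} (I : Impl K) {n B q k : ℕ} {A X Y : Set ℕ}

open Forest

theorem wp_constLoop (hK : K.Closed n B A X Y) {m : Machine} {x : ℕ} (h0 : m.reg 0 = n)
    (h7 : m.reg 7 = 1) (h10 : m.reg 10 = 0) (h11 : m.reg 11 = n) (h19 : m.reg 19 = x)
    (hx : x ∈ X) :
    WP (.loop 11 I.constBody) m fun t m' => t ≤ n * (I.τ B + 8) + 1 ∧
      (∀ x < 10, m'.reg x = m.reg x) ∧ m'.arr = m.arr ∧
      m'.out = m.out ++ (constListed K n x).map (· + 1) := by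
  refine WP.loop (c := n) (T := I.τ B + 7) (fun j m' => m'.reg 11 = n - j ∧ m'.reg 10 = j ∧
    m'.reg 19 = x ∧ (∀ x < 10, m'.reg x = m.reg x) ∧ m'.arr = m.arr ∧ m'.out = m.out ++
      ((List.range j).filter fun c => K.const ![n, x, c] ≠ 0).map (· + 1)) ?_ ?_ ?_ ?_
  · exact ⟨h11, h10, h19, fun _ _ => rfl, rfl, by simp⟩
  · exact fun j m h => h.1
  · rintro j m₁ hj ⟨e11, e10, e19, ef, ea, eo⟩
    refine .seq <| (I.wp_const hK ((ef 0 (by omega)).trans h0) e19 e10 hx hj.le).mono ?_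
    rintro t₂ m₂ ⟨ht₂, hr⟩
    have f10 : m₂.reg 10 = j := (hr.frame 10 (by omega) (by omega)).trans e10
    have f7 : m₂.reg 7 = 1 :=
      (hr.frame 7 (by omega) (by omega)).trans ((ef 7 (by omega)).trans h7)
    have f11 : m₂.reg 11 = n - j := (hr.frame 11 (by omega) (by omega)).trans e11
    have f19 : m₂.reg 19 = x := (hr.frame 19 (by omega) (by omega)).trans e19
    have ff : ∀ x < 10, m₂.reg x = m.reg x := fun x hx =>
      (hr.frame x (by omega) (by omega)).trans (ef x hx)
    refine .seq <| .branch (fun h => .seq <| .add' (j + 1) (by rw [f10, f7]) <| .put ?_) fun h =>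
      .skip ?_
    · rw [hr.value] at h
      refine .seq <| .add' (j + 1) (by simp [f10, f7]) <| .seq <| .sub' (n - (j + 1))
        (by simp [f11, f7]; omega) <| .skip ⟨by omega, by simp, by simp, by simp [f19],
          fun x hx => ?_, hr.arr.trans ea, ?_⟩
      · simp (disch := omega) only [Machine.setReg_of_ne]
        exact ff x hx
      · simp [List.range_succ, hr.output, eo, h]
    · rw [hr.value] at h
      refine .seq <| .add' (j + 1) (by simp [f10, f7]) <| .seq <| .sub' (n - (j + 1))
        (by simp [f11, f7]; omega) <| .skip ⟨by omega, by simp, by simp, by simp [f19],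
          fun x hx => ?_, hr.arr.trans ea, ?_⟩
      · simp (disch := omega) only [Machine.setReg_of_ne]
        exact ff x hx
      · simp [List.range_succ, hr.output, eo, h]
  · rintro t m' ⟨-, -, -, ef, ea, eo⟩ ht
    exact ⟨by linarith, ef, ea, eo⟩

/-- A bound for the time per node of the passes for one target. -/
def blockTime (B : ℕ) : ℕ := 6 * I.τ B + 150 + B * (I.τ B + 8)

/-- The root has no parent, so its context is stored explicitly and its round is treated apart from
those of its descendants. Nothing is assumed about the arrays `4` to `7`: they are rewritten before
they are read, and can be reused for the next target. -/
theorem wp_blockProg (hK : K.Closed n B A X Y) {l : Lab} {c : Forest}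
    (hf : (Forest.cons l c .nil).Valid n) {m : Machine} (hm : Regs n q k m)
    (h1 : m.reg 1 = 1 + c.size) (hl : Laid m.arr (.cons l c .nil) 0) :
    WP I.blockProg m fun t m' => t ≤ I.blockTime B * (1 + c.size) ∧
      (∀ x < 8, m'.reg x = m.reg x) ∧ m'.out = m.out ++ blockOut K n q k l c ∧
      ∀ b, b ≠ 4 → b ≠ 5 → b ≠ 6 → b ≠ 7 → m'.arr b = m.arr b := by
  refine .seq <| .assign <| .seq <| .add' (1 + c.size) (by simp [h1]) ?_
  obtain ⟨t₁, m₁, hi₁, ht₁, e10, hd₁, ef, eo, ea⟩ := I.iter_up hK hf (n := n) (q := q) (k := k)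
    (m := (m.setReg 8 0).setReg 10 (1 + c.size)) (o := 0)
    (hm.congr fun x hx => by simp (disch := omega) only [Machine.setReg_of_ne])
    (by simp [size]) hl
  have ef' : ∀ x < 8, m₁.reg x = m.reg x := fun x hx => by
    rw [ef x (by omega)]; simp (disch := omega) only [Machine.setReg_of_ne]
  have e8 : m₁.reg 8 = 0 := by rw [ef 8 (by omega)]; simp
  simp only [Machine.setReg_arr, Machine.setReg_out] at eo ea
  refine .seq ⟨_, m₁, hi₁.runs e10, ?_⟩
  have hm₁ := hm.congr ef'
  refine .seq <| (I.wp_root hK hm₁.r0).mono ?_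
  rintro t₂ m₂ ⟨ht₂, hr₂⟩
  have f8 : ∀ x < 9, m₂.reg x = m₁.reg x := fun x hx => hr₂.frame x (by omega) (by omega)
  refine .seq <| .assign <| .seq <| .store' 0 (K.root ![n]) (by simp) (by simp [hr₂.value]) <|
    .seq <| .add' (1 + c.size) (by simp [f8, e8, ef', h1]) <| .seq ?_
  set m₃ : Machine := ((m₂.setReg 10 0).setArr 7 0 (K.root ![n])).setReg 11 (1 + c.size) with hm₃
  have g8 : ∀ x < 9, m₃.reg x = m₁.reg x := fun x hx => by
    rw [← f8 x hx, hm₃]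
    simp (disch := omega) only [Machine.setReg_of_ne, Machine.setArr_reg]
  have ga : ∀ b j, b ≠ 7 ∨ j ≠ 0 → m₃.arr b j = m₁.arr b j := fun b j h => by
    have : ¬ (b = 7 ∧ j = 0) := by omega
    simp only [hm₃, Machine.setReg_arr, Machine.setArr_arr, this, if_false, hr₂.arr]
  have hr3 : Regs n q k m₃ := hm₁.congr fun x hx => g8 x (by omega)
  have hl₁ : Laid m₁.arr (.cons l c .nil) 0 := hl.congr fun a ha i _ _ => ea a i (by omega)
  have hl₃ : Laid m₃.arr (.cons l c .nil) 0 := hl₁.congr fun a ha i _ _ => ga a i (by omega)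
  have hd₃ : Done K n q k m₃.arr (.cons l c .nil) 0 :=
    hd₁.congr fun a ha i _ _ => ga a i (by omega)
  obtain ⟨t₄, m₄, hr₄, ht₄, i10, i11, iF, io, ic, ia⟩ := I.wp_downBody hK hf hr3 (o := 0)
    (d := c.size) (by simp [hm₃]) (by simp [hm₃, Nat.add_comm]) hl₃ hd₃ (by simp [hm₃]) hK.root
  have hm₄ : Regs n q k m₄ := hr3.congr fun x hx => iF x (by omega)
  obtain ⟨t₅, m₅, hi₅, ht₅, j10, j11, jf, jo, ja⟩ := I.iter_down hK hf.2.1 hm₄ (d := 0) i10 i11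
    hf.1.1 hf.1.2 (fold_mem hK hf.2.1 hf.1.1 hK.zero) hK.root
    (hl₃.2.1.congr fun b hb j h1 h2 => ia b j (by omega))
    (hd₃.2.1.congr fun b hb j h1 h2 => ia b j (by omega)) ic
  refine ⟨_, m₅, ((Iter.one (by simp [hm₃]) hr₄).trans hi₅).runs j11, ?_⟩
  have k8 : ∀ x < 9, m₅.reg x = m₁.reg x := fun x hx => by
    rw [jf x (by omega), iF x (by omega), g8 x hx]
  have k5 : m₅.arr 5 0 = value K n q k l c := by
    rw [ja 5 0 (by omega), ia 5 0 (by omega)]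
    exact hd₃.1.2.1
  refine .seq <| .assign <| .seq <| .add' n (by simp [k8, hm₁.r0, e8]) <| .seq <|
    .load' (value K n q k l c) (by simp [k5]) <| .seq <|
    (I.wp_constLoop hK (by simp [k8, hm₁.r0]) (by simp [k8, hm₁.r7]) (by simp) (by simp)
      (x := value K n q k l c) (by simp) (value_mem hK hf.2.1 hf.1.1 hf.1.2)).mono ?_
  rintro t₆ m₆ ⟨ht₆, lf, la, lo⟩
  refine .seq <| .assign <| .seq <| .put <| .skip ⟨?_, fun x hx => ?_, ?_, fun b h4 h5 h6 h7 => ?_⟩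
  -- The loop over the constants runs only once for each target; as the tree has at least one node,
  -- its cost may be counted as a cost per node.
  · have h8 : n * (I.τ B + 8) ≤ B * (I.τ B + 8) := Nat.mul_le_mul_right _ hK.le_n
    have h9 : B * (I.τ B + 8) ≤ B * (I.τ B + 8) * (1 + c.size) :=
      Nat.le_mul_of_pos_right _ (by omega)
    simp only [blockTime, size, len, Nat.add_mul, Nat.mul_add, Nat.mul_one, Nat.one_mul,
      Nat.add_zero, Nat.mul_assoc] at *
    have h10 := Nat.mul_comm (I.τ B) c.size
    have h11 := Nat.mul_left_comm c.size 2 (I.τ B)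
    omega
  · simp (disch := omega) only [Machine.setReg_of_ne]
    rw [lf x (by omega)]
    simp (disch := omega) only [Machine.setReg_of_ne]
    rw [k8 x (by omega), ef' x hx]
  · simp [lo, jo, io, hm₃, hr₂.output, eo, blockOut, treeListed]
  · funext j
    simp only [Machine.setReg_arr, la]
    rw [ja b j (by omega), ia b j (by omega), ga b j (by omega), ea b j (by omega)]

end Impl

/-! ### The whole program -/

/-- The number of children of a node, in terms of its kind and symbol and of the table of ranks. -/
def arityOf (rk : ℕ → ℕ) (l : Lab) : ℕ :=
  if l.kind = 0 then 0 else if l.kind = 1 then 2 else if l.kind = 2 then 2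
  else if l.kind = 3 then 1 else rk l.sym

/-- The numbers of children fit to the labels, and the nodes that are applications of symbols of
positive rank are marked by `j + 1, j + 2, …`. -/
def Marked (rk : ℕ → ℕ) : ℕ → List (Lab × ℕ) → Prop
  | _, [] => True
  | j, p :: L => p.2 = arityOf rk p.1 ∧ p.1.kind < 5 ∧
      if p.1.kind = 4 ∧ p.2 ≠ 0 then p.1.mark = j + 1 ∧ Marked rk (j + 1) L
      else p.1.mark = 0 ∧ Marked rk j L

/-- The arrays `1` and `2` hold the kinds and symbols of a list of labels, from index `o` on. -/
def TokenRow (A : ℕ → ℕ → ℕ) : List (Lab × ℕ) → ℕ → Prop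
  | [], _ => True
  | p :: L, o => (A 1 o = p.1.kind ∧ A 2 o = p.1.sym) ∧ TokenRow A L (o + 1)

/-- The arrays `1`, `2`, `3` and `8` hold the entries of a list of labels, from index `o` on. -/
def LabelRow (A : ℕ → ℕ → ℕ) : List (Lab × ℕ) → ℕ → Prop
  | [], _ => True
  | p :: L, o => (A 1 o = p.1.kind ∧ A 2 o = p.1.sym ∧ A 3 o = p.1.mark ∧ A 8 o = p.2) ∧
      LabelRow A L (o + 1)

theorem TokenRow.congr {A A' : ℕ → ℕ → ℕ} {L : List (Lab × ℕ)} : ∀ {o : ℕ}, TokenRow A L o →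
    A' 1 = A 1 → A' 2 = A 2 → TokenRow A' L o := by
  induction L with
  | nil => exact fun _ _ _ => trivial
  | cons p L ih =>
    intro o h h1 h2
    exact ⟨by rw [h1, h2]; exact h.1, ih h.2 h1 h2⟩

theorem LabelRow.congr {A A' : ℕ → ℕ → ℕ} {L : List (Lab × ℕ)} : ∀ {o : ℕ}, LabelRow A L o →
    A' 1 = A 1 → A' 2 = A 2 → A' 3 = A 3 → A' 8 = A 8 → LabelRow A' L o := by
  induction L with
  | nil => exact fun _ _ _ _ _ => trivial
  | cons p L ih =>
    intro o h h1 h2 h3 h8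
    exact ⟨by rw [h1, h2, h3, h8]; exact h.1, ih h.2 h1 h2 h3 h8⟩

theorem labelRow_append {A : ℕ → ℕ → ℕ} {L L' : List (Lab × ℕ)} : ∀ {o : ℕ},
    LabelRow A (L ++ L') o ↔ LabelRow A L o ∧ LabelRow A L' (o + L.length) := by
  induction L with
  | nil => simp [LabelRow]
  | cons p L ih =>
    intro o
    simp only [List.cons_append, LabelRow, ih, List.length_cons, and_assoc]
    rw [Nat.add_right_comm, Nat.add_assoc o]

theorem Forest.laid_iff {A : ℕ → ℕ → ℕ} {f : Forest} : ∀ {o : ℕ},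
    Laid A f o ↔ LabelRow A f.labels o := by
  induction f with
  | nil => simp [Laid, labels, LabelRow]
  | cons l c r ihc ihr =>
    intro o
    simp only [Laid, labels, LabelRow, labelRow_append, ihc, ihr, length_labels]

/-- Store the mark and the number of children of the node `reg 10`. -/
def prepBody : Prog := .block [.load 12 1 10, .load 13 2 10,
  .branch 12 (.seq (.sub 12 12 7) (.branch 12 (.seq (.sub 12 12 7) (.branch 12
    (.seq (.sub 12 12 7) (.branch 12
      (.seq (.load 15 0 13) (.branch 15 (.seq (.add 14 14 7) (.store 3 10 14)) .skip))
      (.assign 15 1))) (.assign 15 2))) (.assign 15 2))) (.assign 15 0),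
  .store 8 10 15, .add 10 10 7, .sub 11 11 7]

/-- The kind is decoded by repeated decrements. Kind 4 reads the rank table and takes a fresh mark
if the rank is positive; all other nodes keep the initial entry 0 of array `3`, which means
unmarked. -/
theorem wp_prepBody {m : Machine} {p : Lab × ℕ} {o j d : ℕ} (h7 : m.reg 7 = 1)
    (h10 : m.reg 10 = o) (h11 : m.reg 11 = d + 1) (h14 : m.reg 14 = j) (h1 : m.arr 1 o = p.1.kind)
    (h2 : m.arr 2 o = p.1.sym) (h3 : m.arr 3 o = 0) (hp : p.2 = arityOf (m.arr 0) p.1)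
    (hk : p.1.kind < 5) (hmk : p.1.mark = if p.1.kind = 4 ∧ p.2 ≠ 0 then j + 1 else 0) :
    WP prepBody m fun t m' => t ≤ 20 ∧ m'.reg 10 = o + 1 ∧ m'.reg 11 = d ∧
      m'.reg 14 = (if p.1.kind = 4 ∧ p.2 ≠ 0 then j + 1 else j) ∧
      (∀ x < 10, m'.reg x = m.reg x) ∧ m'.out = m.out ∧ m'.arr 3 o = p.1.mark ∧
      m'.arr 8 o = p.2 ∧ ∀ b i, (b ≠ 3 ∧ b ≠ 8) ∨ i ≠ o → m'.arr b i = m.arr b i := by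
  refine .seq <| .load' p.1.kind (by simpa [h10]) <| .seq <| .load' p.1.sym (by simpa [h10]) <|
    .seq <| WP.mono (Q := fun t m₁ => t ≤ 13 ∧ m₁.reg 15 = p.2 ∧
      m₁.reg 14 = (if p.1.kind = 4 ∧ p.2 ≠ 0 then j + 1 else j) ∧
      (∀ x < 12, m₁.reg x = m.reg x) ∧ m₁.out = m.out ∧ m₁.arr 3 o = p.1.mark ∧
      ∀ b i, b ≠ 3 ∨ i ≠ o → m₁.arr b i = m.arr b i) ?_ ?_
  · have hc : p.1.kind = 0 ∨ p.1.kind = 1 ∨ p.1.kind = 2 ∨ p.1.kind = 3 ∨ p.1.kind = 4 := by omega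
    rcases hc with hc | hc | hc | hc | hc <;> simp only [arityOf, hc] at hp <;>
      simp only [hc] at hmk ⊢
    · refine .branch_false (by simp) <| .assign ⟨by omega, by simp [hp], by simp [h14],
        fun x hx => ?_, rfl, by simpa [h3] using hmk.symm, fun _ _ _ => rfl⟩
      simp (disch := omega) only [Machine.setReg_of_ne]
    · refine .branch_true (by simp) <| .seq <| .sub' 0 (by simp [h7]) <|
        .branch_false (by simp) <| .assign ⟨by omega, by simp [hp], by simp [h14],
        fun x hx => ?_, rfl, by simpa [h3] using hmk.symm, fun _ _ _ => rfl⟩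
      simp (disch := omega) only [Machine.setReg_of_ne]
    · refine .branch_true (by simp) <| .seq <| .sub' 1 (by simp [h7]) <|
        .branch_true (by simp) <| .seq <| .sub' 0 (by simp [h7]) <|
        .branch_false (by simp) <| .assign ⟨by omega, by simp [hp], by simp [h14],
        fun x hx => ?_, rfl, by simpa [h3] using hmk.symm, fun _ _ _ => rfl⟩
      simp (disch := omega) only [Machine.setReg_of_ne]
    · refine .branch_true (by simp) <| .seq <| .sub' 2 (by simp [h7]) <|
        .branch_true (by simp) <| .seq <| .sub' 1 (by simp [h7]) <|
        .branch_true (by simp) <| .seq <| .sub' 0 (by simp [h7]) <|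
        .branch_false (by simp) <| .assign ⟨by omega, by simp [hp], by simp [h14],
        fun x hx => ?_, rfl, by simpa [h3] using hmk.symm, fun _ _ _ => rfl⟩
      simp (disch := omega) only [Machine.setReg_of_ne]
    · refine .branch_true (by simp) <| .seq <| .sub' 3 (by simp [h7]) <|
        .branch_true (by simp) <| .seq <| .sub' 2 (by simp [h7]) <|
        .branch_true (by simp) <| .seq <| .sub' 1 (by simp [h7]) <|
        .branch_true (by simp) <| .seq <| .load' p.2 (by simp [hp]) ?_
      by_cases hp0 : p.2 = 0
      · refine .branch_false (by simp [hp0]) <| .skip ⟨by omega, by simp, by simp [h14, hp0],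
          fun x hx => ?_, rfl, by simpa [h3, hp0] using hmk.symm, fun _ _ _ => rfl⟩
        simp (disch := omega) only [Machine.setReg_of_ne]
      · refine .branch_true (by simp [hp0]) <| .seq <| .add' (j + 1) (by simp [h14, h7]) <|
          .store' o (j + 1) (by simp [h10]) (by simp) ⟨by omega, by simp, by simp [hp0],
          fun x hx => ?_, rfl, by simpa [hp0] using hmk.symm, fun b i h => ?_⟩
        · simp (disch := omega) only [Machine.setReg_of_ne, Machine.setArr_reg]
        · have : ¬ (b = 3 ∧ i = o) := by omega
          simp only [Machine.setReg_arr, Machine.setArr_arr, this, if_false]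
  · rintro t₁ m₁ ⟨ht₁, e15, e14, ef, eo, e3, ea⟩
    refine .seq <| .store' o p.2 (by rw [ef 10 (by omega), h10]) e15 <| .seq <|
      .add' (o + 1) (by simp [ef, h10, h7]) <| .seq <| .sub' d (by simp [ef, h11, h7]) <|
      .skip ⟨by omega, by simp, by simp, by simp [e14], fun x hx => ?_, eo, by simp [e3],
        by simp, fun b i h => ?_⟩
    · simp (disch := omega) only [Machine.setReg_of_ne, Machine.setArr_reg]
      exact ef x (by omega)
    · have : ¬ (b = 8 ∧ i = o) := by omega
      simp only [Machine.setReg_arr, Machine.setArr_arr, this, if_false]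
      exact ea b i (by omega)

theorem wp_prepLoop {L : List (Lab × ℕ)} : ∀ {m : Machine} {o j : ℕ}, m.reg 7 = 1 →
    m.reg 10 = o → m.reg 11 = L.length → m.reg 14 = j → TokenRow m.arr L o →
    Marked (m.arr 0) j L → (∀ i, o ≤ i → m.arr 3 i = 0) →
    WP (.loop 11 prepBody) m fun t m' => t ≤ L.length * 21 + 1 ∧
      (∀ x < 10, m'.reg x = m.reg x) ∧ m'.out = m.out ∧ LabelRow m'.arr L o ∧
      ∀ b i, (b ≠ 3 ∧ b ≠ 8) ∨ i < o → m'.arr b i = m.arr b i := by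
  induction L with
  | nil =>
    intro m o j h7 h10 h11 h14 ht hm h3
    exact ⟨_, _, .loop_false h11, by simp, fun _ _ => rfl, rfl, trivial, fun _ _ _ => rfl⟩
  | cons p L ih =>
    intro m o j h7 h10 h11 h14 ht hm h3
    obtain ⟨hm1, hm2, hm3⟩ := hm
    obtain ⟨t₁, m₁, hr₁, ht₁, e10, e11, e14, ef, eo, e3, e8, ea⟩ := wp_prepBody h7 h10 h11 h14
      ht.1.1 ht.1.2 (h3 o le_rfl) hm1 hm2 (by split at hm3 <;> rename_i h <;> [rw [if_pos h, hm3.1]; rw [if_neg h, hm3.1]])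
    have hrow : ∀ b, b ≠ 3 → b ≠ 8 → m₁.arr b = m.arr b := fun b h3 h8 =>
      funext fun i => ea b i (Or.inl ⟨h3, h8⟩)
    obtain ⟨t₂, m₂, hr₂, ht₂, ff, fo, fr, fa⟩ := ih ((ef 7 (by omega)).trans h7) e10 e11 e14
      (ht.2.congr (hrow 1 (by omega) (by omega)) (hrow 2 (by omega) (by omega)))
      (by
        rw [hrow 0 (by omega) (by omega)]
        split at hm3 <;> rename_i h <;> [rw [if_pos h]; rw [if_neg h]] <;> exact hm3.2)
      (fun i hi => by rw [ea 3 i (by omega)]; exact h3 i (by omega))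
    refine ⟨t₁ + t₂ + 1, m₂, .loop_true (by rw [h11]; simp) hr₁ hr₂, ?_, fun x hx => ?_,
      fo.trans eo, ⟨⟨?_, ?_, ?_, ?_⟩, fr⟩, fun b i h => ?_⟩
    · simp only [List.length_cons]; omega
    · rw [ff x hx, ef x hx]
    · rw [fa 1 o (by omega), ea 1 o (by omega), ht.1.1]
    · rw [fa 2 o (by omega), ea 2 o (by omega), ht.1.2]
    · rw [fa 3 o (by omega), e3]
    · rw [fa 8 o (by omega), e8]
    · rw [fa b i (by omega), ea b i (by omega)]

namespace Impl

variable {K : Kernel} (I : Impl K) {n B : ℕ} {A X Y : Set ℕ}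

open Forest

/-- Register 2 holds the mark and register 3 the child number of the target. Register 4 is the index
of its node, 5 counts the remaining nodes and 6 the remaining children. -/
def targetBody : Prog := .block [I.blockProg, .add 3 3 7, .sub 6 6 7]

def nodeBody : Prog := .block [.load 2 3 4,
  .branch 2 (.block [.load 6 8 4, .assign 3 0, .loop 6 I.targetBody]) .skip,
  .add 4 4 7, .sub 5 5 7]

def mainProg : Prog := .block [.assign 7 1, .add 11 1 8, .loop 11 prepBody, .add 5 1 8,
  .loop 5 I.nodeBody]

/-- The output for the targets at one node. -/
def nodeOut (K : Kernel) (n : ℕ) (l : Lab) (c : Forest) (p : Lab × ℕ) : List ℕ :=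
  if p.1.mark = 0 then [] else (List.range p.2).flatMap fun k => blockOut K n p.1.mark k l c

/-- The number of targets. -/
def targets : List (Lab × ℕ) → ℕ
  | [] => 0
  | p :: L => (if p.1.mark = 0 then 0 else p.2) + targets L

/-- The passes leave the arrays `1`, `2`, `3` and `8` intact, so the labels remain available for
every child number. -/
theorem wp_targetLoop (hK : K.Closed n B A X Y) {l : Lab} {c : Forest}
    (hf : (Forest.cons l c .nil).Valid n) {m : Machine} {q a : ℕ} (hm : Regs n q 0 m)
    (h1 : m.reg 1 = 1 + c.size) (h6 : m.reg 6 = a) (hl : LabelRow m.arr (cons l c nil).labels 0) :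
    WP (.loop 6 I.targetBody) m fun t m' =>
      t ≤ a * (I.blockTime B * (1 + c.size) + 4) + 1 ∧
      (∀ x < 8, x ≠ 3 → x ≠ 6 → m'.reg x = m.reg x) ∧
      m'.out = m.out ++ (List.range a).flatMap (fun k => blockOut K n q k l c) ∧
      ∀ b, b ≠ 4 → b ≠ 5 → b ≠ 6 → b ≠ 7 → m'.arr b = m.arr b := by
  refine WP.loop (c := a) (T := I.blockTime B * (1 + c.size) + 3) (fun j m' => m'.reg 6 = a - j ∧
    m'.reg 3 = j ∧ (∀ x < 8, x ≠ 3 → x ≠ 6 → m'.reg x = m.reg x) ∧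
    m'.out = m.out ++ (List.range j).flatMap (fun k => blockOut K n q k l c) ∧
    ∀ b, b ≠ 4 → b ≠ 5 → b ≠ 6 → b ≠ 7 → m'.arr b = m.arr b) ?_ ?_ ?_ ?_
  · exact ⟨h6, hm.r3, fun _ _ _ _ => rfl, by simp, fun _ _ _ _ _ => rfl⟩
  · exact fun j m h => h.1
  · rintro j m₁ hj ⟨e6, e3, ef, eo, ea⟩
    have hm₁ : Regs n q j m₁ := ⟨(ef 0 (by omega) (by omega) (by omega)).trans hm.r0,
      (ef 2 (by omega) (by omega) (by omega)).trans hm.r2, e3,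
      (ef 7 (by omega) (by omega) (by omega)).trans hm.r7⟩
    refine .seq <| (I.wp_blockProg hK hf hm₁ ((ef 1 (by omega) (by omega) (by omega)).trans h1)
      (laid_iff.2 (hl.congr (ea 1 (by omega) (by omega) (by omega) (by omega))
        (ea 2 (by omega) (by omega) (by omega) (by omega))
        (ea 3 (by omega) (by omega) (by omega) (by omega))
        (ea 8 (by omega) (by omega) (by omega) (by omega))))).mono ?_
    rintro t₂ m₂ ⟨ht₂, ff, fo, fa⟩
    refine .seq <| .add' (j + 1) (by simp [ff, hm₁.r3, hm₁.r7]) <| .seq <|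
      .sub' (a - (j + 1)) (by simp [ff, e6, hm₁.r7]; omega) <| .skip
      ⟨by omega, by simp, by simp, fun x hx h3 h6 => ?_, ?_, fun b h4 h5 h6 h7 => ?_⟩
    · simp (disch := omega) only [Machine.setReg_of_ne]
      rw [ff x hx, ef x hx h3 h6]
    · simp [fo, eo, List.range_succ]
    · exact (fa b h4 h5 h6 h7).trans (ea b h4 h5 h6 h7)
  · rintro t m' ⟨-, -, ef, eo, ea⟩ ht
    exact ⟨by linarith, ef, eo, ea⟩

theorem wp_nodeBody (hK : K.Closed n B A X Y) {l : Lab} {c : Forest}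
    (hf : (Forest.cons l c .nil).Valid n) {m : Machine} {p : Lab × ℕ} {o d : ℕ}
    (h0 : m.reg 0 = n) (h7 : m.reg 7 = 1) (h1 : m.reg 1 = 1 + c.size) (h4 : m.reg 4 = o)
    (h5 : m.reg 5 = d + 1) (hl : LabelRow m.arr (cons l c nil).labels 0)
    (h3 : m.arr 3 o = p.1.mark) (h8 : m.arr 8 o = p.2) :
    WP I.nodeBody m fun t m' =>
      t ≤ 10 + (if p.1.mark = 0 then 0 else p.2) * (I.blockTime B * (1 + c.size) + 4) ∧
      m'.reg 4 = o + 1 ∧ m'.reg 5 = d ∧ m'.reg 0 = n ∧ m'.reg 1 = 1 + c.size ∧ m'.reg 7 = 1 ∧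
      m'.out = m.out ++ nodeOut K n l c p ∧
      ∀ b, b ≠ 4 → b ≠ 5 → b ≠ 6 → b ≠ 7 → m'.arr b = m.arr b := by
  refine .seq <| .load' p.1.mark (by simp [h4, h3]) <| .seq ?_
  by_cases hz : p.1.mark = 0
  · exact .branch_false (by simp [hz]) <| .skip <| .seq <| .add' (o + 1) (by simp [h4, h7]) <|
      .seq <| .sub' d (by simp [h5, h7]) <| .skip ⟨by simp [hz], by simp, by simp, by simp [h0],
        by simp [h1], by simp [h7], by simp [nodeOut, hz], fun _ _ _ _ _ => rfl⟩
  · refine .branch_true (by simp [hz]) <| .seq <| .load' p.2 (by simp [h4, h8]) <| .seq <|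
      .assign <| .seq <| (I.wp_targetLoop hK hf (q := p.1.mark) (a := p.2)
        ⟨by simp [h0], by simp, by simp, by simp [h7]⟩ (by simp [h1]) (by simp)
        (by exact hl)).mono ?_
    rintro t₂ m₂ ⟨ht₂, ff, fo, fa⟩
    refine .skip <| .seq <| .add' (o + 1) (by simp [ff, h4, h7]) <|
      .seq <| .sub' d (by simp [ff, h5, h7]) <| .skip ⟨?_, by simp, by simp,
        by simp [ff, h0], by simp [ff, h1], by simp [ff, h7], ?_, fun b h4 h5 h6 h7 => ?_⟩
    · simp only [hz, if_false]; omega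
    · simp [fo, nodeOut, hz]
    · exact fa b h4 h5 h6 h7

theorem wp_nodeLoop (hK : K.Closed n B A X Y) {l : Lab} {c : Forest}
    (hf : (Forest.cons l c .nil).Valid n) {L : List (Lab × ℕ)} : ∀ {m : Machine} {o : ℕ},
    m.reg 0 = n → m.reg 7 = 1 → m.reg 1 = 1 + c.size → m.reg 4 = o → m.reg 5 = L.length →
    LabelRow m.arr (cons l c nil).labels 0 → LabelRow m.arr L o →
    WP (.loop 5 I.nodeBody) m fun t m' =>
      t ≤ L.length * 11 + targets L * (I.blockTime B * (1 + c.size) + 4) + 1 ∧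
      m'.out = m.out ++ L.flatMap (nodeOut K n l c) := by
  induction L with
  | nil =>
    intro m o h0 h7 h1 h4 h5 hl hL
    exact ⟨_, _, .loop_false h5, by simp [targets], by simp⟩
  | cons p L ih =>
    intro m o h0 h7 h1 h4 h5 hl hL
    obtain ⟨t₁, m₁, hr₁, ht₁, e4, e5, e0, e1, e7, eo, ea⟩ := I.wp_nodeBody hK hf h0 h7 h1 h4 h5 hl
      hL.1.2.2.1 hL.1.2.2.2
    have hcongr : ∀ {L : List (Lab × ℕ)} {o : ℕ}, LabelRow m.arr L o → LabelRow m₁.arr L o :=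
      fun h => h.congr (ea 1 (by omega) (by omega) (by omega) (by omega))
        (ea 2 (by omega) (by omega) (by omega) (by omega))
        (ea 3 (by omega) (by omega) (by omega) (by omega))
        (ea 8 (by omega) (by omega) (by omega) (by omega))
    obtain ⟨t₂, m₂, hr₂, ht₂, fo⟩ := ih e0 e7 e1 e4 e5 (hcongr hl) (hcongr hL.2)
    refine ⟨t₁ + t₂ + 1, m₂, .loop_true (by rw [h5]; simp) hr₁ hr₂, ?_, ?_⟩
    · simp only [targets, List.length_cons, Nat.add_mul]
      omega
    · simp [fo, eo]

theorem wp_mainProg (hK : K.Closed n B A X Y) {l : Lab} {c : Forest}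
    (hf : (Forest.cons l c .nil).Valid n) {m : Machine} (hreg : ∀ x, 1 < x → m.reg x = 0)
    (h0 : m.reg 0 = n) (h1 : m.reg 1 = 1 + c.size) (hout : m.out = [])
    (ht : TokenRow m.arr (cons l c nil).labels 0)
    (hmk : Marked (m.arr 0) 0 (cons l c nil).labels) (h3 : ∀ i, m.arr 3 i = 0) :
    WP I.mainProg m fun t m' =>
      t ≤ 50 * (1 + c.size) +
        targets (cons l c nil).labels * (I.blockTime B * (1 + c.size) + 4) ∧
      m'.out = (cons l c nil).labels.flatMap (nodeOut K n l c) := by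
  have hlen : (cons l c nil).labels.length = 1 + c.size := by rw [length_labels]; simp [size]
  refine .seq <| .assign <| .seq <| .add' (1 + c.size) (by simp [h1, hreg]) <| .seq <|
    (wp_prepLoop (L := (cons l c nil).labels) (o := 0) (j := 0) (by simp) (by simp [hreg])
      (by simp [hlen]) (by simp [hreg]) (by exact ht) (by exact hmk) (by exact fun i _ => h3 i)).mono ?_
  rintro t₁ m₁ ⟨ht₁, ef, eo, er, ea⟩
  refine .seq <| .add' (1 + c.size) (by simp [ef, h1, hreg]) <| .seq <|
    (I.wp_nodeLoop hK hf (L := (cons l c nil).labels) (o := 0) (by simp [ef, h0]) (by simp [ef])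
      (by simp [ef, h1]) (by simp [ef, hreg]) (by simp [hlen]) (by exact er)
      (by exact er)).mono ?_
  rintro t₂ m₂ ⟨ht₂, fo⟩
  refine .skip ⟨?_, by simp [fo, eo, hout]⟩
  rw [hlen] at ht₁ ht₂
  omega

end Impl

/-! ### The functions at the nodes -/

/-- The possible properties of an expression: entries `(S, c, y)`, for a list `S` of numbers of
constants, a constant `c` and a property `y < 4`. -/
abbrev Tab := List (List ℕ × ℕ × ℕ)

namespace Tab

/-- All sublists of `0, …, n - 1`. -/
def subs : ℕ → List (List ℕ)
  | 0 => [[]]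
  | n + 1 => subs n ++ (subs n).map (· ++ [n])

/-- All entries for `n` symbols. -/
def all (n : ℕ) : Tab :=
  (subs n).flatMap fun S => (List.range n).flatMap fun c => (List.range 4).map fun y => (S, c, y)

/-- The table with the entries `(S, c, y)` such that `P (S, c, y)`. -/
def mk (n : ℕ) (P : List ℕ × ℕ × ℕ → Bool) : Tab := (all n).filter P

/-- The entry `(S, c, y)` is in the table. -/
def has (t : Tab) (S : List ℕ) (c y : ℕ) : Bool := decide ((S, c, y) ∈ t)

/-- Put `d` into `S` or remove it. -/
def updL (n : ℕ) (S : List ℕ) (d : ℕ) (b : Bool) : List ℕ :=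
  (List.range n).filter fun c => (c == d && b) || (!(c == d) && decide (c ∈ S))

/-- The leaf constraint for the left factor of a product with second factor `x`. -/
def leftL (n : ℕ) (x : Tab) (S : List ℕ) (d : ℕ) : List ℕ := updL n S d (has x S d 3)

/-- Some tree of the closure has its leaves in `S`. -/
def starNE (x : Tab) (S : List ℕ) (d : ℕ) : Bool := decide (d ∈ S) || has x S d 3

/-- The leaf constraint for the argument of a closure. -/
def starL (n : ℕ) (x : Tab) (S : List ℕ) (d : ℕ) : List ℕ := updL n S d (starNE x S d)

/-- The entries for a product. -/
def dotHas (n d : ℕ) (x₁ x₂ : Tab) (S : List ℕ) (c y : ℕ) : Bool :=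
  ((!(c == d) || y == 3) && has x₁ (leftL n x₂ S d) c y) ||
  (y == 0 && (has x₁ (leftL n x₂ S d) d 0 && has x₂ S c 0)) ||
  (y == 1 && ((has x₁ (leftL n x₂ S d) d 1 && has x₂ S c 0) ||
    (has x₁ (leftL n x₂ S d) d 2 && has x₂ S c 1))) ||
  (y == 2 && (has x₁ (leftL n x₂ S d) d 2 && has x₂ S c 2))

/-- The entries for a closure. -/
def starHas (n d : ℕ) (x : Tab) (S : List ℕ) (c y : ℕ) : Bool :=
  (y == 3 && starNE x S d) ||
  ((y == 0 || y == 2) && (c == d && decide (d ∈ S))) ||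
  (!(y == 3) && (!(c == d) && has x (starL n x S d) c y)) ||
  (y == 1 && (has x (starL n x S d) d 1 &&
    ((c == d && decide (d ∈ S)) || (!(c == d) && has x (starL n x S d) c 0))))

/-- The entries for a constant. -/
def leafHas (d : ℕ) (S : List ℕ) (c y : ℕ) : Bool :=
  decide (d ∈ S) && (y == 3 || (!(y == 1) && c == d))

/-- The first table of a list. -/
def fst (acc : List Tab) : Tab := acc.getD 0 []

/-- The second table of a list. -/
def snd (acc : List Tab) : Tab := acc.getD 1 []

/-- The entries for the arguments of a symbol that have been combined so far. -/
def accHas (acc : List Tab) (S : List ℕ) (c y : ℕ) : Bool :=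
  (acc.isEmpty && y == 3) || (!acc.isEmpty && has (fst acc) S c y)

/-- The entries for the arguments of a symbol, with one more argument. -/
def mergeHas (acc : List Tab) (x : Tab) (b : ℕ) (S : List ℕ) (c y : ℕ) : Bool :=
  accHas acc S c 3 && (has x S c 3 && (y == 3 ||
    (y == 1 && (accHas acc S c 1 || (has x S c 1 || (b == 1 && has x S c 0)))) ||
    (y == 2 && (accHas acc S c 2 || has x S c 2))))

/-- The entries for an expression. -/
def finHas (n kind d : ℕ) (acc : List Tab) (S : List ℕ) (c y : ℕ) : Bool :=
  (kind == 1 && (has (fst acc) S c y || has (snd acc) S c y)) ||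
  (kind == 2 && dotHas n d (fst acc) (snd acc) S c y) ||
  (kind == 3 && starHas n d (fst acc) S c y) ||
  (kind == 4 && ((acc.isEmpty && leafHas d S c y) || (!acc.isEmpty && has (fst acc) S c y)))

/-- The table of an expression. -/
def fin (n kind d : ℕ) (acc : List Tab) : Tab :=
  mk n fun e => finHas n kind d acc e.1 e.2.1 e.2.2

/-- The accumulator with one more child. -/
def step (n kind : ℕ) (acc : List Tab) (x : Tab) (b : ℕ) : List Tab :=
  bif kind == 4 then [mk n fun e => mergeHas acc x b e.1 e.2.1 e.2.2] else (acc ++ [x]).take 2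

/-- The context of an expression: the constants that may be leaves of its trees, whether these trees
occur, and whether they occur at the target. -/
abbrev Ctx := List ℕ × Bool × Bool

/-- The context of a child. -/
def down (n kind d : ℕ) (y : Ctx) (acc : List Tab) (first b : ℕ) : Ctx :=
  bif kind == 4 then (y.1, y.2.1 && has (fst acc) y.1 d 3,
    b == 1 && (y.2.1 && has (fst acc) y.1 d 3))
  else bif kind == 3 then (starL n (fst acc) y.1 d, y.2.1,
    y.2.2 || (y.2.1 && has (fst acc) (starL n (fst acc) y.1 d) d 1))
  else bif kind == 2 then
    bif first == 1 then (leftL n (snd acc) y.1 d, y.2.1, y.2.2)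
    else (y.1, y.2.1 && has (fst acc) (leftL n (snd acc) y.1 d) d 2,
      (y.2.1 && has (fst acc) (leftL n (snd acc) y.1 d) d 1) ||
      (y.2.2 && has (fst acc) (leftL n (snd acc) y.1 d) d 0))
  else y

/-- A node is to be listed. -/
def emit (d : ℕ) (y : Ctx) (x : Tab) : Bool := y.2.2 && has x y.1 d 3

/-- A constant is to be listed. -/
def const (n : ℕ) (x : Tab) (c : ℕ) : Bool := has x (List.range n) c 1

/-- The context of the whole expression. -/
def root (n : ℕ) : Ctx := (List.range n, true, false)

/-! ### The node functions are primitive recursive -/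

section Primrec

variable {α : Type*} [Primcodable α]

theorem primrec_and {f g : α → Bool} (hf : Primrec f) (hg : Primrec g) :
    Primrec fun a => f a && g a := Primrec.and.comp hf hg

theorem primrec_or {f g : α → Bool} (hf : Primrec f) (hg : Primrec g) :
    Primrec fun a => f a || g a := Primrec.or.comp hf hg

theorem primrec_not {f : α → Bool} (hf : Primrec f) : Primrec fun a => !f a := Primrec.not.comp hf

theorem primrec_beq {f g : α → ℕ} (hf : Primrec f) (hg : Primrec g) :
    Primrec fun a => f a == g a := Primrec.beq.comp hf hg

theorem primrec_mem {β : Type*} [Primcodable β] [DecidableEq β] {f : α → β} {l : α → List β}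
    (hf : Primrec f) (hl : Primrec l) : Primrec fun a => decide (f a ∈ l a) := by
  have h : PrimrecRel fun (L : List β) (b : β) => ∃ a ∈ L, a = b := Primrec.eq.exists_mem_list
  have h' : PrimrecPred fun a => f a ∈ l a := (h.comp hl hf).of_eq fun a => by simp
  exact h'.decide

theorem primrec_filter {β : Type*} [Primcodable β] {l : α → List β} {p : α → β → Bool}
    (hl : Primrec l) (hp : Primrec₂ p) : Primrec fun a => (l a).filter (p a) := by
  refine (Primrec.list_flatMap (g := fun a b => bif p a b then [b] else []) hl
    (Primrec.cond hp (Primrec.list_cons.comp .snd (.const [])) (.const [])).to₂).of_eq fun a => ?_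
  induction l a with
  | nil => rfl
  | cons b L ih => cases h : p a b <;> simp [h, ih]

theorem primrec_has {t : α → Tab} {S : α → List ℕ} {c y : α → ℕ} (ht : Primrec t)
    (hS : Primrec S) (hc : Primrec c) (hy : Primrec y) :
    Primrec fun a => has (t a) (S a) (c a) (y a) :=
  (primrec_mem (hS.pair (hc.pair hy)) ht).of_eq fun a => by simp [has]

theorem primrec_subs : Primrec subs := by
  have h : Primrec₂ fun (n : ℕ) (l : List (List ℕ)) => l ++ l.map (· ++ [n]) :=
    (Primrec.list_append.comp .snd (Primrec.list_map .snd
      (Primrec.list_append.comp .snd (Primrec.list_cons.comp (Primrec.fst.comp .fst)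
        (.const []))).to₂)).to₂
  refine (Primrec.nat_rec₁ [[]] h).of_eq fun n => ?_
  induction n with
  | zero => rfl
  | succ n ih => simp only [subs, ← ih]

theorem primrec_all : Primrec all := by
  refine Primrec.list_flatMap primrec_subs ?_
  refine Primrec.list_flatMap (Primrec.list_range.comp .fst) ?_
  refine Primrec.list_map (.const _) ?_
  exact (Primrec.pair (Primrec.snd.comp (Primrec.fst.comp .fst))
    (Primrec.pair (Primrec.snd.comp .fst) .snd)).to₂

theorem primrec_mk {n : α → ℕ} {P : α → List ℕ × ℕ × ℕ → Bool} (hn : Primrec n)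
    (hP : Primrec₂ P) : Primrec fun a => mk (n a) (P a) :=
  primrec_filter (primrec_all.comp hn) hP

theorem primrec_updL {n d : α → ℕ} {S : α → List ℕ} {b : α → Bool} (hn : Primrec n)
    (hS : Primrec S) (hd : Primrec d) (hb : Primrec b) :
    Primrec fun a => updL (n a) (S a) (d a) (b a) := by
  have hd' : Primrec fun p : α × ℕ => d p.1 := hd.comp .fst
  have h : Primrec fun p : α × ℕ =>
      (p.2 == d p.1 && b p.1) || (!(p.2 == d p.1) && decide (p.2 ∈ S p.1)) :=
    primrec_or (primrec_and (primrec_beq .snd hd') (hb.comp .fst))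
      (primrec_and (primrec_not (primrec_beq .snd hd')) (primrec_mem .snd (hS.comp .fst)))
  exact primrec_filter (Primrec.list_range.comp hn) h.to₂

theorem primrec_leftL {n d : α → ℕ} {S : α → List ℕ} {x : α → Tab} (hn : Primrec n)
    (hx : Primrec x) (hS : Primrec S) (hd : Primrec d) :
    Primrec fun a => leftL (n a) (x a) (S a) (d a) :=
  primrec_updL hn hS hd (primrec_has hx hS hd (.const 3))

theorem primrec_starNE {d : α → ℕ} {S : α → List ℕ} {x : α → Tab}
    (hx : Primrec x) (hS : Primrec S) (hd : Primrec d) :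
    Primrec fun a => starNE (x a) (S a) (d a) :=
  primrec_or (primrec_mem hd hS) (primrec_has hx hS hd (.const 3))

theorem primrec_starL {n d : α → ℕ} {S : α → List ℕ} {x : α → Tab} (hn : Primrec n)
    (hx : Primrec x) (hS : Primrec S) (hd : Primrec d) :
    Primrec fun a => starL (n a) (x a) (S a) (d a) :=
  primrec_updL hn hS hd (primrec_starNE hx hS hd)

theorem primrec_fst {acc : α → List Tab} (h : Primrec acc) : Primrec fun a => fst (acc a) :=
  (Primrec.list_getD []).comp h (.const 0)

theorem primrec_snd {acc : α → List Tab} (h : Primrec acc) : Primrec fun a => snd (acc a) :=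
  (Primrec.list_getD []).comp h (.const 1)

theorem primrec_isEmpty {β : Type*} [Primcodable β] {l : α → List β} (h : Primrec l) :
    Primrec fun a => (l a).isEmpty :=
  (primrec_beq (Primrec.list_length.comp h) (.const 0)).of_eq fun a => by cases l a <;> simp

theorem primrec_finHas {n kind d c y : α → ℕ} {acc : α → List Tab} {S : α → List ℕ}
    (hn : Primrec n) (hk : Primrec kind) (hd : Primrec d) (ha : Primrec acc) (hS : Primrec S)
    (hc : Primrec c) (hy : Primrec y) :
    Primrec fun a => finHas (n a) (kind a) (d a) (acc a) (S a) (c a) (y a) := by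
  have h1 := primrec_fst ha
  have h2 := primrec_snd ha
  have hl := primrec_leftL hn h2 hS hd
  have hs := primrec_starL hn h1 hS hd
  have hN := primrec_starNE h1 hS hd
  have hm := primrec_mem hd hS
  have he := primrec_isEmpty ha
  unfold finHas dotHas starHas leafHas
  repeat' first
    | assumption
    | apply primrec_or
    | apply primrec_and
    | apply primrec_not
    | apply primrec_beq
    | apply primrec_has
    | exact Primrec.const _

theorem primrec_mergeHas {b c y : α → ℕ} {acc : α → List Tab} {x : α → Tab} {S : α → List ℕ}
    (ha : Primrec acc) (hx : Primrec x) (hb : Primrec b) (hS : Primrec S)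
    (hc : Primrec c) (hy : Primrec y) :
    Primrec fun a => mergeHas (acc a) (x a) (b a) (S a) (c a) (y a) := by
  have h1 := primrec_fst ha
  have he := primrec_isEmpty ha
  unfold mergeHas accHas
  repeat' first
    | assumption
    | apply primrec_or
    | apply primrec_and
    | apply primrec_not
    | apply primrec_beq
    | apply primrec_has
    | exact Primrec.const _

theorem primrec_fin {n kind d : α → ℕ} {acc : α → List Tab}
    (hn : Primrec n) (hk : Primrec kind) (hd : Primrec d) (ha : Primrec acc) :
    Primrec fun a => fin (n a) (kind a) (d a) (acc a) :=
  primrec_mk hn (primrec_finHas (hn.comp .fst) (hk.comp .fst) (hd.comp .fst) (ha.comp .fst)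
    (Primrec.fst.comp .snd) (Primrec.fst.comp (Primrec.snd.comp .snd))
    (Primrec.snd.comp (Primrec.snd.comp .snd))).to₂

theorem primrec_step {n kind b : α → ℕ} {acc : α → List Tab} {x : α → Tab}
    (hn : Primrec n) (hk : Primrec kind) (ha : Primrec acc) (hx : Primrec x) (hb : Primrec b) :
    Primrec fun a => step (n a) (kind a) (acc a) (x a) (b a) := by
  refine Primrec.cond (primrec_beq hk (.const 4)) (Primrec.list_cons.comp (primrec_mk hn ?_)
    (.const [])) (Primrec.list_take.comp (.const 2) (Primrec.list_append.comp ha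
      (Primrec.list_cons.comp hx (.const []))))
  exact (primrec_mergeHas (ha.comp .fst) (hx.comp .fst) (hb.comp .fst) (Primrec.fst.comp .snd)
    (Primrec.fst.comp (Primrec.snd.comp .snd)) (Primrec.snd.comp (Primrec.snd.comp .snd))).to₂

theorem primrec_down {n kind d first b : α → ℕ} {y : α → Ctx} {acc : α → List Tab}
    (hn : Primrec n) (hk : Primrec kind) (hd : Primrec d) (hy : Primrec y) (ha : Primrec acc)
    (hf : Primrec first) (hb : Primrec b) :
    Primrec fun a => down (n a) (kind a) (d a) (y a) (acc a) (first a) (b a) := by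
  have h1 := primrec_fst ha
  have h2 := primrec_snd ha
  have hS : Primrec fun a => (y a).1 := Primrec.fst.comp hy
  have hA : Primrec fun a => (y a).2.1 := Primrec.fst.comp (Primrec.snd.comp hy)
  have hW : Primrec fun a => (y a).2.2 := Primrec.snd.comp (Primrec.snd.comp hy)
  have hl := primrec_leftL hn h2 hS hd
  have hs := primrec_starL hn h1 hS hd
  unfold down
  repeat' first
    | assumption
    | apply Primrec.cond
    | apply Primrec.pair
    | apply primrec_or
    | apply primrec_and
    | apply primrec_not
    | apply primrec_beq
    | apply primrec_has
    | exact Primrec.const _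

theorem primrec_emit {d : α → ℕ} {y : α → Ctx} {x : α → Tab} (hd : Primrec d) (hy : Primrec y)
    (hx : Primrec x) : Primrec fun a => emit (d a) (y a) (x a) :=
  primrec_and (Primrec.snd.comp (Primrec.snd.comp hy))
    (primrec_has hx (Primrec.fst.comp hy) hd (.const 3))

theorem primrec_const {n c : α → ℕ} {x : α → Tab} (hn : Primrec n) (hx : Primrec x)
    (hc : Primrec c) : Primrec fun a => const (n a) (x a) (c a) :=
  primrec_has hx (Primrec.list_range.comp hn) hc (.const 1)

theorem primrec_root {n : α → ℕ} (hn : Primrec n) : Primrec fun a => root (n a) :=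
  (Primrec.list_range.comp hn).pair (.const _)

end Primrec

end Tab

/-! ### For a fixed alphabet, the data at the nodes range over finite sets -/

namespace Tab

/-- Tables are searched by equality of lists, so a set must always appear as the same list. The
canonical form is the increasing list, a filter of `List.range n`, and it is the form that `updL`
returns. -/
theorem filter_mem_subs (n : ℕ) (P : ℕ → Bool) : (List.range n).filter P ∈ subs n := by
  induction n with
  | zero => simp [subs]
  | succ n ih =>
    rw [List.range_succ, List.filter_append, subs, List.mem_append]
    cases h : P n
    · exact .inl (by simpa [h] using ih)
    · exact .inr (List.mem_map.2 ⟨_, ih, by simp [h]⟩)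

theorem updL_mem_subs (n : ℕ) (S : List ℕ) (d : ℕ) (b : Bool) : updL n S d b ∈ subs n :=
  filter_mem_subs ..

theorem range_mem_subs (n : ℕ) : List.range n ∈ subs n := by
  simpa using filter_mem_subs n fun _ => true

theorem has_mk {n : ℕ} {P : List ℕ × ℕ × ℕ → Bool} {S : List ℕ} {c y : ℕ} :
    has (mk n P) S c y = true ↔ (S ∈ subs n ∧ c < n ∧ y < 4) ∧ P (S, c, y) = true := by
  simp [has, mk, all]

/-- The values for `n` symbols. -/
def values (n : ℕ) : Set Tab := {t | t ∈ (all n).sublists}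

/-- The accumulators for `n` symbols. -/
def accs (n : ℕ) : Set (List Tab) :=
  insert [] ((fun t => [t]) '' values n) ∪ Set.image2 (fun s t => [s, t]) (values n) (values n)

/-- The contexts for `n` symbols. -/
def ctxs (n : ℕ) : Set Ctx := {y | y.1 ∈ subs n}

theorem finite_values (n : ℕ) : (values n).Finite := List.finite_toSet _

theorem finite_accs (n : ℕ) : (accs n).Finite :=
  (((finite_values n).image _).insert _).union ((finite_values n).image2 _ (finite_values n))

theorem finite_ctxs (n : ℕ) : (ctxs n).Finite :=
  ((List.finite_toSet (subs n)).prod (Set.finite_univ (α := Bool × Bool))).subset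
    fun _ hy => ⟨hy, trivial⟩

theorem mk_mem_values (n : ℕ) (P : List ℕ × ℕ × ℕ → Bool) : mk n P ∈ values n :=
  List.mem_sublists.2 List.filter_sublist

/-- Truncation to two tables keeps the set of accumulators finite under arbitrary steps, including
more children than a node of that kind has. -/
theorem step_mem_accs {n kind b : ℕ} {acc : List Tab} {x : Tab} (ha : acc ∈ accs n)
    (hx : x ∈ values n) : step n kind acc x b ∈ accs n := by
  unfold step
  cases kind == 4
  · rcases ha with (rfl | ⟨t, ht, rfl⟩) | ⟨s, hs, t, ht, rfl⟩
    · exact .inl (.inr ⟨x, hx, rfl⟩)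
    · exact .inr ⟨t, ht, x, hx, rfl⟩
    · exact .inr ⟨s, hs, t, ht, rfl⟩
  · exact .inl (.inr ⟨_, mk_mem_values .., rfl⟩)

theorem down_mem_ctxs {n kind d first b : ℕ} {y : Ctx} {acc : List Tab} (hy : y ∈ ctxs n) :
    down n kind d y acc first b ∈ ctxs n := by
  unfold down
  cases kind == 4 <;> cases kind == 3 <;> cases kind == 2 <;> cases first == 1 <;>
    first | exact hy | exact updL_mem_subs ..

/-- The object with a given code. -/
def dec (α : Type) [Primcodable α] [Inhabited α] (i : ℕ) : α := (Encodable.decode i).getD default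

@[simp] theorem dec_encode {α : Type} [Primcodable α] [Inhabited α] (a : α) :
    dec α (Encodable.encode a) = a := by simp [dec]

theorem primrec_dec {α : Type} [Primcodable α] [Inhabited α] {β : Type*} [Primcodable β]
    {f : β → ℕ} (hf : Primrec f) : Primrec fun b => dec α (f b) :=
  Primrec.option_getD.comp (Primrec.decode.comp hf) (.const _)

theorem primrec_arg {k : ℕ} (i : Fin k) : Primrec fun v : Fin k → ℕ => v i :=
  Primrec.fin_app.comp .id (.const i)

/-- The functions at the nodes, on codes of tables and contexts. -/
def kernel : Kernel where
  step v := Encodable.encode (step (v 0) (v 1) (dec (List Tab) (v 2)) (dec Tab (v 3)) (v 4))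
  fin v := Encodable.encode (fin (v 0) (v 1) (v 2) (dec (List Tab) (v 3)))
  down v := Encodable.encode
    (down (v 0) (v 1) (v 2) (dec Ctx (v 3)) (dec (List Tab) (v 4)) (v 5) (v 6))
  emit v := Encodable.encode (emit (v 1) (dec Ctx (v 2)) (dec Tab (v 3)))
  const v := Encodable.encode (const (v 0) (dec Tab (v 1)) (v 2))
  root v := Encodable.encode (root (v 0))

theorem nonempty_impl : Nonempty (Impl kernel) := by
  have hs : Primrec kernel.step := Primrec.encode.comp (primrec_step (primrec_arg 0)
    (primrec_arg 1) (primrec_dec (primrec_arg 2)) (primrec_dec (primrec_arg 3)) (primrec_arg 4))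
  have hf : Primrec kernel.fin := Primrec.encode.comp (primrec_fin (primrec_arg 0)
    (primrec_arg 1) (primrec_arg 2) (primrec_dec (primrec_arg 3)))
  have hd : Primrec kernel.down := Primrec.encode.comp (primrec_down (primrec_arg 0)
    (primrec_arg 1) (primrec_arg 2) (primrec_dec (primrec_arg 3)) (primrec_dec (primrec_arg 4))
    (primrec_arg 5) (primrec_arg 6))
  have he : Primrec kernel.emit := Primrec.encode.comp (primrec_emit (primrec_arg 1)
    (primrec_dec (primrec_arg 2)) (primrec_dec (primrec_arg 3)))
  have hc : Primrec kernel.const := Primrec.encode.comp (primrec_const (primrec_arg 0)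
    (primrec_dec (primrec_arg 1)) (primrec_arg 2))
  have hr : Primrec kernel.root := Primrec.encode.comp (primrec_root (primrec_arg 0))
  obtain ⟨p₁, τ₁, h₁⟩ := exists_computes hs ![0, 12, 18, 19, 20] 30 (by decide) 18 (by decide)
  obtain ⟨p₂, τ₂, h₂⟩ := exists_computes hf ![0, 12, 13, 18] 30 (by decide) 19 (by decide)
  obtain ⟨p₃, τ₃, h₃⟩ :=
    exists_computes hd ![0, 12, 13, 22, 18, 23, 20] 30 (by decide) 19 (by decide)
  obtain ⟨p₄, τ₄, h₄⟩ := exists_computes he ![0, 13, 22, 19] 30 (by decide) 24 (by decide)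
  obtain ⟨p₅, τ₅, h₅⟩ := exists_computes hc ![0, 19, 10] 30 (by decide) 24 (by decide)
  obtain ⟨p₆, τ₆, h₆⟩ := exists_computes hr ![0] 30 (by decide) 22 (by decide)
  exact ⟨⟨p₁, p₂, p₃, p₄, p₅, p₆, fun B => τ₁ B + τ₂ B + τ₃ B + τ₄ B + τ₅ B + τ₆ B,
    h₁.mono fun B => by omega, h₂.mono fun B => by omega, h₃.mono fun B => by omega,
    h₄.mono fun B => by omega, h₅.mono fun B => by omega, h₆.mono fun B => by omega⟩⟩

/-- Finitely many tables, accumulators and contexts have bounded codes. This is the point where the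
cost per node becomes a function of `n` alone. -/
theorem exists_closed (n : ℕ) : ∃ B, kernel.Closed n B (Encodable.encode '' accs n)
    (Encodable.encode '' values n) (Encodable.encode '' ctxs n) := by
  obtain ⟨B₁, h₁⟩ := ((finite_accs n).image Encodable.encode).bddAbove
  obtain ⟨B₂, h₂⟩ := ((finite_values n).image Encodable.encode).bddAbove
  obtain ⟨B₃, h₃⟩ := ((finite_ctxs n).image Encodable.encode).bddAbove
  refine ⟨n + 5 + B₁ + B₂ + B₃, by omega, by omega, fun a ha => (h₁ ha).trans (by omega),
    fun a ha => (h₂ ha).trans (by omega), fun a ha => (h₃ ha).trans (by omega),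
    ⟨[], .inl (.inl rfl), by simp⟩, ?_, ?_, ?_, ⟨_, range_mem_subs n, rfl⟩⟩
  · rintro c - _ ⟨a, ha, rfl⟩ _ ⟨x, hx, rfl⟩ b -
    exact ⟨_, step_mem_accs (kind := c) (b := b) ha hx, by simp [kernel]⟩
  · rintro c - s - _ ⟨a, ha, rfl⟩
    exact ⟨_, mk_mem_values n _, by simp only [kernel]; simp; rfl⟩
  · rintro c - s - _ ⟨y, hy, rfl⟩ _ ⟨a, ha, rfl⟩ b - b' -
    exact ⟨_, down_mem_ctxs (kind := c) (d := s) (acc := a) (first := b) (b := b') hy,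
      by simp [kernel]⟩

end Tab

/-! ### Syntax trees as forests -/

theorem Fin.sum_Iio_succ {m : ℕ} (w : Fin (m + 1) → ℕ) (i : Fin m) :
    ∑ l ∈ Finset.Iio i.succ, w l = w 0 + ∑ l ∈ Finset.Iio i, w l.succ := by
  have h : Finset.Iio i.succ = insert 0 ((Finset.Iio i).map (Fin.succEmb m)) := by
    ext l
    refine Fin.cases ?_ (fun l => ?_) l <;> simp
  rw [h, Finset.sum_insert (by simp), Finset.sum_map]
  rfl

namespace Forest

/-- The forest of the given trees. -/
def ofList (ts : List (Lab × Forest)) : Forest := ts.foldr (fun p f => cons p.1 p.2 f) nil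

@[simp] theorem ofList_nil : ofList [] = nil := rfl

@[simp] theorem ofList_cons (p : Lab × Forest) (ts : List (Lab × Forest)) :
    ofList (p :: ts) = cons p.1 p.2 (ofList ts) := rfl

theorem len_ofList (ts : List (Lab × Forest)) : (ofList ts).len = ts.length := by
  induction ts with
  | nil => rfl
  | cons p ts ih => simp [len, ih]; omega

theorem labels_ofList (ts : List (Lab × Forest)) :
    (ofList ts).labels = (ts.map fun p => (cons p.1 p.2 nil).labels).flatten := by
  induction ts with
  | nil => rfl
  | cons p ts ih => simp [labels, ih]

theorem valid_ofList {n : ℕ} {ts : List (Lab × Forest)} (h : ∀ p ∈ ts, (cons p.1 p.2 nil).Valid n) :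
    (ofList ts).Valid n := by
  induction ts with
  | nil => trivial
  | cons p ts ih =>
    have h' := h p (by simp)
    exact ⟨h'.1, h'.2.1, ih fun q hq => h q (by simp [hq])⟩

end Forest

namespace RegExp

variable {σ : Type*} {r : σ → ℕ}

/-- The root label and the children of the syntax tree of an expression over the marked alphabet. -/
def tree (num : σ → ℕ) : RegExp (markedRank r) → Lab × Forest
  | zero => (⟨0, 0, 0⟩, .nil)
  | sym f args => (⟨4, num f.1, f.2⟩, .ofList (List.ofFn fun i => tree num (args i)))
  | plus E₁ E₂ => (⟨1, 0, 0⟩, .ofList [tree num E₁, tree num E₂])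
  | dot c _ E₁ E₂ => (⟨2, num c.1, 0⟩, .ofList [tree num E₁, tree num E₂])
  | star c _ E₁ => (⟨3, num c.1, 0⟩, .ofList [tree num E₁])

/-- The labels and the numbers of children of the nodes of the syntax tree, in prefix order. -/
def treeLabels (num : σ → ℕ) (E : RegExp (markedRank r)) : List (Lab × ℕ) :=
  (Forest.cons (tree num E).1 (tree num E).2 .nil).labels

section treeLabels

variable {num : σ → ℕ}

theorem treeLabels_zero : treeLabels num (zero : RegExp (markedRank r)) = [(⟨0, 0, 0⟩, 0)] := rfl

theorem treeLabels_sym {f : σ × ℕ} {args : Fin (markedRank r f) → RegExp (markedRank r)} :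
    treeLabels num (sym f args) =
      (⟨4, num f.1, f.2⟩, r f.1) :: (List.ofFn fun i => treeLabels num (args i)).flatten := by
  simp [treeLabels, tree, Forest.labels, Forest.len_ofList, Forest.labels_ofList, List.map_ofFn]
  rfl

theorem treeLabels_plus {E₁ E₂ : RegExp (markedRank r)} :
    treeLabels num (plus E₁ E₂) =
      (⟨1, 0, 0⟩, 2) :: (treeLabels num E₁ ++ treeLabels num E₂) := by
  simp [treeLabels, tree, Forest.labels, Forest.len]

theorem treeLabels_dot {c : σ × ℕ} {hc} {E₁ E₂ : RegExp (markedRank r)} :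
    treeLabels num (dot c hc E₁ E₂) =
      (⟨2, num c.1, 0⟩, 2) :: (treeLabels num E₁ ++ treeLabels num E₂) := by
  simp [treeLabels, tree, Forest.labels, Forest.len]

theorem treeLabels_star {c : σ × ℕ} {hc} {E₁ : RegExp (markedRank r)} :
    treeLabels num (star c hc E₁) = (⟨3, num c.1, 0⟩, 1) :: treeLabels num E₁ := by
  simp [treeLabels, tree, Forest.labels, Forest.len]

theorem length_tokens (E : RegExp r) : (E.tokens num).length = E.size := by
  induction E with
  | zero => rfl
  | sym f args ih =>
    simp [tokens, size, List.length_flatten, List.map_ofFn, Function.comp_def, ih, List.sum_ofFn]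
    omega
  | plus E₁ E₂ h₁ h₂ => simp [tokens, size, h₁, h₂]; omega
  | dot c hc E₁ E₂ h₁ h₂ => simp [tokens, size, h₁, h₂]; omega
  | star c hc E₁ h₁ => simp [tokens, size, h₁]; omega

theorem map_treeLabels (E : RegExp r) : ∀ j, (treeLabels num (E.markFrom j)).map
    (fun p => (p.1.kind, p.1.sym)) = E.tokens num := by
  induction E with
  | zero => exact fun j => rfl
  | sym f args ih =>
    intro j
    simp only [markFrom, treeLabels_sym, List.map_cons, List.map_flatten, List.map_ofFn, tokens]
    congr 2
    exact congrArg List.ofFn (funext fun i => ih i _)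
  | plus E₁ E₂ h₁ h₂ => intro j; simp [markFrom, treeLabels_plus, tokens, h₁, h₂]
  | dot c hc E₁ E₂ h₁ h₂ => intro j; simp [markFrom, treeLabels_dot, tokens, h₁, h₂]
  | star c hc E₁ h₁ => intro j; simp [markFrom, treeLabels_star, tokens, h₁]

/-- The list `L` stands for the rest of the input, so blocks can be prefixed one after the other.
`Marked` is indexed by the last mark used and `T i` by the first mark it will use, hence the shift
by one. -/
theorem marked_flatten {rk : ℕ → ℕ} {m : ℕ} : ∀ {T : Fin m → ℕ → List (Lab × ℕ)} {w : Fin m → ℕ},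
    (∀ i j L, Marked rk (j + w i) L → Marked rk j (T i (j + 1) ++ L)) → ∀ j L,
    Marked rk (j + ∑ i, w i) L →
    Marked rk j ((List.ofFn fun i => T i (j + 1 + ∑ l ∈ Finset.Iio i, w l)).flatten ++ L) := by
  induction m with
  | zero => intro T w _ j L h; simpa using h
  | succ m ih =>
    intro T w hT j L h
    rw [Fin.sum_univ_succ] at h
    simp only [List.ofFn_succ, List.flatten_cons, List.append_assoc, Fin.sum_Iio_succ]
    have e : Finset.Iio (0 : Fin (m + 1)) = ∅ := by ext; simp
    rw [e, Finset.sum_empty]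
    refine hT 0 j _ ?_
    have := ih (T := fun i => T i.succ) (w := fun i => w i.succ) (fun i => hT i.succ) (j + w 0) L
      (by rwa [Nat.add_assoc])
    convert this using 6
    omega

theorem marked_treeLabels {rk : ℕ → ℕ} (hrk : ∀ s, rk (num s) = r s) (E : RegExp r) : ∀ j L,
    Marked rk (j + E.width) L → Marked rk j (treeLabels num (E.markFrom (j + 1)) ++ L) := by
  induction E with
  | zero =>
    intro j L h
    simpa [markFrom, treeLabels_zero, Marked, arityOf, width] using h
  | sym f args ih =>
    intro j L h
    simp only [markFrom, treeLabels_sym, List.cons_append, Marked]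
    refine ⟨by simp [arityOf, hrk], by simp, ?_⟩
    rcases Nat.eq_zero_or_pos (r f) with h0 | h0
    · have h0' : markedRank r (f, if r f = 0 then 0 else j + 1) = 0 := h0
      rw [List.ofFn_eq_nil_iff.2 h0']
      have : IsEmpty (Fin (r f)) := by rw [h0]; infer_instance
      simpa [h0, width] using h
    · simp only [h0.ne', ne_eq, not_false_eq_true, and_true, if_true, if_false]
      refine ⟨trivial, marked_flatten (w := fun i => (args i).width)
        (T := fun i j => treeLabels num ((args i).markFrom j)) (fun i => ih i) (j + 1) L ?_⟩
      simp only [width, h0.ne', if_false] at h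
      convert h using 1
      omega
  | plus E₁ E₂ h₁ h₂ =>
    intro j L h
    simp only [markFrom, treeLabels_plus, List.cons_append, List.append_assoc, Marked]
    refine ⟨by simp [arityOf], by simp, ?_⟩
    simp only [width] at h
    have := h₁ j _ (h₂ (j + E₁.width) L (by rwa [Nat.add_assoc]))
    simpa [Nat.add_right_comm] using this
  | dot c hc E₁ E₂ h₁ h₂ =>
    intro j L h
    simp only [markFrom, treeLabels_dot, List.cons_append, List.append_assoc, Marked]
    refine ⟨by simp [arityOf], by simp, ?_⟩
    simp only [width] at h
    have := h₁ j _ (h₂ (j + E₁.width) L (by rwa [Nat.add_assoc]))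
    simpa [Nat.add_right_comm] using this
  | star c hc E₁ h₁ =>
    intro j L h
    simp only [markFrom, treeLabels_star, List.cons_append, Marked]
    refine ⟨by simp [arityOf], by simp, ?_⟩
    simpa using h₁ j L h

end treeLabels

/-! ### Marks of positions and the number of targets -/

/-- The constants are unmarked, and the other symbols are marked. -/
def WellMarked : RegExp (markedRank r) → Prop
  | zero => True
  | sym f args => (r f.1 = 0 ↔ f.2 = 0) ∧ ∀ i, WellMarked (args i)
  | plus E₁ E₂ => WellMarked E₁ ∧ WellMarked E₂
  | dot c _ E₁ E₂ => c.2 = 0 ∧ WellMarked E₁ ∧ WellMarked E₂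
  | star c _ E₁ => c.2 = 0 ∧ WellMarked E₁

/-- The mark 0 means unmarked, so numbering must start at 1 or later. -/
theorem wellMarked_markFrom (E : RegExp r) : ∀ j, 1 ≤ j → (E.markFrom j).WellMarked := by
  induction E with
  | zero => exact fun _ _ => trivial
  | sym f args ih =>
    intro j hj
    refine ⟨?_, fun i => ih i _ (by omega)⟩
    by_cases h : r f = 0 <;> simp [h]
    omega
  | plus E₁ E₂ h₁ h₂ => exact fun j hj => ⟨h₁ _ hj, h₂ _ (by omega)⟩
  | dot c hc E₁ E₂ h₁ h₂ => exact fun j hj => ⟨rfl, h₁ _ hj, h₂ _ (by omega)⟩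
  | star c hc E₁ h₁ => exact fun j hj => ⟨rfl, h₁ _ hj⟩

theorem flatten_range' {m : ℕ} : ∀ (w : Fin m → ℕ) (j : ℕ),
    (List.ofFn fun i => List.range' (j + ∑ l ∈ Finset.Iio i, w l) (w i)).flatten =
      List.range' j (∑ i, w i) := by
  induction m with
  | zero => intro w j; simp
  | succ m ih =>
    intro w j
    have e : Finset.Iio (0 : Fin (m + 1)) = ∅ := by ext; simp
    simp only [List.ofFn_succ, List.flatten_cons, Fin.sum_Iio_succ, e, Finset.sum_empty,
      Fin.sum_univ_succ, ← Nat.add_assoc, ih, Nat.add_zero]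
    exact List.range'_append_1

/-- Consecutive marks make the positions distinct and nonzero, and they show that the number of
positions is the width. -/
theorem marks_occurrences (E : RegExp r) : ∀ j,
    (E.markFrom j).occurrences.map Prod.snd = List.range' j E.width := by
  induction E with
  | zero => exact fun j => rfl
  | sym f args ih =>
    intro j
    simp only [markFrom, occurrences, List.map_append, List.map_flatten, List.map_ofFn,
      Function.comp_def, ih, width]
    rcases Nat.eq_zero_or_pos (r f) with h0 | h0
    · have : IsEmpty (Fin (r f)) := by rw [h0]; infer_instance
      simp [h0]
    · simp only [h0.ne', if_false]
      have := flatten_range' (fun i => (args i).width) (j + 1)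
      erw [this]
      simp [List.range'_succ, Nat.add_comm 1]
  | plus E₁ E₂ h₁ h₂ => intro j; simp [markFrom, occurrences, h₁, h₂, width]
  | dot c hc E₁ E₂ h₁ h₂ => intro j; simp [markFrom, occurrences, h₁, h₂, width]
  | star c hc E₁ h₁ => intro j; simp [markFrom, occurrences, h₁, width]

theorem rank_le_of_mem_occurrences (E : RegExp r) : ∀ j, ∀ f ∈ (E.markFrom j).occurrences,
    r f.1 ≤ E.maxRank := by
  induction E with
  | zero => intro j f hf; simp [markFrom, occurrences] at hf
  | sym f args ih =>
    intro j g hg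
    simp only [markFrom, occurrences, List.mem_append, List.mem_flatten, List.mem_ofFn'] at hg
    rcases hg with hg | ⟨_, ⟨i, rfl⟩, hg⟩
    · by_cases h : r f = 0
      · simp [h] at hg
      · simp [h] at hg; subst hg; exact le_max_left _ _
    · exact (ih i _ g hg).trans ((Finset.le_sup (f := fun i => (args i).maxRank)
        (Finset.mem_univ i)).trans (le_max_right _ _))
  | plus E₁ E₂ h₁ h₂ =>
    intro j g hg
    rcases List.mem_append.1 hg with hg | hg
    · exact (h₁ _ g hg).trans (le_max_left _ _)
    · exact (h₂ _ g hg).trans (le_max_right _ _)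
  | dot c hc E₁ E₂ h₁ h₂ =>
    intro j g hg
    rcases List.mem_append.1 hg with hg | hg
    · exact (h₁ _ g hg).trans (le_max_left _ _)
    · exact (h₂ _ g hg).trans (le_max_right _ _)
  | star c hc E₁ h₁ => exact fun j g hg => h₁ _ g hg

theorem flatMap_flatten {α β : Type*} (G : α → List β) (L : List (List α)) :
    L.flatten.flatMap G = (L.map fun l => l.flatMap G).flatten := by
  induction L with
  | nil => rfl
  | cons l L ih => simp [ih]

/-- The label of the position `f`. -/
def posLab (num : σ → ℕ) (f : σ × ℕ) : Lab := ⟨4, num f.1, f.2⟩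

/-- The program visits all nodes, the specification only positions; the two traversals agree because
unmarked nodes contribute nothing and the marked nodes come in the order of the positions. -/
theorem flatMap_treeLabels {num : σ → ℕ} {β : Type*} (G : Lab × ℕ → List β)
    (hG : ∀ p, p.1.mark = 0 → G p = []) {E : RegExp (markedRank r)} (hE : E.WellMarked) :
    (treeLabels num E).flatMap G = E.occurrences.flatMap fun f => G (posLab num f, r f.1) := by
  induction E with
  | zero => simp [treeLabels_zero, occurrences, hG]
  | sym f args ih =>
    simp only [treeLabels_sym, occurrences, List.flatMap_cons, List.flatMap_append,
      flatMap_flatten, List.map_ofFn]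
    congr 1
    · by_cases h : r f.1 = 0
      · simp [h, hG, hE.1.1 h]
      · simp [h, posLab]
    · exact congrArg (fun L => (List.ofFn L).flatten) (funext fun i => ih i (hE.2 i))
  | plus E₁ E₂ h₁ h₂ =>
    simp [treeLabels_plus, occurrences, hG, h₁ hE.1, h₂ hE.2]
  | dot c hc E₁ E₂ h₁ h₂ =>
    simp [treeLabels_dot, occurrences, hG, h₁ hE.2.1, h₂ hE.2.2]
  | star c hc E₁ h₁ =>
    simp [treeLabels_star, occurrences, hG, h₁ hE.2]

/-- The number of targets is the sum of the ranks over the positions: `E.width` summands, each at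
most `E.maxRank`. -/
theorem targets_treeLabels_le {num : σ → ℕ} (E : RegExp r) :
    Impl.targets (treeLabels num E.linearize) ≤ E.maxRank * E.width := by
  have h : ∀ L, Impl.targets L =
      (L.flatMap fun p => if p.1.mark = 0 then [] else List.range p.2).length := by
    intro L
    induction L with
    | nil => rfl
    | cons p L ih => rw [Impl.targets, ih]; by_cases h : p.1.mark = 0 <;> simp [h]
  rw [h, linearize, flatMap_treeLabels _ (fun p hp => by simp [hp]) (E.wellMarked_markFrom 1 le_rfl)]
  have hw : E.width = (E.markFrom 1).occurrences.length := by
    have := congrArg List.length (E.marks_occurrences 1)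
    simpa using this.symm
  rw [List.length_flatMap, hw, mul_comm]
  refine (List.sum_le_card_nsmul _ E.maxRank ?_).trans (by simp)
  intro x hx
  obtain ⟨f, hf, rfl⟩ := List.mem_map.1 hx
  refine le_trans ?_ (E.rank_le_of_mem_occurrences 1 f hf)
  split <;> simp

theorem valid_tree {n : ℕ} {num : σ → ℕ} (hn : ∀ s, num s ≤ n) (E : RegExp (markedRank r)) :
    (Forest.cons (tree num E).1 (tree num E).2 .nil).Valid n := by
  induction E with
  | zero => exact ⟨by simp [tree], trivial, trivial⟩
  | sym f args ih =>
    refine ⟨by simp [tree, hn], Forest.valid_ofList fun p hp => ?_, trivial⟩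
    obtain ⟨i, rfl⟩ := (List.mem_ofFn' _ _).1 hp
    exact ih i
  | plus E₁ E₂ h₁ h₂ =>
    exact ⟨by simp [tree], Forest.valid_ofList (by simp [h₁, h₂]), trivial⟩
  | dot c hc E₁ E₂ h₁ h₂ =>
    exact ⟨by simp [tree, hn], Forest.valid_ofList (by simp [h₁, h₂]), trivial⟩
  | star c hc E₁ h₁ =>
    exact ⟨by simp [tree, hn], Forest.valid_ofList (by simp [h₁]), trivial⟩

end RegExp

/-! ### The passes compute the possible properties -/

namespace Forest

variable (n q k : ℕ)

/-- The typed version of `Forest.fold`. -/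
def accOf : Forest → Lab → ℕ → List Tab → List Tab
  | nil, _, _, a => a
  | cons l' c r, l, i, a => accOf r l (i + 1)
      (Tab.step n l.kind a (Tab.fin n l'.kind l'.sym (accOf c l' 0 [])) (flag q k l.mark i))

/-- The table of the tree with root label `p.1` and children `p.2`. -/
def tabOf (p : Lab × Forest) : Tab := Tab.fin n p.1.kind p.1.sym (accOf n q k p.2 p.1 0 [])

/-- The typed version of `Forest.childCtx`. -/
def ctxOf (l : Lab) (a : List Tab) (y : Tab.Ctx) (i : ℕ) : Tab.Ctx :=
  Tab.down n l.kind l.sym y a (1 - i) (flag q k l.mark i)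

/-- The typed version of `Forest.ownList`. -/
def ownOf (l : Lab) (y : Tab.Ctx) (x : Tab) : List Lab :=
  if l.mark ≠ 0 ∧ Tab.emit l.sym y x = true then [l] else []

/-- The typed version of `Forest.listed`. -/
def listOf : Forest → Lab → List Tab → Tab.Ctx → ℕ → List Lab
  | nil, _, _, _, _ => []
  | cons l' c r, l, a, y, i =>
      ownOf l' (ctxOf n q k l a y i) (tabOf n q k (l', c)) ++
      listOf c l' (accOf n q k c l' 0 []) (ctxOf n q k l a y i) 0 ++ listOf r l a y (i + 1)

/-- The labels that are to be listed in the tree with root label `p.1` and children `p.2`. -/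
def treeListOf (p : Lab × Forest) (y : Tab.Ctx) : List Lab :=
  ownOf p.1 y (tabOf n q k p) ++ listOf n q k p.2 p.1 (accOf n q k p.2 p.1 0 []) y 0

variable {n q k}

theorem fold_kernel (f : Forest) : ∀ (l : Lab) (i : ℕ) (a : List Tab),
    fold Tab.kernel n q k f l i (Encodable.encode a) = Encodable.encode (accOf n q k f l i a) := by
  induction f with
  | nil => exact fun _ _ _ => rfl
  | cons l' c r ihc ihr =>
    intro l i a
    have h := ihc l' 0 []
    rw [Encodable.encode_list_nil] at h
    rw [fold, accOf, h, ← ihr]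
    simp [Tab.kernel]

/-- The machine starts every accumulator at 0, which is the code of the empty list. -/
theorem fold_kernel_zero (f : Forest) (l : Lab) :
    fold Tab.kernel n q k f l 0 0 = Encodable.encode (accOf n q k f l 0 []) := by
  rw [← fold_kernel, Encodable.encode_list_nil]

theorem value_kernel (p : Lab × Forest) :
    value Tab.kernel n q k p.1 p.2 = Encodable.encode (tabOf n q k p) := by
  rw [value, fold_kernel_zero, tabOf]
  simp [Tab.kernel]

theorem childCtx_kernel (l : Lab) (a : List Tab) (y : Tab.Ctx) (i : ℕ) :
    childCtx Tab.kernel n q k l (Encodable.encode a) (Encodable.encode y) i =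
      Encodable.encode (ctxOf n q k l a y i) := by
  rw [childCtx, ctxOf]
  simp [Tab.kernel]

theorem encode_bool_ne_zero (b : Bool) : Encodable.encode b ≠ 0 ↔ b = true := by
  cases b <;> simp

theorem ownList_kernel (l : Lab) (y : Tab.Ctx) (x : Tab) :
    ownList Tab.kernel n l (Encodable.encode y) (Encodable.encode x) = ownOf l y x := by
  simp [ownList, ownOf, Tab.kernel, encode_bool_ne_zero]

theorem listed_kernel (f : Forest) : ∀ (l : Lab) (a : List Tab) (y : Tab.Ctx) (i : ℕ),
    listed Tab.kernel n q k f l (Encodable.encode a) (Encodable.encode y) i =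
      listOf n q k f l a y i := by
  induction f with
  | nil => exact fun _ _ _ _ => rfl
  | cons l' c r ihc ihr =>
    intro l a y i
    rw [listed, listOf, childCtx_kernel, value_kernel (l', c), ownList_kernel, fold_kernel_zero,
      ihc, ihr]

theorem treeListed_kernel (p : Lab × Forest) :
    treeListed Tab.kernel n q k p.1 p.2 = treeListOf n q k p (Tab.root n) := by
  have h : Tab.kernel.root ![n] = Encodable.encode (Tab.root n) := by simp [Tab.kernel]
  rw [treeListed, treeListOf, h, value_kernel, ownList_kernel, fold_kernel_zero, listed_kernel]

theorem constListed_kernel (p : Lab × Forest) :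
    constListed Tab.kernel n (value Tab.kernel n q k p.1 p.2) =
      (List.range n).filter fun c => Tab.const n (tabOf n q k p) c := by
  rw [constListed, value_kernel]
  refine List.filter_congr fun c _ => ?_
  simp [Tab.kernel, encode_bool_ne_zero]

/-- An induction principle for the accumulator: an invariant indexed by the child number is
preserved by every step, hence holds after the last child. -/
theorem accOf_ofList {l : Lab} {Inv : ℕ → List Tab → Prop} {ts : List (Lab × Forest)} :
    ∀ {i : ℕ} {a : List Tab}, Inv i a →
    (∀ j (hj : j < ts.length) a, Inv (i + j) a → Inv (i + j + 1)
      (Tab.step n l.kind a (tabOf n q k ts[j]) (flag q k l.mark (i + j)))) →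
    Inv (i + ts.length) (accOf n q k (ofList ts) l i a) := by
  induction ts with
  | nil => exact fun h _ => h
  | cons p ts ih =>
    intro i a h hs
    have := ih (hs 0 (by simp) a h) fun j hj a ha => by
      have := hs (j + 1) (by simpa using hj) a (by convert ha using 1; omega)
      simpa [Nat.add_assoc, Nat.add_comm 1] using this
    rw [List.length_cons, Nat.add_comm ts.length, ← Nat.add_assoc]
    exact this

theorem accOf_ofFn {l : Lab} {Inv : ℕ → List Tab → Prop} {m : ℕ} {T : Fin m → Lab × Forest}
    (h0 : Inv 0 []) (hs : ∀ (j : Fin m) a, Inv j a → Inv (j + 1)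
      (Tab.step n l.kind a (tabOf n q k (T j)) (flag q k l.mark j))) :
    Inv m (accOf n q k (ofList (List.ofFn T)) l 0 []) := by
  have := accOf_ofList (n := n) (q := q) (k := k) (l := l) (ts := List.ofFn T) h0
    fun j hj a ha => by
      have := hs ⟨j, by simpa using hj⟩ a (by simpa using ha)
      simpa using this
  simpa using this

theorem mem_listOf_ofList {l x : Lab} {a : List Tab} {y : Tab.Ctx} {ts : List (Lab × Forest)} :
    ∀ {i : ℕ}, x ∈ listOf n q k (ofList ts) l a y i ↔
    ∃ (j : ℕ) (hj : j < ts.length), x ∈ treeListOf n q k ts[j] (ctxOf n q k l a y (i + j)) := by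
  induction ts with
  | nil => simp [listOf]
  | cons p ts ih =>
    intro i
    rw [ofList_cons, listOf, List.mem_append, ih]
    constructor
    · rintro (h | ⟨j, hj, h⟩)
      · exact ⟨0, by simp, h⟩
      · exact ⟨j + 1, by simpa using hj, by
          simpa [Nat.add_assoc, Nat.add_comm 1] using h⟩
    · rintro ⟨j, hj, h⟩
      cases j with
      | zero => exact .inl h
      | succ j => exact .inr ⟨j, by simpa using hj, by
          simpa [Nat.add_assoc, Nat.add_comm 1] using h⟩

theorem mem_listOf_ofFn {l x : Lab} {a : List Tab} {y : Tab.Ctx} {m : ℕ}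
    {T : Fin m → Lab × Forest} : x ∈ listOf n q k (ofList (List.ofFn T)) l a y 0 ↔
    ∃ j : Fin m, x ∈ treeListOf n q k (T j) (ctxOf n q k l a y j) := by
  rw [mem_listOf_ofList]
  constructor
  · rintro ⟨j, hj, h⟩
    exact ⟨⟨j, by simpa using hj⟩, by simpa using h⟩
  · rintro ⟨j, h⟩
    exact ⟨j, by simp, by simpa using h⟩

/-- Each marked node is visited once and decides only about itself. The list is thus a sublist of
the marked labels in prefix order, which gives the absence of repetitions. -/
theorem listOf_sublist (f : Forest) : ∀ (l : Lab) (a : List Tab) (y : Tab.Ctx) (i : ℕ),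
    (listOf n q k f l a y i).Sublist
      (f.labels.flatMap fun p => if p.1.mark = 0 then [] else [p.1]) := by
  induction f with
  | nil => exact fun _ _ _ _ => .slnil
  | cons l' c r ihc ihr =>
    intro l a y i
    rw [listOf, labels, List.flatMap_cons, List.flatMap_append, List.append_assoc]
    refine .append ?_ (.append (ihc ..) (ihr ..))
    unfold ownOf
    by_cases h : l'.mark = 0
    · simp [h]
    · simp only [h, ne_eq, not_false_eq_true, true_and, if_false]
      split <;> simp

theorem treeListOf_sublist (p : Lab × Forest) (y : Tab.Ctx) : (treeListOf n q k p y).Sublist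
    ((cons p.1 p.2 nil).labels.flatMap fun p => if p.1.mark = 0 then [] else [p.1]) := by
  -- The tree is viewed as the only child of an auxiliary node of kind 1, which hands its context on
  -- unchanged.
  have h := listOf_sublist (n := n) (q := q) (k := k) (ofList [p]) ⟨1, 0, 0⟩ [] y 0
  have e : ctxOf n q k ⟨1, 0, 0⟩ [] y 0 = y := rfl
  simpa [listOf, e, treeListOf] using h

end Forest

theorem Fin.exists_lt_succ {m : ℕ} (i : Fin m) (P : Fin m → Prop) :
    (∃ j : Fin m, (j : ℕ) < i + 1 ∧ P j) ↔ (∃ j : Fin m, (j : ℕ) < i ∧ P j) ∨ P i := by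
  constructor
  · rintro ⟨j, hj, h⟩
    rcases Nat.lt_succ_iff_lt_or_eq.1 hj with hj | hj
    · exact .inl ⟨j, hj, h⟩
    · rw [Fin.val_inj] at hj; exact .inr (hj ▸ h)
  · rintro (⟨j, hj, h⟩ | h)
    · exact ⟨j, by omega, h⟩
    · exact ⟨i, by omega, h⟩

theorem Fin.forall_lt_succ {m : ℕ} (i : Fin m) (P : Fin m → Prop) :
    (∀ j : Fin m, (j : ℕ) < i + 1 → P j) ↔ (∀ j : Fin m, (j : ℕ) < i → P j) ∧ P i := by
  constructor
  · exact fun h => ⟨fun j hj => h j (by omega), h i (by omega)⟩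
  · rintro ⟨h, h'⟩ j hj
    rcases Nat.lt_succ_iff_lt_or_eq.1 hj with hj | hj
    · exact h j hj
    · rw [Fin.val_inj] at hj; exact hj ▸ h'

theorem and_and_and_or_iff {a b c d : Prop} : a ∧ b ∧ (a ∧ c ∨ d) ↔ (a ∧ b) ∧ (c ∨ d) := by tauto

theorem RTree.good_subst {σ : Type*} {r : σ → ℕ} {S : Set σ} {d : σ} {L : Set (RTree r)}
    (hL : ∀ v ∈ L, Good S v) {t : RTree r} (ht : Good S t) : ∀ u ∈ subst d L t, Good S u := by
  induction t with
  | node f ts ih =>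
    intro u hu
    rw [subst] at hu
    split at hu
    · exact hL u hu
    · obtain ⟨us, hus, rfl⟩ := hu
      exact ⟨ht.1, fun i => ih i (ht.2 i) _ (hus i)⟩

/-! ### Correctness of the first pass -/

namespace RegExp

open RTree Tab Forest

variable {σ : Type*} {r : σ → ℕ} {n : ℕ}

/-- The constants with numbers in `S`. -/
def leaves (num : σ ≃ Fin n) (S : List ℕ) : Set (σ × ℕ) := {x | x.2 = 0 ∧ (num x.1 : ℕ) ∈ S}

/-- The constants of an expression are unmarked, the other symbols are marked, and the mark of `p`
occurs at no other symbol. -/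
def Fits (p : σ × ℕ) : RegExp (markedRank r) → Prop
  | zero => True
  | sym f args => ((r f.1 = 0 ↔ f.2 = 0) ∧ (r f.1 ≠ 0 → f.2 = p.2 → f = p)) ∧ ∀ i, Fits p (args i)
  | plus E₁ E₂ => Fits p E₁ ∧ Fits p E₂
  | dot c _ E₁ E₂ => c.2 = 0 ∧ Fits p E₁ ∧ Fits p E₂
  | star c _ E₁ => c.2 = 0 ∧ Fits p E₁

theorem fits_of_wellMarked {p : σ × ℕ} {E : RegExp (markedRank r)} (hE : E.WellMarked)
    (h : ∀ f ∈ E.occurrences, f.2 = p.2 → f = p) : E.Fits p := by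
  induction E with
  | zero => trivial
  | sym f args ih =>
    refine ⟨⟨hE.1, fun hf => h f ?_⟩, fun i => ih i (hE.2 i) fun g hg => h g ?_⟩
    · simp [occurrences, hf]
    · exact List.mem_append_right _ (List.mem_flatten.2 ⟨_, (List.mem_ofFn' _ _).2 ⟨i, rfl⟩, hg⟩)
  | plus E₁ E₂ h₁ h₂ =>
    exact ⟨h₁ hE.1 fun g hg => h g (List.mem_append_left _ hg),
      h₂ hE.2 fun g hg => h g (List.mem_append_right _ hg)⟩
  | dot c hc E₁ E₂ h₁ h₂ =>
    exact ⟨hE.1, h₁ hE.2.1 fun g hg => h g (List.mem_append_left _ hg),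
      h₂ hE.2.2 fun g hg => h g (List.mem_append_right _ hg)⟩
  | star c hc E₁ h₁ => exact ⟨hE.1, h₁ hE.2 h⟩

/-- All leaves of trees of a marked expression are unmarked constants, so for the whole expression
the constraint that allows all constants is void. -/
theorem good_of_mem_lang {E : RegExp (markedRank r)} (hE : E.WellMarked) :
    ∀ t ∈ E.lang, Good {x | x.2 = 0} t := by
  induction E with
  | zero => exact fun t ht => ht.elim
  | sym f args ih =>
    rintro _ ⟨ts, hts, rfl⟩
    exact ⟨hE.1.1, fun i => ih i (hE.2 i) _ (hts i)⟩
  | plus E₁ E₂ h₁ h₂ =>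
    rintro t (ht | ht)
    · exact h₁ hE.1 t ht
    · exact h₂ hE.2 t ht
  | dot c hc E₁ E₂ h₁ h₂ =>
    intro u hu
    obtain ⟨t, ht, hu⟩ := mem_cProd.1 hu
    exact good_subst (h₂ hE.2.2) (h₁ hE.2.1 t ht) u hu
  | star c hc E₁ h₁ =>
    intro u hu
    obtain ⟨i, hu⟩ := Set.mem_iUnion.1 hu
    have : ∀ i, ∀ u ∈ cIter c E₁.lang i, Good {x | x.2 = 0} u := by
      intro i
      induction i with
      | zero =>
        rintro _ ⟨ts, rfl⟩
        exact ⟨fun _ => hE.1, fun j => (hc ▸ j : Fin 0).elim0⟩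
      | succ i ih =>
        rintro u (hu | hu)
        · exact ih u hu
        · obtain ⟨t, ht, hu⟩ := mem_cProd.1 hu
          exact good_subst ih (h₁ hE.2 t ht) u hu
    exact this i u hu

variable {num : σ ≃ Fin n} {p : σ × ℕ} {k : ℕ}

theorem leaves_updL {S : List ℕ} {d : σ} {b : Bool} {P : Prop} (h : b = true ↔ P) :
    leaves num (updL n S (num d) b) = upd (leaves num S) (d, 0) P := by
  ext ⟨c, j⟩
  have hcd : (num c : ℕ) = num d ↔ c = d := by rw [Fin.val_inj, num.apply_eq_iff_eq]
  simp only [leaves, updL, upd, Set.mem_ofPred_eq, List.mem_filter, List.mem_range,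
    (num c).isLt, true_and, Bool.or_eq_true, Bool.and_eq_true, beq_iff_eq, hcd, h,
    Bool.not_eq_true', beq_eq_false_iff_ne, ne_eq, decide_eq_true_eq, Prod.mk.injEq]
  tauto

/-- The table `x` has the entries that are possible for `E`. -/
def Represents (num : σ ≃ Fin n) (p : σ × ℕ) (k : ℕ) (x : Tab) (E : RegExp (markedRank r)) : Prop :=
  ∀ S ∈ subs n, ∀ (c : σ) (y : ℕ), y < 4 →
    (has x S (num c) y = true ↔ Poss p k E.lang (leaves num S) (c, 0) y)

theorem Represents.three {x : Tab} {E : RegExp (markedRank r)} (h : Represents num p k x E)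
    {S : List ℕ} (hS : S ∈ subs n) (c : σ) :
    has x S (num c) 3 = true ↔ ∃ t ∈ E.lang, Good (leaves num S) t := by
  rw [h S hS c 3 (by omega), poss_three_iff]

theorem Represents.leaves_leftL {x : Tab} {E : RegExp (markedRank r)}
    (h : Represents num p k x E) {S : List ℕ} (hS : S ∈ subs n) (d : σ) :
    leaves num (leftL n x S (num d)) = leftSet E.lang (leaves num S) (d, 0) :=
  leaves_updL (h.three hS d)

theorem Represents.starNE_iff {x : Tab} {E : RegExp (markedRank r)}
    (h : Represents num p k x E) {S : List ℕ} (hS : S ∈ subs n) (d : σ) :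
    starNE x S (num d) = true ↔ StarNonempty E.lang (leaves num S) (d, 0) := by
  simp [starNE, StarNonempty, h.three hS d, leaves]

theorem Represents.leaves_starL {x : Tab} {E : RegExp (markedRank r)}
    (h : Represents num p k x E) {S : List ℕ} (hS : S ∈ subs n) (d : σ) :
    leaves num (starL n x S (num d)) = starSet E.lang (leaves num S) (d, 0) :=
  leaves_updL (h.starNE_iff hS d)

theorem has_fin {kind d : ℕ} {acc : List Tab} {S : List ℕ} (hS : S ∈ subs n) (c : σ) {y : ℕ}
    (hy : y < 4) : has (Tab.fin n kind d acc) S (num c) y = finHas n kind d acc S (num c) y := by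
  rw [Bool.eq_iff_iff, Tab.fin, has_mk]
  simp [hS, hy]

/-- The table of the left factor is consulted at the modified leaf set, that of the right factor at
`S`; the cases are the four descriptions of a product. -/
theorem represents_dot {x₁ x₂ : Tab} {E₁ E₂ : RegExp (markedRank r)} {d : σ}
    {hd : markedRank r (d, 0) = 0} (h₁ : Represents num p k x₁ E₁) (h₂ : Represents num p k x₂ E₂) :
    Represents num p k (Tab.fin n 2 (num d) [x₁, x₂]) (dot (d, 0) hd E₁ E₂) := by
  intro S hS c y hy
  have hcd : (num c : ℕ) = num d ↔ c = d := by rw [Fin.val_inj, num.apply_eq_iff_eq]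
  have h₁' := h₁ (leftL n x₂ S (num d)) (updL_mem_subs ..)
  have h₂' := h₂ S hS
  rw [h₂.leaves_leftL hS d] at h₁'
  have e : finHas n 2 (num d) [x₁, x₂] S (num c) y = dotHas n (num d) x₁ x₂ S (num c) y := by
    simp [finHas, Tab.fst, Tab.snd]
  rw [has_fin hS c hy, e]
  interval_cases y
  · simp [dotHas, h₁', h₂', lang, poss_cProd_zero hd, hcd]
  · simp [dotHas, h₁', h₂', lang, poss_cProd_one hd, hcd]
  · simp [dotHas, h₁', h₂', lang, poss_cProd_two hd, hcd]
  · simp [dotHas, h₁', lang, poss_cProd_three hd]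

theorem represents_star {x : Tab} {E : RegExp (markedRank r)} {d : σ}
    {hd : markedRank r (d, 0) = 0} (h : Represents num p k x E) :
    Represents num p k (Tab.fin n 3 (num d) [x]) (star (d, 0) hd E) := by
  intro S hS c y hy
  have hcd : (num c : ℕ) = num d ↔ c = d := by rw [Fin.val_inj, num.apply_eq_iff_eq]
  have h' := h (starL n x S (num d)) (updL_mem_subs ..)
  have hN := h.starNE_iff hS d
  have hm : (d, 0) ∈ leaves num S ↔ (num d : ℕ) ∈ S := by simp [leaves]
  rw [h.leaves_starL hS d] at h'
  have e : finHas n 3 (num d) [x] S (num c) y = starHas n (num d) x S (num c) y := by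
    simp [finHas, Tab.fst]
  rw [has_fin hS c hy, lang, poss_cClosure hd, e]
  interval_cases y
  · simp [starHas, h', StarPoss, hcd, hm]
  · simp [starHas, h', StarPoss, hcd, hm]
  · simp [starHas, h', StarPoss, hcd, hm]
  · simp [starHas, StarPoss, hN]

theorem represents_plus {x₁ x₂ : Tab} {E₁ E₂ : RegExp (markedRank r)}
    (h₁ : Represents num p k x₁ E₁) (h₂ : Represents num p k x₂ E₂) :
    Represents num p k (Tab.fin n 1 0 [x₁, x₂]) (plus E₁ E₂) := by
  intro S hS c y hy
  rw [has_fin hS c hy, lang, poss_union, ← h₁ S hS c y hy, ← h₂ S hS c y hy]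
  simp [finHas, Tab.fst, Tab.snd]

theorem represents_zero : Represents num p k (Tab.fin n 0 0 []) (zero : RegExp (markedRank r)) := by
  intro S hS c y hy
  rw [has_fin hS c hy]
  simp [finHas, lang, Poss]

/-- The accumulator represents the first `i` arguments of the symbol `f`. -/
def Accumulates (num : σ ≃ Fin n) (p : σ × ℕ) (k : ℕ) (f : σ × ℕ)
    (args : Fin (r f.1) → RegExp (markedRank r)) (i : ℕ) (acc : List Tab) : Prop :=
  (acc.isEmpty = true ↔ i = 0) ∧ ∀ S ∈ subs n, ∀ (c : σ) (y : ℕ), y < 4 →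
    (accHas acc S (num c) y = true ↔
      (∀ j : Fin (r f.1), (j : ℕ) < i → ∃ t ∈ (args j).lang, Good (leaves num S) t) ∧
      (y = 3 ∨ (y = 1 ∧ ∃ j : Fin (r f.1), (j : ℕ) < i ∧ (Poss p k (args j).lang (leaves num S) (c, 0) 1 ∨
        ((f = p ∧ (j : ℕ) = k) ∧ Poss p k (args j).lang (leaves num S) (c, 0) 0))) ∨
      (y = 2 ∧ ∃ j : Fin (r f.1), (j : ℕ) < i ∧
        Poss p k (args j).lang (leaves num S) (c, 0) 2)))

/-- The machine compares only marks; this suffices because the mark of the target determines its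
symbol. -/
theorem flag_eq_one {f : σ × ℕ} (hf : f.2 = p.2 → f = p) (i : ℕ) :
    flag p.2 k f.2 i = 1 ↔ f = p ∧ i = k := by
  have : f.2 = p.2 ↔ f = p := ⟨hf, fun h => h ▸ rfl⟩
  simp [flag, this]

/-- Nonemptiness of the arguments is combined by conjunction in every entry, because a property
realized in one argument needs admissible trees in all the others. The flag contributes the edge
from the node to this child. -/
theorem accumulates_step {f : σ × ℕ} {args : Fin (r f.1) → RegExp (markedRank r)}
    (hf : f.2 = p.2 → f = p) {i : Fin (r f.1)} {acc : List Tab} {x : Tab}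
    (ha : Accumulates num p k f args i acc) (hx : Represents num p k x (args i)) :
    Accumulates num p k f args (i + 1) (Tab.step n 4 acc x (flag p.2 k f.2 i)) := by
  refine ⟨by simp [Tab.step], fun S hS c y hy => ?_⟩
  have e : accHas (Tab.step n 4 acc x (flag p.2 k f.2 i)) S (num c) y =
      mergeHas acc x (flag p.2 k f.2 i) S (num c) y := by
    rw [Bool.eq_iff_iff]
    simp [Tab.step, accHas, Tab.fst, has_mk, hS, hy]
  have h1 := ha.2 S hS c 1 (by omega)
  have h2 := ha.2 S hS c 2 (by omega)
  have h3 := ha.2 S hS c 3 (by omega)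
  have hb := flag_eq_one (k := k) hf i
  rw [e, Fin.forall_lt_succ, Fin.exists_lt_succ, Fin.exists_lt_succ, ← hb]
  simp only [mergeHas, Bool.and_eq_true, Bool.or_eq_true, beq_iff_eq, h1, h2, h3,
    hx.three hS c, hx S hS c 0 (by omega), hx S hS c 1 (by omega), hx S hS c 2 (by omega)]
  interval_cases y <;> simp [and_and_and_or_iff]

/-- An empty accumulator signals rank 0, and then `f` is a constant and a possible root. For
positive rank the marked symbol `f` is never one of the tabulated constants, so the accumulated
table is already the result. -/
theorem represents_sym {f : σ × ℕ} {args : Fin (markedRank r f) → RegExp (markedRank r)}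
    (hf : r f.1 = 0 ↔ f.2 = 0) {acc : List Tab}
    (ha : Accumulates num p k f args (r f.1) acc) :
    Represents num p k (Tab.fin n 4 (num f.1) acc) (sym f args) := by
  intro S hS c y hy
  have h := ha.2 S hS c y hy
  rw [has_fin hS c hy, poss_sym]
  by_cases h0 : r f.1 = 0
  · have he := ha.1.2 h0
    have : IsEmpty (Fin (markedRank r f)) := by rw [markedRank, h0]; infer_instance
    obtain ⟨d, j⟩ := f
    obtain rfl : j = 0 := hf.1 h0
    have hcd : (num c : ℕ) = num d ↔ d = c := by rw [Fin.val_inj, num.apply_eq_iff_eq, eq_comm]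
    have hm : (d, 0) ∈ leaves num S ↔ (num d : ℕ) ∈ S := by simp [leaves]
    simp only [finHas, he, leafHas]
    interval_cases y <;> simp [SymPoss, h0, hm, hcd]
  · have he : acc.isEmpty = false := by
      rw [← Bool.not_eq_true, ha.1]; exact h0
    have hne : f ≠ (c, 0) := fun h => h0 (hf.2 (by rw [h]))
    rw [accHas] at h
    simp only [he, Bool.false_and, Bool.false_or, Bool.not_false, Bool.true_and,
      Fin.is_lt, true_and, forall_const] at h
    simp only [finHas, he, Bool.false_and, Bool.false_or, Bool.not_false, Bool.true_and]
    interval_cases y <;> simp [h, SymPoss, h0, hne]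

theorem accumulates_tree {f : σ × ℕ} {args : Fin (markedRank r f) → RegExp (markedRank r)}
    (hf : r f.1 ≠ 0 → f.2 = p.2 → f = p)
    (h : ∀ i, Represents num p k (tabOf n p.2 k (tree (fun s => (num s : ℕ)) (args i))) (args i)) :
    Accumulates num p k f args (r f.1) (accOf n p.2 k
      (tree (fun s => (num s : ℕ)) (sym f args)).2 ⟨4, num f.1, f.2⟩ 0 []) := by
  refine accOf_ofFn (Inv := Accumulates num p k f args) ⟨by simp, ?_⟩ fun j a ha =>
    accumulates_step (hf (fun h => (h ▸ j : Fin 0).elim0)) ha (h j)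
  intro S hS c y hy
  simp [accHas]

theorem represents_tree {E : RegExp (markedRank r)} (hE : E.Fits p) :
    Represents num p k (tabOf n p.2 k (tree (fun s => (num s : ℕ)) E)) E := by
  induction E with
  | zero => exact represents_zero
  | sym f args ih => exact represents_sym hE.1.1 (accumulates_tree hE.1.2 fun i => ih i (hE.2 i))
  | plus E₁ E₂ h₁ h₂ => exact represents_plus (h₁ hE.1) (h₂ hE.2)
  | dot c hc E₁ E₂ h₁ h₂ =>
    obtain ⟨d, j⟩ := c
    obtain rfl : j = 0 := hE.1
    exact represents_dot (h₁ hE.2.1) (h₂ hE.2.2)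
  | star c hc E₁ h₁ =>
    obtain ⟨d, j⟩ := c
    obtain rfl : j = 0 := hE.1
    exact represents_star (h₁ hE.2)

end RegExp

namespace Forest

variable {n q k : ℕ}

theorem listOf_one {t : Lab × Forest} {l : Lab} {a : List Tab} {y : Tab.Ctx} :
    listOf n q k (ofList [t]) l a y 0 = treeListOf n q k t (ctxOf n q k l a y 0) := by
  simp [listOf, treeListOf]

theorem listOf_two {t₁ t₂ : Lab × Forest} {l : Lab} {a : List Tab} {y : Tab.Ctx} :
    listOf n q k (ofList [t₁, t₂]) l a y 0 =
      treeListOf n q k t₁ (ctxOf n q k l a y 0) ++ treeListOf n q k t₂ (ctxOf n q k l a y 1) := by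
  simp [listOf, treeListOf]

end Forest

/-! ### Correctness of the second pass -/

namespace RegExp

open RTree Tab Forest

variable {σ : Type*} {r : σ → ℕ} {n : ℕ} {num : σ ≃ Fin n} {p g : σ × ℕ} {k : ℕ}

theorem posLab_inj {f : σ × ℕ} :
    posLab (fun s => (num s : ℕ)) g = posLab (fun s => (num s : ℕ)) f ↔ f = g := by
  simp [posLab, Prod.ext_iff, Fin.val_inj, eq_comm]

theorem posLab_mem_ownOf {l : Lab} {y : Ctx} {x : Tab} :
    posLab (fun s => (num s : ℕ)) g ∈ ownOf l y x ↔
      posLab (fun s => (num s : ℕ)) g = l ∧ l.mark ≠ 0 ∧ emit l.sym y x = true := by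
  unfold ownOf
  split
  · simp_all
  · simp_all

theorem mem_treeListOf_unmarked {q a b : ℕ} {c : Forest} {y : Ctx} {l : Lab} :
    l ∈ treeListOf n q k (⟨a, b, 0⟩, c) y ↔
      l ∈ listOf n q k c ⟨a, b, 0⟩ (accOf n q k c ⟨a, b, 0⟩ 0 []) y 0 := by
  simp [treeListOf, ownOf]

/-- Here `a` and `w` are the flags of the context. The index is the number of the property; `p` and
`d` refer to `g` and to the substituted constant in the left factor, `q` to `g` in the right factor.
The left side reads off the contexts of the factors, the right side the description of the product.
-/
theorem dot_logic {a w p₀ p₁ d₀ d₁ d₂ q₀ q₁ : Prop} :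
    (a ∧ p₁ ∨ w ∧ p₀) ∨ ((a ∧ d₂) ∧ q₁ ∨ (a ∧ d₁ ∨ w ∧ d₀) ∧ q₀) ↔
      a ∧ (p₁ ∨ d₁ ∧ q₀ ∨ d₂ ∧ q₁) ∨ w ∧ (p₀ ∨ d₀ ∧ q₀) := by tauto

theorem sym_logic {ι : Sort*} {a w c f : Prop} {p q b : ι → Prop} :
    (f ∧ w ∧ c ∨ ∃ j, (a ∧ c) ∧ p j ∨ (b j ∧ a ∧ c) ∧ q j) ↔
      (a ∧ c ∧ ∃ i, p i ∨ b i ∧ q i) ∨ w ∧ c ∧ f := by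
  constructor
  · rintro (⟨h₁, h₂, h₃⟩ | ⟨j, ⟨⟨h₁, h₂⟩, h₃⟩ | ⟨⟨h₀, h₁, h₂⟩, h₃⟩⟩)
    · exact .inr ⟨h₂, h₃, h₁⟩
    · exact .inl ⟨h₁, h₂, j, .inl h₃⟩
    · exact .inl ⟨h₁, h₂, j, .inr ⟨h₀, h₃⟩⟩
  · rintro (⟨h₁, h₂, j, h₃ | ⟨h₀, h₃⟩⟩ | ⟨h₁, h₂, h₃⟩)
    · exact .inr ⟨j, .inl ⟨⟨h₁, h₂⟩, h₃⟩⟩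
    · exact .inr ⟨j, .inr ⟨⟨h₀, h₁, h₂⟩, h₃⟩⟩
    · exact .inl ⟨h₃, h₁, h₂⟩

/-- A tree of the argument has its root at the target if the tree of the closure is there and this
is its top layer, or if in some layer the substituted constant is there. The flag `a` is passed on
unchanged, since a tree of the argument can be the top layer. -/
theorem star_logic {a w p₀ p₁ d₁ : Prop} :
    a ∧ p₁ ∨ (w ∨ a ∧ d₁) ∧ p₀ ↔ a ∧ (p₁ ∨ d₁ ∧ p₀) ∨ w ∧ p₀ := by tauto

/-- The position `f` itself is listed if its trees stand at the target and all arguments have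
admissible trees. The flag `w` says nothing about the children: their roots are at the target
exactly if `f = p`, the child number is `k`, and trees of this node occur at all. -/
theorem posLab_mem_sym {f : σ × ℕ} {args : Fin (markedRank r f) → RegExp (markedRank r)}
    (hE : (sym f args).Fits p) (hg : g.2 ≠ 0)
    (ih : ∀ i, ∀ y : Ctx, y.1 ∈ subs n → (posLab (fun s => (num s : ℕ)) g ∈
        treeListOf n p.2 k (tree (fun s => (num s : ℕ)) (args i)) y ↔
      (y.2.1 = true ∧ Poss p k (args i).lang (leaves num y.1) g 1) ∨
      (y.2.2 = true ∧ Poss p k (args i).lang (leaves num y.1) g 0))) (y : Ctx)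
    (hy : y.1 ∈ subs n) : posLab (fun s => (num s : ℕ)) g ∈
        treeListOf n p.2 k (tree (fun s => (num s : ℕ)) (sym f args)) y ↔
      (y.2.1 = true ∧ Poss p k (sym f args).lang (leaves num y.1) g 1) ∨
      (y.2.2 = true ∧ Poss p k (sym f args).lang (leaves num y.1) g 0) := by
  have hrep : Represents num p k _ (sym f args) := represents_tree (num := num) (k := k) hE
  have hacc := accumulates_tree (num := num) (k := k) hE.1.2 fun i => represents_tree (hE.2 i)
  obtain ⟨S, a, w⟩ := y
  have h3 := hrep.three hy f.1
  rw [← poss_three_iff (p := p) (k := k) (g := g), poss_sym] at h3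
  rw [treeListOf, List.mem_append, posLab_mem_ownOf, poss_sym, poss_sym]
  simp only [tree] at hacc ⊢
  rw [mem_listOf_ofFn]
  by_cases h0 : r f.1 = 0
  · have hf : f.2 = 0 := hE.1.1.1 h0
    have : IsEmpty (Fin (markedRank r f)) := by rw [markedRank, h0]; infer_instance
    have hne : f ≠ g := fun h => hg (h ▸ hf)
    simp [hf, SymPoss, hne]
  · have hf : f.2 ≠ 0 := fun h => h0 (hE.1.1.2 h)
    have he := Bool.eq_false_of_not_eq_true (fun h => h0 (hacc.1.1 h))
    have hN := hacc.2 S hy f.1 3 (by omega)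
    simp only [accHas, he, Bool.false_and, Bool.false_or, Bool.not_false, Bool.true_and,
      true_or, and_true] at hN
    have hN' : has (Tab.fst (accOf n p.2 k (ofList (List.ofFn fun i =>
        tree (fun s => (num s : ℕ)) (args i))) ⟨4, num f.1, f.2⟩ 0 [])) S (num f.1) 3 = true ↔
        ∀ j : Fin (r f.1), ∃ t ∈ (args j).lang, Good (leaves num S) t :=
      hN.trans ⟨fun h j => h j j.isLt, fun h j _ => h j⟩
    have hw : ∀ j : Fin (markedRank r f), flag p.2 k f.2 j = 1 ↔ f = p ∧ (j : ℕ) = k := fun j =>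
      flag_eq_one (hE.1.2 h0) j
    generalize accOf n p.2 k (ofList (List.ofFn fun i =>
        tree (fun s => (num s : ℕ)) (args i))) ⟨4, num f.1, f.2⟩ 0 [] = acc at *
    -- The leaf constraint is passed to the arguments unchanged, so the hypothesis on `S` serves for
    -- every child.
    have hc : ∀ j : Fin (markedRank r f), _ := fun j =>
      ih j (ctxOf n p.2 k ⟨4, num f.1, f.2⟩ acc (S, a, w) j) hy
    change ∀ j : Fin (markedRank r f), _ ↔
      ((a && has (Tab.fst acc) S (num f.1) 3) = true ∧ Poss p k (args j).lang (leaves num S) g 1) ∨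
      (((flag p.2 k f.2 j == 1) && (a && has (Tab.fst acc) S (num f.1) 3)) = true ∧
        Poss p k (args j).lang (leaves num S) g 0) at hc
    simp only [hc, Bool.and_eq_true, hN', beq_iff_eq, hw]
    have hl : posLab (fun s => (num s : ℕ)) g = ⟨4, num f.1, f.2⟩ ↔ f = g := posLab_inj
    have h3' : has (tabOf n p.2 k (⟨4, num f.1, f.2⟩, ofList (List.ofFn fun i =>
        tree (fun s => (num s : ℕ)) (args i)))) S (num f.1) 3 = true ↔
        ∀ j : Fin (r f.1), ∃ t ∈ (args j).lang, Good (leaves num S) t := by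
      simpa [SymPoss, h0, tree] using h3
    simp only [emit, Bool.and_eq_true, SymPoss, h0, hf, hl, h3', ne_eq, not_false_eq_true, true_and,
      false_imp_iff]
    exact sym_logic

/-- The flag `a` asks for an edge to `g` inside a tree of `E`, the flag `w` for `g` as the root of
such a tree. As `g` is marked, it is never the constant of a product or closure, and the rules for
contexts become the descriptions of properties 0 and 1. -/
theorem posLab_mem_treeListOf {E : RegExp (markedRank r)} (hE : E.Fits p) (hg : g.2 ≠ 0) :
    ∀ y : Ctx, y.1 ∈ subs n → (posLab (fun s => (num s : ℕ)) g ∈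
        treeListOf n p.2 k (tree (fun s => (num s : ℕ)) E) y ↔
      (y.2.1 = true ∧ Poss p k E.lang (leaves num y.1) g 1) ∨
      (y.2.2 = true ∧ Poss p k E.lang (leaves num y.1) g 0)) := by
  induction E with
  | zero =>
    intro y _
    simp [tree, mem_treeListOf_unmarked, listOf, lang, Poss]
  | sym f args ih => exact posLab_mem_sym hE hg fun i => ih i (hE.2 i)
  | plus E₁ E₂ h₁ h₂ =>
    intro y hy
    have e : ∀ a i, ctxOf n p.2 k ⟨1, 0, 0⟩ a y i = y := fun _ _ => rfl
    rw [tree, mem_treeListOf_unmarked, listOf_two, List.mem_append]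
    simp only [e, lang, poss_union, h₁ hE.1 y hy, h₂ hE.2 y hy, and_or_left]
    exact or_or_or_comm ..
  | dot c hc E₁ E₂ h₁ h₂ =>
    obtain ⟨d, j⟩ := c
    obtain rfl : j = 0 := hE.1
    intro y hy
    obtain ⟨S, a, w⟩ := y
    have r₁ := represents_tree (num := num) (k := k) hE.2.1
    have r₂ := represents_tree (num := num) (k := k) hE.2.2
    have hS := updL_mem_subs n S (num d) (has (tabOf n p.2 k (tree (fun s => (num s : ℕ)) E₂)) S
      (num d) 3)
    have hl := r₂.leaves_leftL hy d
    have r := r₁ _ hS d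
    have e₁ := h₁ hE.2.1 (leftL n (tabOf n p.2 k (tree (fun s => (num s : ℕ)) E₂)) S (num d), a, w)
      hS
    have e₂ := h₂ hE.2.2 (S,
      a && has (tabOf n p.2 k (tree (fun s => (num s : ℕ)) E₁))
        (leftL n (tabOf n p.2 k (tree (fun s => (num s : ℕ)) E₂)) S (num d)) (num d) 2,
      a && has (tabOf n p.2 k (tree (fun s => (num s : ℕ)) E₁))
        (leftL n (tabOf n p.2 k (tree (fun s => (num s : ℕ)) E₂)) S (num d)) (num d) 1 ||
      w && has (tabOf n p.2 k (tree (fun s => (num s : ℕ)) E₁))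
        (leftL n (tabOf n p.2 k (tree (fun s => (num s : ℕ)) E₂)) S (num d)) (num d) 0) hy
    have hne : g ≠ (d, 0) := fun h => hg (by rw [h])
    rw [tree, mem_treeListOf_unmarked, listOf_two, List.mem_append]
    refine (or_congr e₁ e₂).trans ?_
    change leaves num (updL n S (num d) _) = _ at hl
    simp only [lang, poss_cProd_zero hc, poss_cProd_one hc, hne, leftL, hl, Bool.and_eq_true,
      Bool.or_eq_true, r 0 (by omega), r 1 (by omega), r 2 (by omega), ne_eq, not_false_eq_true,
      true_and]
    exact dot_logic
  | star c hc E₁ h₁ =>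
    obtain ⟨d, j⟩ := c
    obtain rfl : j = 0 := hE.1
    intro y hy
    obtain ⟨S, a, w⟩ := y
    have r₁ := represents_tree (num := num) (k := k) hE.2
    have hS := updL_mem_subs n S (num d) (starNE (tabOf n p.2 k
      (tree (fun s => (num s : ℕ)) E₁)) S (num d))
    have hl := r₁.leaves_starL hy d
    have r := r₁ _ hS d
    have e₁ := h₁ hE.2 (starL n (tabOf n p.2 k (tree (fun s => (num s : ℕ)) E₁)) S (num d), a,
      w || a && has (tabOf n p.2 k (tree (fun s => (num s : ℕ)) E₁))
        (starL n (tabOf n p.2 k (tree (fun s => (num s : ℕ)) E₁)) S (num d)) (num d) 1) hS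
    have hne : g ≠ (d, 0) := fun h => hg (by rw [h])
    rw [tree, mem_treeListOf_unmarked, listOf_one]
    refine e₁.trans ?_
    change leaves num (updL n S (num d) _) = _ at hl
    simp only [lang, poss_cClosure hc, StarPoss, hne, Tab.starL, hl, Bool.and_eq_true,
      Bool.or_eq_true, r 1 (by omega), ne_eq, not_false_eq_true, true_and, false_and, false_or]
    exact star_logic

end RegExp

/-! ### One block of the output -/

namespace RegExp

open RTree Tab Forest

variable {σ : Type*} {r : σ → ℕ} {n : ℕ}

theorem leaves_range (num : σ ≃ Fin n) : leaves num (List.range n) = {x | x.2 = 0} := by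
  ext x
  simp [leaves]

/-- With all constants allowed the leaf constraint disappears, and Follow is property 1 of the whole
language. -/
theorem follow_iff_poss {num : σ ≃ Fin n} {E : RegExp (markedRank r)} (hE : E.WellMarked)
    {p g : σ × ℕ} {k : Fin (markedRank r p)} :
    g ∈ E.follow p k ↔ Poss p k E.lang (leaves num (List.range n)) g 1 := by
  rw [mem_follow_iff, leaves_range]
  exact ⟨fun ⟨t, ht, h⟩ => ⟨t, ht, good_of_mem_lang hE t ht, h⟩, fun ⟨t, ht, _, h⟩ => ⟨t, ht, h⟩⟩

theorem mark_ne_zero {E : RegExp r} {f : σ × ℕ} (hf : f ∈ E.linearize.occurrences) : f.2 ≠ 0 := by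
  have h := List.mem_map_of_mem (f := Prod.snd) hf
  rw [linearize, marks_occurrences, List.mem_range'_1] at h
  omega

theorem nodup_marks (E : RegExp r) : (E.linearize.occurrences.map Prod.snd).Nodup := by
  rw [linearize, marks_occurrences]
  exact List.nodup_range'

theorem fits_linearize {E : RegExp r} {p : σ × ℕ} (hp : p ∈ E.linearize.occurrences) :
    E.linearize.Fits p :=
  fits_of_wellMarked (E.wellMarked_markFrom 1 le_rfl) fun _ hf h =>
    List.inj_on_of_nodup_map E.nodup_marks hf hp h

/-- The block is made of the positions listed by the second pass and the constants found in the
table of the root. The root context has `a` true and `w` false, so for positions, too, exactly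
property 1 remains. -/
theorem exists_block (num : σ ≃ Fin n) (E : RegExp r) {p : σ × ℕ}
    (hp : p ∈ E.linearize.occurrences) (k : Fin (markedRank r p)) :
    ∃ b : List (σ × ℕ), (b.Nodup ∧ ∀ g, g ∈ b ↔ g ∈ E.linearize.follow p k) ∧
      blockOut kernel n p.2 k (tree (fun s => (num s : ℕ)) E.linearize).1
        (tree (fun s => (num s : ℕ)) E.linearize).2 = b.map (outCode num) ++ [0] := by
  have hE : E.linearize.WellMarked := E.wellMarked_markFrom 1 le_rfl
  have hfit := fits_linearize hp
  set T := tree (fun s => (num s : ℕ)) E.linearize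
  -- The machine produces labels and numbers. As sublists of the encoded positions and constants
  -- they lift to lists of symbols without repetitions.
  have hsub : (treeListOf n p.2 k T (root n)).Sublist
      (E.linearize.occurrences.map (posLab fun s => (num s : ℕ))) := by
    convert treeListOf_sublist T (root n) using 1
    change _ = (treeLabels (fun s => (num s : ℕ)) E.linearize).flatMap _
    rw [flatMap_treeLabels _ (fun p hp => by simp [hp]) hE, List.map_eq_flatMap]
    refine List.flatMap_congr fun f hf => ?_
    simp [posLab, mark_ne_zero hf]
  obtain ⟨b, hb, hb'⟩ := List.sublist_map_iff.1 hsub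
  have hr : List.range n = ((List.finRange n).map num.symm).map fun s => (num s : ℕ) := by
    simp [Function.comp_def]
  have hsub' : ((List.range n).filter fun c => Tab.const n (tabOf n p.2 k T) c).Sublist
      (((List.finRange n).map num.symm).map fun s => (num s : ℕ)) := by
    rw [← hr]; exact List.filter_sublist
  obtain ⟨c, hc, hc'⟩ := List.sublist_map_iff.1 hsub'
  have hb0 : ∀ g ∈ b, g.2 ≠ 0 := fun g hg => mark_ne_zero (hb.subset hg)
  refine ⟨b ++ c.map fun s => (s, 0), ⟨?_, fun g => ?_⟩, ?_⟩
  · refine List.Nodup.append ((List.Nodup.of_map _ E.nodup_marks).sublist hb) ?_ ?_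
    · exact (((List.nodup_finRange n).map num.symm.injective).sublist hc).map fun a b h => by
        simpa using h
    · intro g hg hg'
      obtain ⟨s, -, rfl⟩ := List.mem_map.1 hg'
      exact hb0 _ hg rfl
  · rw [follow_iff_poss (num := num) hE, List.mem_append]
    by_cases hg : g.2 = 0
    · obtain ⟨s, j⟩ := g
      obtain rfl : j = 0 := hg
      have h1 : (s, 0) ∉ b := fun h => hb0 _ h rfl
      have h2 : (s, 0) ∈ c.map (fun s => (s, 0)) ↔ s ∈ c := by simp
      have h3 : s ∈ c ↔ (num s : ℕ) ∈ c.map fun s => (num s : ℕ) := by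
        simp [Fin.val_inj]
      rw [h2, h3, ← hc', List.mem_filter]
      have := represents_tree (num := num) (k := k) hfit _ (range_mem_subs n) s 1 (by omega)
      simp only [h1, false_or, List.mem_range, (num s).isLt, true_and]
      exact this
    · have h2 : g ∉ c.map (fun s => (s, 0)) := fun h => by
        obtain ⟨s, -, rfl⟩ := List.mem_map.1 h
        exact hg rfl
      have h3 : g ∈ b ↔ posLab (fun s => (num s : ℕ)) g ∈
          b.map (posLab fun s => (num s : ℕ)) := by
        simp [List.mem_map, eq_comm (b := posLab _ g), posLab_inj]
      rw [h3, ← hb', posLab_mem_treeListOf hfit hg _ (range_mem_subs n)]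
      simp [h2, Tab.root]
  · rw [blockOut, constListed_kernel, treeListed_kernel, hb', hc']
    simp only [List.map_map, List.map_append]
    congr 2
    · refine List.map_congr_left fun g hg => ?_
      simp [outCode, hb0 g hg, posLab]

end RegExp

/-! ### The theorem -/

theorem tokenRow_of_getD {A : ℕ → ℕ → ℕ} {L : List (Lab × ℕ)} : ∀ {o : ℕ},
    (∀ i < L.length, (A 1 (o + i), A 2 (o + i)) =
      (L.map fun p => (p.1.kind, p.1.sym)).getD i (0, 0)) → TokenRow A L o := by
  induction L with
  | nil => exact fun _ => trivial
  | cons p L ih =>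
    intro o h
    have h0 := h 0 (by simp)
    simp only [Nat.add_zero, List.map_cons, List.getD_cons_zero, Prod.mk.injEq] at h0
    refine ⟨h0, ih fun i hi => ?_⟩
    have := h (i + 1) (by simpa using hi)
    rw [List.map_cons, List.getD_cons_succ] at this
    rw [← this, Nat.add_assoc, Nat.add_comm 1]

theorem mainTheorem3 :
    ∃ (P : Prog) (C : ℕ → ℕ),
      ∀ (σ : Type*) (r : σ → ℕ) (n : ℕ) (num : σ ≃ Fin n) (E : RegExp r),
        ∃ (t : ℕ) (m : Machine),
          Runs P (inputMachine num E) t m ∧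
          IsFollowTable num E m.out ∧
          t ≤ C n * (max 1 (E.maxRank * E.width) * E.size) := by
  obtain ⟨I⟩ := Tab.nonempty_impl
  choose B hB using Tab.exists_closed
  -- The summand 50 covers the preparation and the loop over the nodes, `I.blockTime` the passes for
  -- one target, and 4 the overhead of the loop over the targets, each per node.
  refine ⟨I.mainProg, fun n => 50 + I.blockTime (B n) + 4, fun σ r n num E => ?_⟩
  have hmap := E.map_treeLabels (num := fun s => (num s : ℕ)) 1
  have hlen := congrArg List.length hmap
  rw [List.length_map, RegExp.length_tokens] at hlen
  have hsize := hlen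
  rw [RegExp.treeLabels, Forest.length_labels] at hsize
  simp only [Forest.size, Nat.add_zero] at hsize
  have hmk := RegExp.marked_treeLabels (num := fun s => (num s : ℕ))
    (rk := (inputMachine num E).arr 0) (fun s => by simp [inputMachine]) E 0 [] trivial
  rw [List.append_nil] at hmk
  obtain ⟨t, m, hrun, ht, hout⟩ := I.wp_mainProg (hB n) (m := inputMachine num E)
    (RegExp.valid_tree (fun s => (num s).isLt.le) E.linearize)
    (fun x hx => by
      simp only [inputMachine]
      rw [if_neg (by omega), if_neg (by omega)])
    (by simp [inputMachine]) hsize.symm rfl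
    (tokenRow_of_getD fun i _ => by
      change _ = ((RegExp.treeLabels _ (E.markFrom 1)).map _).getD i (0, 0)
      rw [hmap]
      simp [inputMachine])
    hmk (fun i => by simp [inputMachine])
  refine ⟨t, m, hrun, ?_, ht.trans ?_⟩
  -- The blocks must be given for all marked symbols; those that are not positions get the empty
  -- list.
  · have h : ∀ (p : σ × ℕ) (k : Fin (markedRank r p)), ∃ b : List (σ × ℕ),
        p ∈ E.linearize.occurrences → (b.Nodup ∧ ∀ g, g ∈ b ↔ g ∈ E.linearize.follow p k) ∧
        Forest.blockOut Tab.kernel n p.2 k (E.linearize.tree fun s => (num s : ℕ)).1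
          (E.linearize.tree fun s => (num s : ℕ)).2 = b.map (outCode num) ++ [0] := fun p k => by
      by_cases hp : p ∈ E.linearize.occurrences
      · obtain ⟨b, hb⟩ := RegExp.exists_block num E hp k
        exact ⟨b, fun _ => hb⟩
      · exact ⟨[], fun h => absurd h hp⟩
    choose block hblock using h
    refine ⟨block, fun p hp k => (hblock p k hp).1, ?_⟩
    rw [hout]
    change (RegExp.treeLabels (fun s => (num s : ℕ)) (E.markFrom 1)).flatMap _ = _
    rw [RegExp.flatMap_treeLabels _ (fun p hp => by simp [Impl.nodeOut, hp])
      (E.wellMarked_markFrom 1 le_rfl)]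
    refine List.flatMap_congr fun p hp => ?_
    simp only [Impl.nodeOut, RegExp.posLab, RegExp.mark_ne_zero hp, if_false]
    rw [← List.map_coe_finRange_eq_range, List.flatMap_map]
    exact List.flatMap_congr fun k _ => (hblock p k hp).2
  · have h1 : Impl.targets (RegExp.treeLabels (fun s => (num s : ℕ)) E.linearize) ≤ _ :=
      E.targets_treeLabels_le
    have h2 : 1 + (E.linearize.tree fun s => (num s : ℕ)).2.size = E.size := hsize
    rw [h2]
    change 50 * E.size + Impl.targets (RegExp.treeLabels _ E.linearize) * _ ≤ _
    have hs : 1 ≤ E.size := by omega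
    -- The factor `max 1 _` is at least 1, which absorbs the preparation, and at least the number of
    -- targets.
    calc 50 * E.size + Impl.targets (RegExp.treeLabels (fun s => (num s : ℕ)) E.linearize) *
          (I.blockTime (B n) * E.size + 4)
        ≤ max 1 (E.maxRank * E.width) * (50 * E.size) + max 1 (E.maxRank * E.width) *
          (I.blockTime (B n) * E.size + 4 * E.size) := by
          refine Nat.add_le_add (Nat.le_mul_of_pos_left _ (by positivity)) ?_
          exact Nat.mul_le_mul (h1.trans (le_max_right _ _)) (by omega)
      _ = _ := by ring
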